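/- **Setting.** Let $\Gamma=\partial\mathbb R^3_+=\mathbb R^2$ and let $G\subset\mathbb R^2$ be a bounded open Lipschitz set; put $Q=\mathbb R\times G$. Fix $\sigma>0$ and write $\omega=\xi_0+i\sigma$ for $\xi_0\in\mathbb R$. For a distribution $u$ on $\mathbb R\times\mathbb R^2$ let $\hat u(\omega,\xi')$ denote the Fourier transform of $e^{-\sigma t}u$ in time and space at $(\xi_0,\xi')$, and for $s,r\in\mathbb R$ put $$\|u\|_{s,r,\sigma,*}=\Big(\int_{\mathbb R}|\omega|^{2s}\int_{\mathbb R^2}(|\omega|^2+|\xi'|^2)^{r}\,|\hat u(\omega,\xi')|^2\,d\xi'\,d\xi_0\Big)^{1/2}$$ ($=\infty$ if there is no such function $\hat u$). $H^s_\sigma(\mathbb R^+,\tilde H^r(G))$ is the space of those $u$ with $\operatorname{supp}u\subset[0,\infty)\times\overline G$ and $\|u\|_{s,r,\sigma,*}<\infty$, and $H^s_\sigma(\mathbb R^+,\tilde H^r(G))^+$ is its subset of nonnegative distributions. For a distribution $f$ on $Q$ let $\|f\|_{s,r,\sigma}\in[0,\infty]$ be the quotient norm, i.e. the infimum of the norms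 $\|F\|_{s,r,\sigma,*}$ of all extensions $F$ of $f$ to $\mathbb R\times\mathbb R^2$; $H^s_\sigma(\mathbb R^+,H^r(G))$ is the space of those $f$ which vanish for $t<0$ and have $\|f\|_{s,r,\sigma}<\infty$. Let $p_Q$ denote the restriction to $Q$, and let $\langle f,v\rangle_\sigma$ be the extension of $\int_0^\infty e^{-2\sigma t}\int_G f\,\overline v\,dx\,dt$ to the duality between $H^0_\sigma(\mathbb R^+,H^{1/2}(G))$ and $H^0_\sigma(\mathbb R^+,\tilde H^{-1/2}(G))$. The single layer operator of the wave equation on $\Gamma$ is $$V\varphi(t,x)=\frac1{2\pi}\int_{\mathbb R^2}\frac{\varphi(t-|x-y|,y)}{|x-y|}\,dy ,$$ extended to distributions vanishing for $t<0$. **Discretization.** Let $\overline G$ be triangulated by finitely many closed triangles, let $\Delta t>0$, and consider the time mesh $[0,\Delta t),\dots,[(N-1)\Delta t,N\Delta t)$. Let $\tilde V$ be any linear subspace of the tensor product of the piecewise polynomials of degree $p\ge 0$ on the time mesh and the piecewise polynomials of degree $q\ge 0$ on the triangulation (all functions extended by $0$); in particular one may take the subspace generated by those products whose factor in time is continuous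 and vanishes at $t=0$ (if $p\ge1$) and whose factor in space is continuous and vanishes on $\partial G$ (if $q\ge1$). Let $\tilde K^+\subset\tilde V$ be the set of nonnegative functions in $\tilde V$. **Theorem.** For every $\sigma>0$ there is a constant $C>0$, depending only on $\sigma$, with the following property. Let $G$ and the discretization be as above, let $h\in H^{3/2}_\sigma(\mathbb R^+,H^{1/2}(G))$, let $u\in H^{1/2}_\sigma(\mathbb R^+,\tilde H^{-1/2}(G))^+$ satisfy $$\langle p_QVu,v-u\rangle_\sigma\ \ge\ \langle h,v-u\rangle_\sigma\qquad\text{for all }v\in H^{1/2}_\sigma(\mathbb R^+,\tilde H^{-1/2}(G))^+ ,$$ and let $u_{\Delta t,h}\in\tilde K^+$ satisfy $$\langle p_QVu_{\Delta t,h},v-u_{\Delta t,h}\rangle_\sigma\ \ge\ \langle h,v-u_{\Delta t,h}\rangle_\sigma\qquad\text{for all }v\in\tilde K^+ .$$ (If $h$ is not real-valued, the inequalities are understood for the real parts.) Then $$\|u-u_{\Delta t,h}\|_{-\frac12,-\frac12,\sigma,*}^2\ \le\ C\inf_{\phi\in\tilde K^+}\Big(\|h-p_QVu\|_{\frac12,\frac12,\sigma}\,\|u-\phi\|_{-\frac12,-\frac12,\sigma,*}+\|u-\phi\|_{\frac12,-\frac12,\sigma,*}^2\Big),$$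 where $\infty\cdot0=0$. -/

import Mathlib

open MeasureTheory TopologicalSpace
open scoped Distributions FourierTransform ENNReal NNReal

namespace Punch

noncomputable section

/-! ### Space-time -/

/-- The flat boundary `Γ = ∂ℝ³₊ = ℝ²` of the half-space. -/
abbrev Plane := EuclideanSpace ℝ (Fin 2)

/-- Space-time `ℝ × Γ = ℝ × ℝ²`; coordinate `0` is time, coordinates `1, 2` are spatial. -/
abbrev SpaceTime := EuclideanSpace ℝ (Fin 3)

/-- The spatial part of a space-time point (or of a dual variable). -/
def sp (x : SpaceTime) : Plane := !₂[x 1, x 2]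

/-- The space-time point with time `t` and position `y`. -/
def pt (t : ℝ) (y : Plane) : SpaceTime := !₂[t, y 0, y 1]

theorem continuous_sp : Continuous sp := by
  unfold sp
  fun_prop

/-- The cylinder `Q = ℝ × G`. -/
def Q (G : Opens Plane) : Opens SpaceTime :=
  ⟨sp ⁻¹' (G : Set Plane), G.isOpen.preimage continuous_sp⟩

/-- The set `[0,∞) × closure G`. -/
def causalCylinder (G : Opens Plane) : Set SpaceTime :=
  {x | 0 ≤ x 0 ∧ sp x ∈ closure (G : Set Plane)}

/-- `G` is a Lipschitz set: near each boundary point, in suitable Cartesian coordinates, `G` is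
the set of points above the graph of a Lipschitz function. -/
def IsLipschitz (G : Set Plane) : Prop :=
  ∀ x ∈ frontier G, ∃ (R : Plane ≃ₗᵢ[ℝ] Plane) (L : ℝ≥0) (f : ℝ → ℝ) (ε : ℝ),
    LipschitzWith L f ∧ 0 < ε ∧ ∀ y ∈ Metric.ball x ε, y ∈ G ↔ f ((R y) 0) < (R y) 1

/-! ### Distributions

Complex-valued distributions on an open set `Ω` are the elements of Mathlib's `𝓓'(Ω, ℂ)`, continuous
functionals on the space `𝓓(Ω, ℝ)` of real test functions. The definitions below are written for
arbitrary functionals on `𝓓(Ω, ℝ)`, so that they apply at once to distributions, to differences of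
distributions and functions, and to single layer potentials; a functional of finite Sobolev norm
is automatically a distribution, by its representation through its Fourier-Laplace transform. -/

/-- A complex-valued functional on the test functions on `Ω`. -/
abbrev Functional (Ω : Opens SpaceTime) := 𝓓(Ω, ℝ) → ℂ

/-- The regular distribution of a function. -/
def ofFun (f : SpaceTime → ℝ) : Functional ⊤ :=
  fun φ => ((∫ x, f x * φ x : ℝ) : ℂ)

/-- A test function on `Q`, extended by zero. -/
def extendZero {Ω : Opens SpaceTime} (φ : 𝓓(Ω, ℝ)) : 𝓓((⊤ : Opens SpaceTime), ℝ) :=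
  ⟨φ, φ.contDiff, φ.hasCompactSupport, fun _ _ => trivial⟩

/-- The restriction `p_Q` from space-time to `Q = ℝ × G`. -/
def pQ (G : Opens Plane) (u : Functional ⊤) : Functional (Q G) :=
  fun φ => u (extendZero φ)

/-- The translate `x ↦ φ (x + a)` of a test function. -/
def translate (a : SpaceTime) (φ : 𝓓((⊤ : Opens SpaceTime), ℝ)) : 𝓓((⊤ : Opens SpaceTime), ℝ) :=
  ⟨fun x => φ (x + a), φ.contDiff.comp (contDiff_id.add contDiff_const),
    φ.hasCompactSupport.comp_homeomorph (Homeomorph.addRight a), fun _ _ => trivial⟩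

/-- The functional `u` is nonnegative. -/
def Nonneg {Ω : Opens SpaceTime} (u : Functional Ω) : Prop :=
  ∀ φ : 𝓓(Ω, ℝ), (∀ x, 0 ≤ φ x) → 0 ≤ (u φ).re ∧ (u φ).im = 0

/-! ### The single layer operator -/

/-- The single layer operator of the wave equation on the flat boundary `Γ = ℝ²` of `ℝ³₊`,
`V u (t, x) = 2 ∫∫ γ(t - τ, x - y) u(τ, y) dτ dy = (1 / 2π) ∫ u(t - |x - y|, y) / |x - y| dy`,
with the retarded fundamental solution `γ(t, x) = δ(t - |x|) / (4π|x|)`. On distributions it acts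
as the corresponding superposition of translates,
`(V u)(φ) = (1 / 2π) ∫ |z|⁻¹ u(φ(· + (|z|, z))) dz`;
if `u` vanishes for `t < 0`, the integrand vanishes for large `|z|`. -/
def singleLayer (u : Functional ⊤) : Functional ⊤ :=
  fun φ => (1 / (2 * Real.pi) : ℂ) *
    ∫ z : Plane, ((‖z‖⁻¹ : ℝ) : ℂ) * u (translate (pt ‖z‖ z) φ)

/-! ### Space-time Sobolev norms -/

/-- `|ω|` for the complex frequency `ω = 2π ξ₀ + iσ`. The factors `2π` account for the
normalization `exp (-2πi ⟨x, ξ⟩)` of the Fourier transform. -/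
def absOmega (σ : ℝ) (ξ : SpaceTime) : ℝ :=
  ‖((2 * Real.pi * ξ 0 : ℝ) : ℂ) + (σ : ℂ) * Complex.I‖

/-- The weight `|ω|^{2s} (|ω|² + |2πξ'|²)^r`. -/
def weight (s r σ : ℝ) (ξ : SpaceTime) : ℝ :=
  absOmega σ ξ ^ (2 * s) * (absOmega σ ξ ^ 2 + ‖(2 * Real.pi) • sp ξ‖ ^ 2) ^ r

/-- The weighted norm `(∫ |ω|^{2s} ∫ (|ω|² + |ξ'|²)^r |g|² dξ' dω)^{1/2}` of a function on the
frequency side. -/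
def weightedNorm (s r σ : ℝ) (g : SpaceTime → ℂ) : ℝ≥0∞ :=
  (∫⁻ ξ, ENNReal.ofReal (weight s r σ ξ) * ‖g ξ‖ₑ ^ 2) ^ (1 / 2 : ℝ)

/-- On `Ω`, `u` coincides with `e^{σt} 𝓕⁻¹ g`. If `Ω` is the whole space-time, this says that the
function `g` is the Fourier transform of `e^{-σt} u`, that is `g = û(· + iσ)`. If `Ω = Q`, it says
that `u` is the restriction to `Q` of a functional with Fourier-Laplace transform `g`. -/
def HasTransform (σ : ℝ) {Ω : Opens SpaceTime} (u : Functional Ω) (g : SpaceTime → ℂ) : Prop :=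
  AEStronglyMeasurable g volume ∧
  ∀ φ : 𝓓(Ω, ℝ),
    Integrable (fun ξ => g ξ * 𝓕⁻ (fun x : SpaceTime => ((Real.exp (σ * x 0) * φ x : ℝ) : ℂ)) ξ) ∧
    u φ = ∫ ξ, g ξ * 𝓕⁻ (fun x : SpaceTime => ((Real.exp (σ * x 0) * φ x : ℝ) : ℂ)) ξ

/-- The Sobolev norm with time order `s` and space order `r`, equal to `∞` if there is no
representation of finite weighted norm.

* For a functional on the whole space-time the transform `g` is unique and this is
  `‖u‖_{s,r,σ,*}`, the norm of the (already extended by zero) functional on `ℝ × ℝ²`.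
* For a functional on `Q = ℝ × G` this is the quotient norm `‖u‖_{s,r,σ}`, the infimum of the norms
  of all extensions. (Extensions may be chosen at each frequency separately, so this is
  the same as taking the infimum frequency by frequency inside the integral.)

Up to the fixed factor `(2π)^{3/2}`, coming from the normalization of the Fourier transform, these
are the norms defined with angular frequencies. -/
def sobNorm (s r σ : ℝ) {Ω : Opens SpaceTime} (u : Functional Ω) : ℝ≥0∞ :=
  ⨅ (g : SpaceTime → ℂ) (_ : HasTransform σ u g), weightedNorm s r σ g

/-- `u ∈ H^s_σ(ℝ⁺, H̃^r(G))`: `u` is supported in `[0,∞) × closure G` and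
`‖u‖_{s,r,σ,*} < ∞`. -/
def MemTilde (s r σ : ℝ) (G : Opens Plane) (u : Functional ⊤) : Prop :=
  Distribution.IsVanishingOn u (causalCylinder G)ᶜ ∧ sobNorm s r σ u < ⊤

/-- `f ∈ H^s_σ(ℝ⁺, H^r(G))`: `f` is given on `Q = ℝ × G`, vanishes for `t < 0`, and its quotient
norm `‖f‖_{s,r,σ}` is finite. -/
def MemQuot (s r σ : ℝ) (G : Opens Plane) (f : Functional (Q G)) : Prop :=
  Distribution.IsVanishingOn f {x : SpaceTime | x 0 < 0} ∧ sobNorm s r σ f < ⊤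

/-! ### The duality pairing -/

/-- `c` is a value of the pairing of a functional `f` on `Q` of order `(s, r)` and a functional
`v` of order `(-s, -r)`, computed from the transforms of an extension of `f` and of `v`. -/
def IsPairing (s r σ : ℝ) {G : Opens Plane} (f : Functional (Q G)) (v : Functional ⊤) (c : ℂ) :
    Prop :=
  ∃ g y : SpaceTime → ℂ,
    HasTransform σ f g ∧ weightedNorm s r σ g < ⊤ ∧
    HasTransform σ v y ∧ weightedNorm (-s) (-r) σ y < ⊤ ∧
    c = ∫ ξ, g ξ * (starRingEnd ℂ) (y ξ)

open Classical in
/-- The sesquilinear duality `⟨f, v⟩_σ` between `H^s_σ(ℝ⁺, H^r(G))` and `H^{-s}_σ(ℝ⁺, H̃^{-r}(G))`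
which extends `⟨f, v⟩_σ = ∫ e^{-2σt} ∫_G f v̄ dx dt` (by Plancherel's theorem). If `v` is supported in
`ℝ × closure G` with `G` Lipschitz, the value does not depend on the extension of `f`. -/
def pairing (s r σ : ℝ) {G : Opens Plane} (f : Functional (Q G)) (v : Functional ⊤) : ℂ :=
  if h : ∃ c, IsPairing s r σ f v c then h.choose else 0

/-! ### Piecewise polynomials in space-time -/

/-- `f` is a piecewise polynomial of degree at most `p` on the time mesh
`[0, Δt), [Δt, 2Δt), …, [(N-1)Δt, NΔt)`, extended by zero. -/
def IsTimePoly (p : ℕ) (Δt : ℝ) (N : ℕ) (f : ℝ → ℝ) : Prop :=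
  (∀ n < N, ∃ P : Polynomial ℝ, P.natDegree ≤ p ∧
    ∀ t ∈ Set.Ico (n * Δt) ((n + 1) * Δt), f t = P.eval t) ∧
  ∀ t ∉ Set.Ico 0 (N * Δt), f t = 0

/-- `K` is a triangulation of (the closure of) `G` into finitely many closed triangles. -/
def IsTriangulation (G : Opens Plane) (K : Geometry.SimplicialComplex ℝ Plane) : Prop :=
  K.faces.Finite ∧ K.space = closure (G : Set Plane)

/-- `g` is a piecewise polynomial of degree at most `q` on the triangles of `K`, extended by
zero. The values on the edges are not prescribed, as functions matter only up to null sets. -/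
def IsSpacePoly (q : ℕ) (K : Geometry.SimplicialComplex ℝ Plane) (g : Plane → ℝ) : Prop :=
  (∀ S ∈ K.faces, S.card = 3 → ∃ P : MvPolynomial (Fin 2) ℝ, P.totalDegree ≤ q ∧
    ∀ y ∈ interior (convexHull ℝ (S : Set Plane)), g y = MvPolynomial.eval (fun i => y i) P) ∧
  ∀ y ∉ K.space, g y = 0

/-- The algebraic tensor product of the piecewise polynomials of degree `p` in time and of
degree `q` in space, without conditions of continuity or boundary conditions. -/
def piecewisePoly (p q : ℕ) (Δt : ℝ) (N : ℕ) (K : Geometry.SimplicialComplex ℝ Plane) :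
    Submodule ℝ (SpaceTime → ℝ) :=
  Submodule.span ℝ {F | ∃ f g, IsTimePoly p Δt N f ∧ IsSpacePoly q K g ∧
    F = fun x => f (x 0) * g (sp x)}

/-- The cone of the (almost everywhere) nonnegative functions in a space of functions. -/
def nonnegCone (S : Submodule ℝ (SpaceTime → ℝ)) : Set (SpaceTime → ℝ) :=
  {F | F ∈ S ∧ ∀ᵐ x, 0 ≤ F x}

/-! ### The continuous and the discrete variational inequality -/

/-- `u ∈ H^{1/2}_σ(ℝ⁺, H̃^{-1/2}(G))⁺` and `⟨p_Q V u, v - u⟩_σ ≥ ⟨h, v - u⟩_σ` for all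
`v ∈ H^{1/2}_σ(ℝ⁺, H̃^{-1/2}(G))⁺`. For real-valued `h` the pairings are real. -/
def IsSolution (σ : ℝ) (G : Opens Plane) (h : 𝓓'(Q G, ℂ))
    (u : 𝓓'((⊤ : Opens SpaceTime), ℂ)) : Prop :=
  MemTilde (1 / 2) (-1 / 2) σ G u ∧ Nonneg u ∧
  ∀ v : 𝓓'((⊤ : Opens SpaceTime), ℂ), MemTilde (1 / 2) (-1 / 2) σ G v → Nonneg v →
    (pairing 0 (1 / 2) σ h (⇑v - ⇑u)).re ≤
      (pairing 0 (1 / 2) σ (pQ G (singleLayer u)) (⇑v - ⇑u)).re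

/-- `uh` lies in the cone of nonnegative functions in `S`, and
`⟨p_Q V uh, v - uh⟩_σ ≥ ⟨h, v - uh⟩_σ` for all `v` in this cone. -/
def IsDiscreteSolution (σ : ℝ) (G : Opens Plane) (h : 𝓓'(Q G, ℂ))
    (S : Submodule ℝ (SpaceTime → ℝ)) (uh : SpaceTime → ℝ) : Prop :=
  uh ∈ nonnegCone S ∧
  ∀ v ∈ nonnegCone S,
    (pairing 0 (1 / 2) σ h (ofFun v - ofFun uh)).re ≤
      (pairing 0 (1 / 2) σ (pQ G (singleLayer (ofFun uh))) (ofFun v - ofFun uh)).re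

end

end Punch

/-! After the Fourier-Laplace transform the single layer operator is multiplication by a symbol `m`,
and Falk's argument for variational inequalities can be carried out on the frequency side.

The symbol. In polar coordinates the kernel's `1/|z|` cancels against the Jacobian; the radial
integral gives `1/(s + i Re(c̄ e^{iθ}))` with `s = σ + 2πi ξ₀` and `|c| = |2πξ'|`, and its angular
mean is `1/w`, where `w² = s² + |2πξ'|²` and `Re w > 0` (`circleAverage_inv`, `symbol_eq`).
Elementary estimates of this square root give coercivity of `Re m` in the norm of order `(-1/2,
-1/2)` (`le_symbol_re`), the bound `|m|² ≤ Re m · σ⁻¹ · weight (1/2) (-1/2)` (`norm_symbol_sq_le`),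
and the mapping property from order `(1/2, -1/2)` to order `(0, 1/2)`.

Falk's argument. Let `e = u - uh`, `d = u - φ`, and let `w` now be the residual `h - Vu`. Piecewise
polynomials have finite norm of order `(1/2, -1/2)`, so `uh` is admissible in the continuous
inequality, which gives `Re⟨w, e⟩ ≥ 0`. The discrete inequality tested with `φ` reads `Re⟨w + Ve, e
- d⟩ ≤ 0`. Adding, `Re⟨Ve, e⟩ ≤ Re⟨w, d⟩ + Re⟨Ve, d⟩`. The bound on `|m|²` and Young's inequality
absorb half of the left side, and coercivity and duality finish the proof (`falk_estimate`,
`sobNorm_sub_sq_le`). Only `σ` enters the constants.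

The pairing. It is defined through an arbitrary extension of its first argument, so one must show
that `∫ g ȳ = 0` if `g` is the transform of a distribution vanishing on `Q` and `y` that of one
supported in the closed cylinder (`integral_mul_conj_eq_zero`). Smooth functions are not shown to be
dense; instead the product of the two distributions is defined by its action on test functions and
shown to vanish locally. Near the boundary the first factor is translated a little, so that it
vanishes on a neighbourhood of the closed cylinder; this is where the Lipschitz property is used.
Dilating a test function then recovers the pairing from the product. -/

namespace Punch

noncomputable section

set_option linter.unusedSectionVars false

/-! ### Products of distributions, computed from their Fourier transforms -/

section SpectralProduct

open Filter
open scoped Topology ContDiff ComplexConjugate FourierTransform ENNReal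

variable {E : Type*} [NormedAddCommGroup E] [InnerProductSpace ℝ E] [FiniteDimensional ℝ E]
  [MeasurableSpace E] [BorelSpace E]

/-- `χ` is a complex-valued test function with support in `U`. -/
structure IsTest (U : Set E) (χ : E → ℂ) : Prop where
  contDiff : ContDiff ℝ ∞ χ
  hasCompactSupport : HasCompactSupport χ
  tsupport_subset : tsupport χ ⊆ U

/-- The distribution with Fourier transform `g` vanishes on `U`. -/
def SpectralVanishes (g : E → ℂ) (U : Set E) : Prop :=
  ∀ ψ, IsTest U ψ → ∫ ξ, g ξ * 𝓕⁻ ψ ξ = 0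

/-- `(1 + |ξ|)^a g` is square integrable. -/
def MemWeighted (a : ℝ) (g : E → ℂ) : Prop :=
  MemLp (fun ξ => (1 + ‖ξ‖) ^ a • g ξ) 2

/-- The value at `χ` of the product of the distribution with Fourier transform `g` and the complex
conjugate of the distribution with Fourier transform `y`. -/
def spectralProduct (g y χ : E → ℂ) : ℂ :=
  ∫ p : E × E, 𝓕 χ p.2 * (g (p.1 - p.2) * conj (y p.1))

theorem continuous_one_add_norm_rpow (a : ℝ) : Continuous fun ξ : E => (1 + ‖ξ‖) ^ a := by
  refine (continuous_const.add continuous_norm).rpow_const fun x => Or.inl ?_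
  have := norm_nonneg x
  change 1 + ‖x‖ ≠ 0
  positivity

theorem IsTest.integrable_fourier {U : Set E} {χ : E → ℂ} (hχ : IsTest U χ) (a : ℝ) :
    Integrable (fun η => (1 + ‖η‖) ^ a * ‖𝓕 χ η‖) := by
  obtain ⟨n, hn⟩ := exists_nat_ge a
  let S : SchwartzMap E ℂ := 𝓕 (hχ.hasCompactSupport.toSchwartzMap hχ.contDiff)
  have hS : ∀ η, S η = 𝓕 χ η := fun η => rfl
  have h0 := (S.integrable_pow_mul volume 0).add (S.integrable_pow_mul volume n)
  refine Integrable.mono' (h0.const_mul (2 ^ n)) ?_ (Eventually.of_forall fun η => ?_)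
  · have : Continuous (𝓕 χ) := S.continuous
    refine Continuous.aestronglyMeasurable (Continuous.mul ?_ this.norm)
    exact continuous_one_add_norm_rpow a
  · rw [Real.norm_of_nonneg (by positivity)]
    have h1 : (1 + ‖η‖) ^ a ≤ (1 + ‖η‖) ^ n := by
      rw [← Real.rpow_natCast]
      exact Real.rpow_le_rpow_of_exponent_le (by simp) hn
    have h2 : (1 + ‖η‖) ^ n ≤ 2 ^ n * (1 + ‖η‖ ^ n) := by
      refine (add_pow_le zero_le_one (norm_nonneg η) n).trans ?_
      rw [one_pow]
      gcongr
      · norm_num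
      · exact Nat.sub_le _ _
    calc (1 + ‖η‖) ^ a * ‖𝓕 χ η‖ ≤ (2 ^ n * (1 + ‖η‖ ^ n)) * ‖𝓕 χ η‖ := by
          gcongr; exact h1.trans h2
      _ = _ := by simp [hS]; ring

/-- The triangle inequality in the form of Peetre: shifting the frequency by `η` costs a factor `(1
+ |η|)^a`, which the rapid decay of the transform of a test function absorbs. -/
theorem peetre (a : ℝ) (ha : 0 ≤ a) (ξ η : E) :
    (1 + ‖ξ‖) ^ a ≤ (1 + ‖η‖) ^ a * (1 + ‖ξ - η‖) ^ a := by
  rw [← Real.mul_rpow (by positivity) (by positivity)]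
  refine Real.rpow_le_rpow (by positivity) ?_ ha
  have h1 : ‖ξ‖ ≤ ‖ξ - η‖ + ‖η‖ := by simpa using norm_add_le (ξ - η) η
  nlinarith [norm_nonneg (ξ - η), norm_nonneg η]

/-- The pointwise bound behind the integrability of `spectralProduct`. -/
theorem norm_mul_conj_le (g y : E → ℂ) {a : ℝ} (ha : 0 ≤ a) (ξ η : E) :
    ‖g (ξ - η) * conj (y ξ)‖ ≤ (1 + ‖η‖) ^ a *
      ((‖(1 + ‖ξ - η‖) ^ a • g (ξ - η)‖ ^ 2 + ‖(1 + ‖ξ‖) ^ (-a) • y ξ‖ ^ 2) / 2) := by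
  have h := peetre a ha ξ η
  have h1 : 0 < (1 + ‖ξ‖) ^ a := by positivity
  have h2 : 0 < (1 + ‖ξ - η‖) ^ a := by positivity
  have h3 : 0 < (1 + ‖η‖) ^ a := by positivity
  rw [norm_mul, RCLike.norm_conj, norm_smul, norm_smul, Real.rpow_neg (by positivity), norm_inv,
    Real.norm_of_nonneg h1.le, Real.norm_of_nonneg h2.le]
  set A := (1 + ‖ξ‖) ^ a
  set B := (1 + ‖ξ - η‖) ^ a
  set D := (1 + ‖η‖) ^ a
  calc ‖g (ξ - η)‖ * ‖y ξ‖ = A * (‖g (ξ - η)‖ * (A⁻¹ * ‖y ξ‖)) := by field_simp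
    _ ≤ (D * B) * (‖g (ξ - η)‖ * (A⁻¹ * ‖y ξ‖)) := by gcongr
    _ = D * ((B * ‖g (ξ - η)‖) * (A⁻¹ * ‖y ξ‖)) := by ring
    _ ≤ _ := by
      gcongr
      nlinarith [sq_nonneg (B * ‖g (ξ - η)‖ - A⁻¹ * ‖y ξ‖)]

theorem MemWeighted.aestronglyMeasurable {a : ℝ} {g : E → ℂ} (hg : MemWeighted a g) :
    AEStronglyMeasurable g := by
  have h : AEStronglyMeasurable (fun ξ => (1 + ‖ξ‖) ^ (-a) • ((1 + ‖ξ‖) ^ a • g ξ)) :=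
    (continuous_one_add_norm_rpow (-a)).aestronglyMeasurable.smul hg.1
  refine h.congr (Eventually.of_forall fun ξ => ?_)
  have : (1 + ‖ξ‖) ^ (-a) * (1 + ‖ξ‖) ^ a = 1 := by
    rw [← Real.rpow_add (by positivity)]; simp
  simp only [smul_smul, this, one_smul]

theorem aestronglyMeasurable_kernel {a b : ℝ} {g y : E → ℂ} (hg : MemWeighted a g)
    (hy : MemWeighted b y) :
    AEStronglyMeasurable (fun p : E × E => g (p.1 - p.2) * conj (y p.1)) := by
  refine AEStronglyMeasurable.mul ?_ ?_
  · exact hg.aestronglyMeasurable.comp_quasiMeasurePreserving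
      (quasiMeasurePreserving_sub_of_right_invariant volume volume)
  · exact Complex.continuous_conj.comp_aestronglyMeasurable
      (hy.aestronglyMeasurable.comp_fst)

/-- The majorant of the integrand of `spectralProduct`. -/
theorem integrable_majorant {a : ℝ} {g y : E → ℂ} (hg : MemWeighted a g)
    (hy : MemWeighted (-a) y) {φ : E → ℝ} (hφ : Integrable φ) :
    Integrable (fun p : E × E => φ p.2 * ((‖(1 + ‖p.1 - p.2‖) ^ a • g (p.1 - p.2)‖ ^ 2 +
      ‖(1 + ‖p.1‖) ^ (-a) • y p.1‖ ^ 2) / 2)) := by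
  have hg2 := hg.integrable_norm_pow (by norm_num)
  have hy2 := hy.integrable_norm_pow (by norm_num)
  have h1 := Integrable.convolution_integrand (ContinuousLinearMap.mul ℝ ℝ) hφ hg2
  have h2 := (hy2.mul_prod hφ)
  refine ((h1.add h2).div_const 2).congr (Eventually.of_forall fun p => ?_)
  simp
  ring

theorem integrable_spectralProduct {a : ℝ} (ha : 0 ≤ a) {g y : E → ℂ} (hg : MemWeighted a g)
    (hy : MemWeighted (-a) y) {φ : E → ℂ} (hφm : AEStronglyMeasurable φ)
    (hφ : Integrable (fun η => (1 + ‖η‖) ^ a * ‖φ η‖)) :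
    Integrable (fun p : E × E => φ p.2 * (g (p.1 - p.2) * conj (y p.1))) := by
  refine (integrable_majorant hg hy hφ).mono'
    (hφm.comp_snd.mul (aestronglyMeasurable_kernel hg hy)) (Eventually.of_forall fun p => ?_)
  rw [norm_mul, mul_comm (_ ^ a) ‖φ _‖, mul_assoc]
  gcongr
  exact norm_mul_conj_le g y ha p.1 p.2

theorem IsTest.continuous_fourier {U : Set E} {χ : E → ℂ} (hχ : IsTest U χ) :
    Continuous (𝓕 χ) :=
  (𝓕 (hχ.hasCompactSupport.toSchwartzMap hχ.contDiff)).continuous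

theorem IsTest.integrable_spectralProduct {U : Set E} {χ : E → ℂ} (hχ : IsTest U χ) {a : ℝ}
    (ha : 0 ≤ a) {g y : E → ℂ} (hg : MemWeighted a g) (hy : MemWeighted (-a) y) :
    Integrable (fun p : E × E => 𝓕 χ p.2 * (g (p.1 - p.2) * conj (y p.1))) :=
  Punch.integrable_spectralProduct ha hg hy hχ.continuous_fourier.aestronglyMeasurable
    (hχ.integrable_fourier a)

theorem contDiff_fourierChar_inner (ξ : E) :
    ContDiff ℝ ∞ (fun x : E => ((Real.fourierChar (-inner ℝ x ξ) : Circle) : ℂ)) := by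
  simp only [Real.fourierChar_apply]
  have h : ContDiff ℝ ∞ fun x : E => 2 * Real.pi * -inner ℝ x ξ :=
    contDiff_const.mul (contDiff_id.inner ℝ contDiff_const).neg
  exact ((Complex.ofRealCLM.contDiff.comp h).mul contDiff_const).cexp

theorem IsTest.modulate {U : Set E} {χ : E → ℂ} (hχ : IsTest U χ) (ξ : E) :
    IsTest U (fun x => ((Real.fourierChar (-inner ℝ x ξ) : Circle) : ℂ) * χ x) where
  contDiff := (contDiff_fourierChar_inner ξ).mul hχ.contDiff
  hasCompactSupport := hχ.hasCompactSupport.mul_left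
  tsupport_subset := (tsupport_mul_subset_right).trans hχ.tsupport_subset

/-- Shifting and reflecting the frequency only modulates `χ`, which leaves its support unchanged.
Hence convolution with `𝓕 χ` still tests a distribution inside the support of `χ`. -/
theorem fourierInv_modulate (χ : E → ℂ) (ξ ζ : E) :
    𝓕⁻ (fun x => ((Real.fourierChar (-inner ℝ x ξ) : Circle) : ℂ) * χ x) ζ = 𝓕 χ (ξ - ζ) := by
  rw [Real.fourierInv_eq, Real.fourier_eq]
  refine integral_congr_ae (Eventually.of_forall fun x => ?_)
  simp only [Circle.smul_def, smul_eq_mul, ← mul_assoc, ← Circle.coe_mul, ← AddChar.map_add_eq_mul]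
  rw [inner_sub_right]
  congr 4
  ring

theorem conj_fourier (χ : E → ℂ) (ξ : E) : conj (𝓕 χ ξ) = 𝓕⁻ (fun x => conj (χ x)) ξ := by
  rw [Real.fourierInv_eq, Real.fourier_eq, ← integral_conj]
  refine integral_congr_ae (Eventually.of_forall fun x => ?_)
  simp [Circle.smul_def, ← Circle.coe_inv_eq_conj, AddChar.map_neg_eq_inv]

theorem fourierInv_conj_modulate (χ : E → ℂ) (ξ ζ : E) :
    𝓕⁻ (fun x => ((Real.fourierChar (-inner ℝ x ζ) : Circle) : ℂ) * conj (χ x)) ξ =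
      conj (𝓕 χ (ξ - ζ)) := by
  rw [conj_fourier, Real.fourierInv_eq, Real.fourierInv_eq]
  refine integral_congr_ae (Eventually.of_forall fun x => ?_)
  simp only [Circle.smul_def, smul_eq_mul, ← mul_assoc, ← Circle.coe_mul, ← AddChar.map_add_eq_mul]
  rw [inner_sub_right, sub_eq_add_neg]

theorem IsTest.conj {U : Set E} {χ : E → ℂ} (hχ : IsTest U χ) :
    IsTest U (fun x => conj (χ x)) where
  contDiff := Complex.conjCLE.contDiff.comp hχ.contDiff
  hasCompactSupport := hχ.hasCompactSupport.comp_left (map_zero _)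
  tsupport_subset := (tsupport_comp_subset (map_zero _) χ).trans hχ.tsupport_subset

/-- By Fubini, the inner integral over `η` at fixed `ξ` is the first distribution tested against a
modulation of `χ`, again a test function on `U`. -/
theorem spectralProduct_eq_zero_left {U : Set E} {χ : E → ℂ} (hχ : IsTest U χ) {a : ℝ}
    (ha : 0 ≤ a) {g y : E → ℂ} (hg : MemWeighted a g) (hy : MemWeighted (-a) y)
    (h : SpectralVanishes g U) : spectralProduct g y χ = 0 := by
  rw [spectralProduct, Measure.volume_eq_prod,
    integral_prod _ (hχ.integrable_spectralProduct ha hg hy)]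
  refine integral_eq_zero_of_ae (Eventually.of_forall fun ξ => ?_)
  have h1 : ∫ η, 𝓕 χ η * g (ξ - η) = 0 := by
    rw [← integral_sub_left_eq_self _ volume ξ]
    simp only [sub_sub_cancel]
    rw [← h _ (hχ.modulate ξ)]
    simp only [fourierInv_modulate, mul_comm (𝓕 χ _)]
  simp only [← mul_assoc, integral_mul_const, h1, zero_mul, Pi.zero_apply]

/-- The shear `ξ = ζ + η` moves the dependence on `η` from `g` to `y`; the inner integral at fixed
`ζ` is then the conjugate of the second distribution tested against a modulation of `χ̄`. -/
theorem spectralProduct_eq_zero_right {U : Set E} {χ : E → ℂ} (hχ : IsTest U χ) {a : ℝ}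
    (ha : 0 ≤ a) {g y : E → ℂ} (hg : MemWeighted a g) (hy : MemWeighted (-a) y)
    (h : SpectralVanishes y U) : spectralProduct g y χ = 0 := by
  have hi := hχ.integrable_spectralProduct ha hg hy
  have hm := measurePreserving_add_prod (volume : Measure E) (volume : Measure E)
  rw [Measure.volume_eq_prod] at hi
  have hi' : Integrable (fun p : E × E => 𝓕 χ p.2 * (g (p.1 + p.2 - p.2) * conj (y (p.1 + p.2))))
      (volume.prod volume) := hm.integrable_comp_of_integrable hi
  rw [spectralProduct, Measure.volume_eq_prod, ← hm.map_eq, integral_map hm.aemeasurable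
    (by rw [hm.map_eq]; exact hi.aestronglyMeasurable), integral_prod _ hi']
  refine integral_eq_zero_of_ae (Eventually.of_forall fun ζ => ?_)
  have h1 : ∫ η, 𝓕 χ η * conj (y (ζ + η)) = 0 := by
    rw [← integral_sub_right_eq_self _ ζ]
    simp only [add_sub_cancel]
    rw [← map_zero (starRingEnd ℂ), ← h _ (hχ.conj.modulate ζ), ← integral_conj]
    simp only [fourierInv_conj_modulate, map_mul, Complex.conj_conj, mul_comm (𝓕 χ _)]
  simp only [add_sub_cancel_right, mul_left_comm (𝓕 χ _), integral_const_mul, h1, mul_zero,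
    Pi.zero_apply]

end SpectralProduct

/-! ### Localization of the product, and vanishing of the pairing -/

section SpectralProduct

open Filter
open scoped Topology ContDiff ComplexConjugate FourierTransform ENNReal

variable {E : Type*} [NormedAddCommGroup E] [InnerProductSpace ℝ E] [FiniteDimensional ℝ E]
  [MeasurableSpace E] [BorelSpace E]

theorem IsTest.continuous {U : Set E} {χ : E → ℂ} (hχ : IsTest U χ) : Continuous χ :=
  hχ.contDiff.continuous

theorem IsTest.integrable {U : Set E} {χ : E → ℂ} (hχ : IsTest U χ) : Integrable χ :=
  hχ.continuous.integrable_of_hasCompactSupport hχ.hasCompactSupport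

theorem IsTest.mono {U U' : Set E} {χ : E → ℂ} (hχ : IsTest U χ) (h : U ⊆ U') : IsTest U' χ :=
  ⟨hχ.contDiff, hχ.hasCompactSupport, hχ.tsupport_subset.trans h⟩

theorem fourier_finset_sum {ι : Type*} (s : Finset ι) (χ : ι → E → ℂ)
    (h : ∀ i ∈ s, Integrable (χ i)) (η : E) :
    𝓕 (fun x => ∑ i ∈ s, χ i x) η = ∑ i ∈ s, 𝓕 (χ i) η := by
  simp only [Real.fourier_eq, Finset.smul_sum]
  exact integral_finsetSum s fun i hi => (Real.fourierIntegral_convergent_iff η).2 (h i hi)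

theorem spectralProduct_finset_sum {ι : Type*} (s : Finset ι) {χ : ι → E → ℂ} {U : ι → Set E}
    (h : ∀ i ∈ s, IsTest (U i) (χ i)) {a : ℝ}
    (ha : 0 ≤ a) {g y : E → ℂ} (hg : MemWeighted a g) (hy : MemWeighted (-a) y) :
    spectralProduct g y (fun x => ∑ i ∈ s, χ i x) = ∑ i ∈ s, spectralProduct g y (χ i) := by
  simp only [spectralProduct, fourier_finset_sum s χ fun i hi => (h i hi).integrable,
    Finset.sum_mul]
  exact integral_finsetSum s fun i hi => (h i hi).integrable_spectralProduct ha hg hy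

/-- The product of two distributions vanishes on `W` if it does so locally. -/
theorem spectralProduct_eq_zero_of_locally {a : ℝ} (ha : 0 ≤ a) {g y : E → ℂ}
    (hg : MemWeighted a g) (hy : MemWeighted (-a) y) {W : Set E}
    (h : ∀ x ∈ W, ∃ U, IsOpen U ∧ x ∈ U ∧ ∀ χ, IsTest U χ → spectralProduct g y χ = 0)
    {χ : E → ℂ} (hχ : IsTest W χ) : spectralProduct g y χ = 0 := by
  choose! U hUo hxU hU using h
  have hK : IsCompact (tsupport χ) := hχ.hasCompactSupport
  obtain ⟨t, ht⟩ := hK.elim_nhds_subcover' (fun x _ => U x)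
    (fun x hx => (hUo x (hχ.tsupport_subset hx)).mem_nhds (hxU x (hχ.tsupport_subset hx)))
  -- A partition of unity on the support of `χ` splits `χ` into finitely many test functions, each
  -- supported in a set where the product is known to vanish.
  obtain ⟨f, hf⟩ := SmoothPartitionOfUnity.exists_isSubordinate (I := modelWithCornersSelf ℝ E)
    hK.isClosed (fun i : t => U i.1) (fun i => hUo _ (hχ.tsupport_subset i.1.2))
    (fun x hx => by
      obtain ⟨i, hi, hxi⟩ := Set.mem_iUnion₂.1 (ht hx)
      exact Set.mem_iUnion.2 ⟨⟨i, hi⟩, hxi⟩)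
  have htest : ∀ i : t, IsTest (U i.1) (fun x => ((f i x : ℝ) : ℂ) * χ x) := fun i =>
    { contDiff := (Complex.ofRealCLM.contDiff.comp (f i).contMDiff.contDiff).mul hχ.contDiff
      hasCompactSupport := hχ.hasCompactSupport.mul_left
      tsupport_subset := by
        refine (tsupport_mul_subset_left).trans ((closure_mono ?_).trans (hf i))
        intro x hx
        simpa using hx }
  have hsum : χ = fun x => ∑ i : t, ((f i x : ℝ) : ℂ) * χ x := by
    funext x
    by_cases hx : x ∈ tsupport χ
    · have h1 := f.sum_eq_one hx
      rw [finsum_eq_sum_of_fintype] at h1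
      rw [← Finset.sum_mul, ← Complex.ofReal_sum, h1]
      simp
    · simp [image_eq_zero_of_notMem_tsupport hx]
  rw [hsum, spectralProduct_finset_sum Finset.univ (fun i _ => htest i) ha hg hy]
  exact Finset.sum_eq_zero fun i _ => hU _ (hχ.tsupport_subset i.1.2) _ (htest i)

/-! ### Translations -/

theorem fourierInv_comp_sub (ψ : E → ℂ) (c ζ : E) :
    𝓕⁻ (fun x => ψ (x - c)) ζ = ((Real.fourierChar (inner ℝ c ζ) : Circle) : ℂ) * 𝓕⁻ ψ ζ := by
  rw [Real.fourierInv_eq, Real.fourierInv_eq, ← integral_const_mul,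
    ← integral_add_right_eq_self _ c]
  refine integral_congr_ae (Eventually.of_forall fun x => ?_)
  simp only [Circle.smul_def, smul_eq_mul, ← mul_assoc, ← Circle.coe_mul, ← AddChar.map_add_eq_mul,
    add_sub_cancel_right]
  rw [inner_add_left, add_comm]

theorem IsTest.comp_sub {U : Set E} {ψ : E → ℂ} {c : E} (h : IsTest {z | z + c ∈ U} ψ) :
    IsTest U (fun x => ψ (x - c)) where
  contDiff := h.contDiff.comp (contDiff_id.sub contDiff_const)
  hasCompactSupport := h.hasCompactSupport.comp_homeomorph (Homeomorph.subRight c)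
  tsupport_subset := by
    have : tsupport (fun x => ψ (x - c)) ⊆ (fun x => x - c) ⁻¹' tsupport ψ :=
      closure_minimal (fun x hx => subset_tsupport _ hx)
        ((isClosed_tsupport ψ).preimage (by fun_prop))
    intro x hx
    simpa using h.tsupport_subset (this hx)

/-- Multiplication of the transform by a character, that is, translation. -/
def modulation (c : E) (g : E → ℂ) (ζ : E) : ℂ :=
  ((Real.fourierChar (inner ℝ c ζ) : Circle) : ℂ) * g ζ

theorem norm_modulation (c : E) (g : E → ℂ) (ζ : E) : ‖modulation c g ζ‖ = ‖g ζ‖ := by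
  rw [modulation, norm_mul, Circle.norm_coe, one_mul]

theorem SpectralVanishes.modulation {g : E → ℂ} {U : Set E} (h : SpectralVanishes g U) (c : E) :
    SpectralVanishes (modulation c g) {z | z + c ∈ U} := by
  intro ψ hψ
  rw [← h _ hψ.comp_sub]
  simp only [fourierInv_comp_sub, Punch.modulation]
  refine integral_congr_ae (Eventually.of_forall fun x => ?_)
  ring

theorem continuous_fourierChar_inner (c : E) :
    Continuous fun ζ : E => ((Real.fourierChar (inner ℝ c ζ) : Circle) : ℂ) :=
  continuous_subtype_val.comp (Real.continuous_fourierChar.comp (by fun_prop))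

theorem MemWeighted.modulation {a : ℝ} {g : E → ℂ} (h : MemWeighted a g) (c : E) :
    MemWeighted a (modulation c g) := by
  refine MemLp.of_le h ?_ (Eventually.of_forall fun ξ => ?_)
  · exact (continuous_one_add_norm_rpow a).aestronglyMeasurable.smul
      ((continuous_fourierChar_inner c).aestronglyMeasurable.mul h.aestronglyMeasurable)
  · simp only [norm_smul, norm_modulation, le_refl]

/-- A character has modulus one, so the integrand at `ε = 0` has the same modulus for every `ε` and
dominates the family. -/
theorem tendsto_spectralProduct_modulation {a : ℝ} (ha : 0 ≤ a) {g y : E → ℂ}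
    (hg : MemWeighted a g) (hy : MemWeighted (-a) y) {U : Set E} {χ : E → ℂ} (hχ : IsTest U χ)
    (τ : E) : Tendsto (fun ε : ℝ => spectralProduct (modulation (ε • τ) g) y χ) (𝓝[>] 0)
      (𝓝 (spectralProduct g y χ)) := by
  refine tendsto_integral_filter_of_dominated_convergence
    (fun p : E × E => ‖𝓕 χ p.2 * (g (p.1 - p.2) * conj (y p.1))‖)
    (Eventually.of_forall fun ε =>
      (hχ.integrable_spectralProduct ha (hg.modulation (ε • τ)) hy).aestronglyMeasurable)
    (Eventually.of_forall fun ε => Eventually.of_forall fun p => ?_)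
    (hχ.integrable_spectralProduct ha hg hy).norm (Eventually.of_forall fun p => ?_)
  · simp only [norm_mul, norm_modulation, le_refl]
  · have h : Continuous fun ε : ℝ =>
        𝓕 χ p.2 * (modulation (ε • τ) g (p.1 - p.2) * conj (y p.1)) := by
      unfold modulation
      refine continuous_const.mul ((Continuous.mul ?_ continuous_const).mul continuous_const)
      exact continuous_subtype_val.comp (Real.continuous_fourierChar.comp (by fun_prop))
    have h0 := (h.tendsto 0).mono_left (nhdsWithin_le_nhds (s := Set.Ioi 0))
    simpa [modulation] using h0

/-! ### Recovering the pairing from the product -/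

/-- The correlation of two functions. -/
def correlation (g y : E → ℂ) (η : E) : ℂ := ∫ ξ, g (ξ - η) * conj (y ξ)

theorem spectralProduct_eq_integral_correlation {U : Set E} {χ : E → ℂ} (hχ : IsTest U χ) {a : ℝ}
    (ha : 0 ≤ a) {g y : E → ℂ} (hg : MemWeighted a g) (hy : MemWeighted (-a) y) :
    spectralProduct g y χ = ∫ η, 𝓕 χ η * correlation g y η := by
  rw [spectralProduct, Measure.volume_eq_prod,
    integral_prod_symm _ (hχ.integrable_spectralProduct ha hg hy)]
  simp only [integral_const_mul, correlation]

theorem integrable_weighted_sq {a : ℝ} {g y : E → ℂ} (hg : MemWeighted a g)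
    (hy : MemWeighted (-a) y) (η : E) :
    Integrable fun ξ => (‖(1 + ‖ξ - η‖) ^ a • g (ξ - η)‖ ^ 2 + ‖(1 + ‖ξ‖) ^ (-a) • y ξ‖ ^ 2) / 2 :=
  (((hg.integrable_norm_pow (by norm_num)).comp_sub_right η).add
    (hy.integrable_norm_pow (by norm_num))).div_const 2

/-- The constant in the bound of `correlation`. -/
def correlationBound (a : ℝ) (g y : E → ℂ) : ℝ :=
  ((∫ ξ, ‖(1 + ‖ξ‖) ^ a • g ξ‖ ^ 2) + ∫ ξ, ‖(1 + ‖ξ‖) ^ (-a) • y ξ‖ ^ 2) / 2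

theorem integral_weighted_sq {a : ℝ} {g y : E → ℂ} (hg : MemWeighted a g)
    (hy : MemWeighted (-a) y) (η : E) :
    ∫ ξ, (‖(1 + ‖ξ - η‖) ^ a • g (ξ - η)‖ ^ 2 + ‖(1 + ‖ξ‖) ^ (-a) • y ξ‖ ^ 2) / 2 =
      correlationBound a g y := by
  rw [integral_div, integral_add ((hg.integrable_norm_pow (by norm_num)).comp_sub_right η)
    (hy.integrable_norm_pow (by norm_num)), correlationBound]
  congr 2
  exact integral_sub_right_eq_self (μ := volume) (fun ξ => ‖(1 + ‖ξ‖) ^ a • g ξ‖ ^ 2) η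

/-- Polynomial growth of the correlation, used as a majorant when the test function is dilated. -/
theorem norm_correlation_le {a : ℝ} (ha : 0 ≤ a) {g y : E → ℂ} (hg : MemWeighted a g)
    (hy : MemWeighted (-a) y) (η : E) :
    ‖correlation g y η‖ ≤ (1 + ‖η‖) ^ a * correlationBound a g y := by
  rw [← integral_weighted_sq hg hy η, ← integral_const_mul]
  exact norm_integral_le_of_norm_le ((integrable_weighted_sq hg hy η).const_mul _)
    (Eventually.of_forall fun ξ => norm_mul_conj_le g y ha ξ η)

/-- Translation is continuous on `L²`, and the correlation is the inner product of a fixed element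
with the translates of another. -/
theorem continuous_correlation_of_memLp {G Y : E → ℂ} (hG : MemLp G 2) (hY : MemLp Y 2) :
    Continuous (correlation G Y) := by
  let tr : E → C(E, E) := fun η => ⟨fun ξ => ξ - η, by fun_prop⟩
  have htr : Continuous tr := by
    have h : Continuous fun p : E × E => p.2 - p.1 := by fun_prop
    exact (ContinuousMap.mk _ h).curry.continuous
  have hmp : ∀ η, MeasurePreserving (tr η) (volume : Measure E) volume := fun η =>
    measurePreserving_sub_right volume η
  have hc : Continuous fun η => Lp.compMeasurePreserving (tr η) (hmp η) (hG.toLp G) :=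
    continuous_const.compMeasurePreservingLp htr hmp (by norm_num)
  have hin : Continuous fun η => inner ℂ (hY.toLp Y)
      (Lp.compMeasurePreserving (tr η) (hmp η) (hG.toLp G)) := continuous_const.inner hc
  convert hin using 2 with η
  rw [L2.inner_def, correlation]
  refine integral_congr_ae ?_
  have h1 := Lp.coeFn_compMeasurePreserving (hG.toLp G) (hmp η)
  have h2 := (hmp η).quasiMeasurePreserving.ae_eq_comp hG.coeFn_toLp
  filter_upwards [h1, h2, hY.coeFn_toLp] with ξ h1 h2 h3
  rw [h1, h2, h3]
  simp [tr]

/-- The weighted functions `G`, `Y` are square integrable, so their correlation is continuous. At `η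
= 0` the weights cancel and it agrees with that of `g`, `y`; elsewhere the two differ by at most a
multiple of `(1 + |η|)^a - 1`. -/
theorem continuousAt_correlation {a : ℝ} (ha : 0 ≤ a) {g y : E → ℂ} (hg : MemWeighted a g)
    (hy : MemWeighted (-a) y) : ContinuousAt (correlation g y) 0 := by
  set G : E → ℂ := fun ξ => (1 + ‖ξ‖) ^ a • g ξ
  set Y : E → ℂ := fun ξ => (1 + ‖ξ‖) ^ (-a) • y ξ
  have hc : Tendsto (correlation G Y) (𝓝 0) (𝓝 (correlation G Y 0)) :=
    (continuous_correlation_of_memLp hg hy).tendsto 0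
  have hw : ∀ ξ : E, 0 < (1 + ‖ξ‖) ^ a := fun ξ => by positivity
  have h0 : correlation G Y 0 = correlation g y 0 := by
    refine integral_congr_ae (Eventually.of_forall fun ξ => ?_)
    have h1 := (hw ξ).ne'
    have h2 : ((1 + ‖ξ‖) ^ a : ℝ) * (1 + ‖ξ‖) ^ (-a) = 1 := by
      rw [Real.rpow_neg (by positivity), mul_inv_cancel₀ h1]
    simp only [G, Y, sub_zero, Complex.real_smul, map_mul, Complex.conj_ofReal]
    have h3 : (((1 + ‖ξ‖) ^ a : ℝ) : ℂ) * (((1 + ‖ξ‖) ^ (-a) : ℝ) : ℂ) = 1 := by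
      rw [← Complex.ofReal_mul, h2, Complex.ofReal_one]
    linear_combination (g ξ * conj (y ξ)) * h3
  have hdiff : ∀ η, ‖correlation g y η - correlation G Y η‖ ≤
      ((1 + ‖η‖) ^ a - 1) * correlationBound a g y := by
    intro η
    have hi1 : Integrable fun ξ => g (ξ - η) * conj (y ξ) :=
      ((integrable_weighted_sq hg hy η).const_mul ((1 + ‖η‖) ^ a)).mono'
        ((hg.aestronglyMeasurable.comp_measurePreserving (measurePreserving_sub_right volume η)).mul
          (Complex.continuous_conj.comp_aestronglyMeasurable hy.aestronglyMeasurable))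
        (Eventually.of_forall fun ξ => norm_mul_conj_le g y ha ξ η)
    have hi2 : Integrable fun ξ => G (ξ - η) * conj (Y ξ) := by
      refine (integrable_weighted_sq hg hy η).mono'
        ((hg.1.comp_measurePreserving (measurePreserving_sub_right volume η)).mul
          (Complex.continuous_conj.comp_aestronglyMeasurable hy.1))
        (Eventually.of_forall fun ξ => ?_)
      rw [norm_mul, RCLike.norm_conj]
      change ‖G (ξ - η)‖ * ‖Y ξ‖ ≤ (‖G (ξ - η)‖ ^ 2 + ‖Y ξ‖ ^ 2) / 2
      nlinarith [sq_nonneg (‖G (ξ - η)‖ - ‖Y ξ‖)]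
    rw [correlation, correlation, ← integral_sub hi1 hi2, ← integral_weighted_sq hg hy η,
      ← integral_const_mul]
    refine norm_integral_le_of_norm_le ((integrable_weighted_sq hg hy η).const_mul _)
      (Eventually.of_forall fun ξ => ?_)
    have hA := hw ξ
    have hB := hw (ξ - η)
    have hD := hw η
    have hP := peetre a ha ξ η
    have hP' := peetre a ha (ξ - η) (-η)
    rw [norm_neg, sub_neg_eq_add, sub_add_cancel] at hP'
    have hG : g (ξ - η) = ((((1 + ‖ξ - η‖) ^ a)⁻¹ : ℝ) : ℂ) * G (ξ - η) := by
      simp only [G, Complex.real_smul, ← mul_assoc, ← Complex.ofReal_mul]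
      rw [inv_mul_cancel₀ hB.ne']; simp
    have hY : y ξ = (((1 + ‖ξ‖) ^ a : ℝ) : ℂ) * Y ξ := by
      simp only [Y, Complex.real_smul, ← mul_assoc, ← Complex.ofReal_mul]
      rw [Real.rpow_neg (by positivity), mul_inv_cancel₀ hA.ne']; simp
    have key : g (ξ - η) * conj (y ξ) - G (ξ - η) * conj (Y ξ) =
        (((((1 + ‖ξ - η‖) ^ a)⁻¹ * (1 + ‖ξ‖) ^ a - 1 : ℝ)) : ℂ) * (G (ξ - η) * conj (Y ξ)) := by
      rw [hG, hY, map_mul, Complex.conj_ofReal]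
      push_cast
      ring
    -- Peetre's inequality in both directions puts the quotient `A / B` of the weights between `1/D`
    -- and `D`, and `1/D ≥ 2 - D`.
    have hq : |((1 + ‖ξ - η‖) ^ a)⁻¹ * (1 + ‖ξ‖) ^ a - 1| ≤ (1 + ‖η‖) ^ a - 1 := by
      set A := (1 + ‖ξ‖) ^ a
      set B := (1 + ‖ξ - η‖) ^ a
      set D := (1 + ‖η‖) ^ a
      have hD1 : 1 ≤ D := Real.one_le_rpow (by simp) ha
      rw [inv_mul_eq_div, abs_le]
      constructor
      · have : 1 / D ≤ A / B := by
          rw [div_le_div_iff₀ hD hB]; linarith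
        have h2 : 2 - D ≤ 1 / D := by
          rw [le_div_iff₀ hD]; nlinarith [sq_nonneg (D - 1)]
        linarith
      · have : A / B ≤ D := by rwa [div_le_iff₀ hB]
        linarith
    rw [key, norm_mul, Complex.norm_real, Real.norm_eq_abs, norm_mul, RCLike.norm_conj]
    refine mul_le_mul hq ?_ (by positivity) ((abs_nonneg _).trans hq)
    change ‖G (ξ - η)‖ * ‖Y ξ‖ ≤ (‖G (ξ - η)‖ ^ 2 + ‖Y ξ‖ ^ 2) / 2
    nlinarith [sq_nonneg (‖G (ξ - η)‖ - ‖Y ξ‖)]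
  have hlim : Tendsto (fun η : E => ((1 + ‖η‖) ^ a - 1) * correlationBound a g y) (𝓝 0) (𝓝 0) := by
    have := (((continuous_one_add_norm_rpow (E := E) a).sub continuous_const).mul
      (continuous_const (y := correlationBound a g y))).tendsto 0 (f := fun η : E =>
        ((1 + ‖η‖) ^ a - 1) * correlationBound a g y)
    simpa using this
  have h3 : Tendsto (fun η => correlation g y η - correlation G Y η) (𝓝 0) (𝓝 0) :=
    squeeze_zero_norm hdiff hlim
  have h4 := h3.add hc
  rw [h0, zero_add] at h4
  exact h4.congr fun η => sub_add_cancel _ _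

theorem fourier_comp_smul (χ : E → ℂ) {t : ℝ} (ht : 0 < t) (η : E) :
    𝓕 (fun x => χ (t • x)) (t • η) = (((t ^ Module.finrank ℝ E)⁻¹ : ℝ) : ℂ) * 𝓕 χ η := by
  have h := Measure.integral_comp_smul_of_nonneg (volume : Measure E)
    (fun x => Real.fourierChar (-inner ℝ x η) • χ x) t (hR := ht.le)
  rw [Real.fourier_eq, Real.fourier_eq, ← Complex.real_smul, ← h]
  simp only [inner_smul_left, inner_smul_right, conj_trivial]

/-- If the product of two distributions vanishes, so does their pairing. -/
theorem integral_mul_conj_eq_zero_of_spectralProduct {a : ℝ} (ha : 0 ≤ a) {g y : E → ℂ}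
    (hg : MemWeighted a g) (hy : MemWeighted (-a) y)
    (h : ∀ χ, IsTest Set.univ χ → spectralProduct g y χ = 0) : ∫ ξ, g ξ * conj (y ξ) = 0 := by
  obtain ⟨u, -, hu1, hu2, -, hu0⟩ :=
    exists_contDiff_tsupport_subset (n := ⊤) (s := Set.univ) (x := (0 : E)) Filter.univ_mem
  set χ : E → ℂ := fun x => ((u x : ℝ) : ℂ)
  have hχ : IsTest Set.univ χ :=
    ⟨Complex.ofRealCLM.contDiff.comp hu2, hu1.comp_left Complex.ofReal_zero, Set.subset_univ _⟩
  have hχt : ∀ t : ℝ, 0 < t → IsTest Set.univ (fun x => χ (t • x)) := fun t ht =>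
    ⟨hχ.contDiff.comp (contDiff_const.smul contDiff_id),
      hχ.hasCompactSupport.comp_homeomorph (Homeomorph.smulOfNeZero t ht.ne'), Set.subset_univ _⟩
  -- The dilated test function `χ(t ·)` has a transform concentrated near `0` as `t → 0`. Rescaling
  -- `η` puts the parameter into the correlation instead.
  have hzero : ∀ t : ℝ, 0 < t → ∫ η, 𝓕 χ η * correlation g y (t • η) = 0 := by
    intro t ht
    have h1 := h _ (hχt t ht)
    rw [spectralProduct_eq_integral_correlation (hχt t ht) ha hg hy] at h1
    have h2 := Measure.integral_comp_smul_of_nonneg (volume : Measure E)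
      (fun η => 𝓕 (fun x => χ (t • x)) η * correlation g y η) t (hR := ht.le)
    rw [h1, smul_zero] at h2
    simp only [fourier_comp_smul χ ht, mul_assoc, integral_const_mul] at h2
    refine (mul_eq_zero.1 h2).resolve_left ?_
    exact Complex.ofReal_ne_zero.2 (by positivity)
  have hmeas : AEStronglyMeasurable (correlation g y) :=
    (aestronglyMeasurable_kernel hg hy).prod_swap.integral_prod_right'
  have hlim : Tendsto (fun t : ℝ => ∫ η, 𝓕 χ η * correlation g y (t • η)) (𝓝[>] 0)
      (𝓝 (∫ η, 𝓕 χ η * correlation g y 0)) := by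
    refine tendsto_integral_filter_of_dominated_convergence
      (fun η => (1 + ‖η‖) ^ a * ‖𝓕 χ η‖ * correlationBound a g y) ?_ ?_
      ((hχ.integrable_fourier a).mul_const _) (Eventually.of_forall fun η => ?_)
    · filter_upwards [self_mem_nhdsWithin] with t ht
      exact hχ.continuous_fourier.aestronglyMeasurable.mul
        (hmeas.comp_quasiMeasurePreserving
          (Measure.quasiMeasurePreserving_smul volume (ne_of_gt ht)))
    · filter_upwards [self_mem_nhdsWithin, nhdsWithin_le_nhds (Iio_mem_nhds one_pos)] with t ht ht1
      refine Eventually.of_forall fun η => ?_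
      have hb : 0 ≤ correlationBound a g y := by unfold correlationBound; positivity
      rw [norm_mul, mul_comm (_ ^ a), mul_assoc]
      gcongr
      refine (norm_correlation_le ha hg hy _).trans ?_
      gcongr
      rw [norm_smul, Real.norm_of_nonneg (le_of_lt ht)]
      exact mul_le_of_le_one_left (norm_nonneg _) (le_of_lt ht1)
    · refine tendsto_const_nhds.mul ?_
      refine (continuousAt_correlation ha hg hy).tendsto.comp ?_
      have : Continuous fun t : ℝ => t • η := by fun_prop
      simpa using (this.tendsto 0).mono_left (nhdsWithin_le_nhds (s := Set.Ioi 0))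
  have hfin : ∫ η, 𝓕 χ η * correlation g y 0 = 0 := by
    refine tendsto_nhds_unique hlim (tendsto_const_nhds.congr' ?_)
    filter_upwards [self_mem_nhdsWithin] with t ht
    exact (hzero t ht).symm
  -- The limiting kernel has total mass `χ(0) = 1` by Fourier inversion, so the limit is the
  -- correlation at `0`, which is the pairing.
  have hinv : ∫ η, 𝓕 χ η = 1 := by
    have hF : Integrable (𝓕 χ) :=
      (𝓕 (hχ.hasCompactSupport.toSchwartzMap hχ.contDiff)).integrable
    have h1 := congrFun (hχ.continuous.fourierInv_fourier_eq hχ.integrable hF) 0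
    rw [Real.fourierInv_eq] at h1
    simpa [χ, hu0] using h1
  rw [integral_mul_const, hinv, one_mul, correlation] at hfin
  simpa using hfin

/-! ### Independence of the extension -/

/-- Near each boundary point, `closure U` can be translated into `U`. -/
def IsTranslatable (U : Set E) : Prop :=
  ∀ x ∈ frontier U, ∃ τ : E, ∃ W, IsOpen W ∧ x ∈ W ∧
    ∀ᶠ ε : ℝ in 𝓝[>] 0, ∀ z ∈ closure U ∩ W, z + ε • τ ∈ U

/-- The product vanishes locally: on `U` because of `g`, and off `closure U` because of `y`. Near a
boundary point, the modulation of `g` vanishes on a translate of `U` that covers the nearby part of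
`closure U`; letting the translation tend to zero gives the claim. -/
theorem integral_mul_conj_eq_zero {a : ℝ} (ha : 0 ≤ a) {g y : E → ℂ} (hg : MemWeighted a g)
    (hy : MemWeighted (-a) y) {U : Set E} (hUo : IsOpen U) (hU : IsTranslatable U)
    (hgU : SpectralVanishes g U) (hyU : SpectralVanishes y (closure U)ᶜ) :
    ∫ ξ, g ξ * conj (y ξ) = 0 := by
  refine integral_mul_conj_eq_zero_of_spectralProduct ha hg hy fun χ hχ => ?_
  refine spectralProduct_eq_zero_of_locally ha hg hy (fun x _ => ?_) hχ
  by_cases hx : x ∈ closure U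
  · by_cases hxU : x ∈ U
    · exact ⟨U, hUo, hxU, fun χ hχ => spectralProduct_eq_zero_left hχ ha hg hy hgU⟩
    · obtain ⟨τ, W, hW, hxW, hev⟩ := hU x (by rw [hUo.frontier_eq]; exact ⟨hx, hxU⟩)
      refine ⟨W, hW, hxW, fun χ hχ => ?_⟩
      refine tendsto_nhds_unique (tendsto_spectralProduct_modulation ha hg hy hχ τ)
        (tendsto_const_nhds.congr' ?_)
      filter_upwards [hev] with ε hε
      symm
      refine spectralProduct_eq_zero_of_locally ha (hg.modulation _) hy (fun z hz => ?_) hχ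
      by_cases hzU : z ∈ closure U
      · exact ⟨{z | z + ε • τ ∈ U}, hUo.preimage (by fun_prop), hε z ⟨hzU, hz⟩, fun χ hχ =>
          spectralProduct_eq_zero_left hχ ha (hg.modulation _) hy (hgU.modulation _)⟩
      · exact ⟨_, isClosed_closure.isOpen_compl, hzU, fun χ hχ =>
          spectralProduct_eq_zero_right hχ ha (hg.modulation _) hy hyU⟩
  · exact ⟨_, isClosed_closure.isOpen_compl, hx, fun χ hχ =>
      spectralProduct_eq_zero_right hχ ha hg hy hyU⟩

/-- A distribution of finite Sobolev norm determines its Fourier transform. -/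
theorem ae_eq_zero_of_spectralVanishes {a : ℝ} (ha : 0 ≤ a) {y : E → ℂ} (hy : MemWeighted (-a) y)
    (h : SpectralVanishes y Set.univ) : y =ᵐ[volume] 0 := by
  have hloc : LocallyIntegrable y := by
    have h1 : LocallyIntegrable (fun ξ => (1 + ‖ξ‖) ^ (-a) • y ξ) :=
      MemLp.locallyIntegrable hy (by norm_num)
    have h2 := h1.continuous_smul (continuous_one_add_norm_rpow (E := E) a)
    refine h2.congr (Eventually.of_forall fun ξ => ?_)
    have : (1 + ‖ξ‖) ^ a * (1 + ‖ξ‖) ^ (-a) = 1 := by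
      rw [← Real.rpow_add (by positivity)]; simp
    simp only [smul_smul, this, one_smul]
  refine ae_eq_zero_of_integral_contDiff_smul_eq_zero hloc fun f hf hfc => ?_
  have hfw : MemWeighted a (fun ξ => ((f ξ : ℝ) : ℂ)) := by
    refine Continuous.memLp_of_hasCompactSupport ?_ ?_
    · exact (continuous_one_add_norm_rpow a).smul (Complex.continuous_ofReal.comp hf.continuous)
    · refine hfc.mono fun ξ hξ => ?_
      contrapose! hξ
      simp [Function.notMem_support.1 hξ]
  -- The empty set serves as `U`: every `g` vanishes on it, and `y` vanishes on its complement. So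
  -- `y` is orthogonal to every smooth compactly supported function on the frequency side.
  have h0 := integral_mul_conj_eq_zero ha hfw hy isOpen_empty
    (fun x hx => by rw [frontier_empty] at hx; exact hx.elim) (fun ψ hψ => by
      have h0 : ψ = 0 := tsupport_eq_empty_iff.1 (Set.subset_empty_iff.1 hψ.tsupport_subset)
      have h1 : ∀ ξ, 𝓕⁻ ψ ξ = 0 := fun ξ => by
        rw [Real.fourierInv_eq]
        simp only [h0, Pi.zero_apply, smul_zero, integral_zero]
      simp only [h1, mul_zero, integral_zero]) (by rwa [closure_empty, Set.compl_empty])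
  have h1 := congrArg conj h0
  rw [← integral_conj, map_zero] at h1
  simpa only [map_mul, Complex.conj_ofReal, Complex.conj_conj, Complex.real_smul] using h1

end SpectralProduct

/-! ### The square root `w` and the angular mean -/

section Symbol

open Filter
open scoped Topology ComplexConjugate Real

/-! ### The square root `w` of `s² + k²` -/

theorem exists_sqrt_re_pos {s : ℂ} (hs : 0 < s.re) (k : ℝ) :
    ∃ w : ℂ, 0 < w.re ∧ w ^ 2 = s ^ 2 + (k : ℂ) ^ 2 := by
  obtain ⟨w, hw⟩ := IsAlgClosed.exists_pow_nat_eq (s ^ 2 + (k : ℂ) ^ 2) two_pos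
  -- If `Re w = 0`, then `w²` is a nonpositive real. A real value of `s² + k²` forces `Im s = 0`,
  -- since `Re s > 0`, and then `s² + k² > 0`.
  have hne : w.re ≠ 0 := by
    intro h0
    have him := congrArg Complex.im hw
    have hre := congrArg Complex.re hw
    simp [pow_two, h0] at him hre
    have h1 : s.im = 0 := by
      rcases mul_eq_zero.1 (show s.re * s.im = 0 by linarith) with h | h
      · exact absurd h hs.ne'
      · exact h
    rw [h1] at hre
    nlinarith [sq_nonneg w.im, sq_nonneg k, mul_pos hs hs]
  rcases lt_or_gt_of_ne hne with h | h
  · exact ⟨-w, by simpa using h, by rw [neg_sq, hw]⟩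
  · exact ⟨w, h, hw⟩

variable {s w : ℂ} {k : ℝ}

/-- The real and imaginary parts of `w² = s² + k²`. -/
theorem sqrt_re_im (h : w ^ 2 = s ^ 2 + (k : ℂ) ^ 2) :
    w.re ^ 2 - w.im ^ 2 = s.re ^ 2 - s.im ^ 2 + k ^ 2 ∧ w.re * w.im = s.re * s.im := by
  have him := congrArg Complex.im h
  have hre := congrArg Complex.re h
  simp [pow_two] at him hre
  constructor <;> nlinarith

/-- Here `(w + s)(w - s) = k²`, and `|w - s| < |w + s|` because `Re (s w̄) > 0`; note that `Im s`
and `Im w` never have opposite signs. Hence the poles `ρ₁`, `ρ₂` below lie in the open unit disc. -/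
theorem norm_lt_norm_add_sqrt (hs : 0 < s.re) (hw : 0 < w.re) (h : w ^ 2 = s ^ 2 + (k : ℂ) ^ 2) :
    |k| < ‖s + w‖ := by
  obtain ⟨h1, h2⟩ := sqrt_re_im h
  have hb : 0 ≤ s.im * w.im := by
    have : 0 ≤ w.re * (s.im * w.im) := by
      have h3 : w.re * (s.im * w.im) = s.re * s.im ^ 2 := by linear_combination s.im * h2
      rw [h3]; positivity
    exact nonneg_of_mul_nonneg_right this hw
  have hlt : Complex.normSq (w - s) < Complex.normSq (s + w) := by
    simp only [Complex.normSq_apply, Complex.add_re, Complex.add_im, Complex.sub_re, Complex.sub_im]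
    nlinarith [mul_pos hs hw]
  have hprod : Complex.normSq (s + w) * Complex.normSq (w - s) = (k ^ 2) ^ 2 := by
    rw [← Complex.normSq_mul, show (s + w) * (w - s) = ((k ^ 2 : ℝ) : ℂ) by
      push_cast; linear_combination h, Complex.normSq_ofReal]
    ring
  have h0 := Complex.normSq_nonneg (w - s)
  have hk : k ^ 2 < Complex.normSq (s + w) := by
    refine lt_of_pow_lt_pow_left₀ 2 (Complex.normSq_nonneg _) ?_
    nlinarith
  rw [Complex.normSq_eq_norm_sq] at hk
  exact abs_lt_of_sq_lt_sq hk (norm_nonneg _)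

/-- The mean over the unit circle of `1 / (s + i Re (c̄ z))`. -/
theorem circleAverage_inv {c : ℂ} (hs : 0 < s.re) (hw : 0 < w.re)
    (h : w ^ 2 = s ^ 2 + (‖c‖ : ℂ) ^ 2) :
    Real.circleAverage (fun z => (s + Complex.I * ((conj c * z).re : ℂ))⁻¹) 0 1 = w⁻¹ := by
  have hlt := norm_lt_norm_add_sqrt hs hw h
  rw [abs_norm] at hlt
  have hsw : s + w ≠ 0 := norm_pos_iff.1 ((norm_nonneg c).trans_lt hlt)
  have hw0 : w ≠ 0 := fun h => by simp [h] at hw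
  -- On the circle, `s + i Re(c̄ z) = (s + w)/2 · (1 - ρ₁ z)(1 - ρ₂ z⁻¹)`. Partial fractions turn
  -- the reciprocal into `w⁻¹` times the sum of `(1 - ρ₁ z)⁻¹` and `ρ₂ z⁻¹ (1 - ρ₂ z⁻¹)⁻¹`.
  set ρ₁ : ℂ := -Complex.I * conj c / (s + w) with hρ₁
  set ρ₂ : ℂ := -Complex.I * c / (s + w) with hρ₂
  have hn₁ : ‖ρ₁‖ < 1 := by
    rw [hρ₁, norm_div, norm_mul, norm_neg, Complex.norm_I, one_mul, RCLike.norm_conj]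
    exact (div_lt_one (norm_pos_iff.2 hsw)).2 hlt
  have hn₂ : ‖ρ₂‖ < 1 := by
    rw [hρ₂, norm_div, norm_mul, norm_neg, Complex.norm_I, one_mul]
    exact (div_lt_one (norm_pos_iff.2 hsw)).2 hlt
  have hne : ∀ ρ z : ℂ, ‖ρ‖ < 1 → ‖z‖ ≤ 1 → 1 - ρ * z ≠ 0 := by
    intro ρ z hρ hz h0
    have h1 : ρ * z = 1 := (sub_eq_zero.1 h0).symm
    have h2 : ‖ρ * z‖ = 1 := by rw [h1, norm_one]
    rw [norm_mul] at h2
    nlinarith [norm_nonneg ρ, norm_nonneg z]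
  have hclosed : ∀ z ∈ closure (Metric.ball (0 : ℂ) |1|), ‖z‖ ≤ 1 := by
    intro z hz
    simpa using Metric.closure_ball_subset_closedBall hz
  have hd : ∀ ρ : ℂ, ‖ρ‖ < 1 → DifferentiableOn ℂ (fun z => 1 - ρ * z) (closure (Metric.ball 0 |1|)) :=
    fun ρ _ => by fun_prop
  have hf₁ : DifferentiableOn ℂ (fun z => (1 - ρ₁ * z)⁻¹) (closure (Metric.ball 0 |1|)) :=
    (hd ρ₁ hn₁).inv fun z hz => hne _ _ hn₁ (hclosed z hz)
  have hf₂ : DifferentiableOn ℂ (fun z => ρ₂ * z * (1 - ρ₂ * z)⁻¹)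
      (closure (Metric.ball 0 |1|)) :=
    DifferentiableOn.mul (by fun_prop) ((hd ρ₂ hn₂).inv fun z hz => hne _ _ hn₂ (hclosed z hz))
  have hsph : Metric.sphere (0 : ℂ) |1| ⊆ closure (Metric.ball 0 |1|) := by
    rw [closure_ball _ (by simp)]
    exact Metric.sphere_subset_closedBall
  -- The mean value property at the centre yields `1` for the first term; after `z ↦ z⁻¹` it yields
  -- `0` for the second.
  have ha₁ : Real.circleAverage (fun z => (1 - ρ₁ * z)⁻¹) 0 1 = 1 := by
    rw [hf₁.diffContOnCl.circleAverage]
    simp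
  have ha₂ : Real.circleAverage (fun z => ρ₂ * z⁻¹ * (1 - ρ₂ * z⁻¹)⁻¹) 0 1 = 0 := by
    have := Real.circleAverage_zero_one_congr_inv (f := fun z => ρ₂ * z * (1 - ρ₂ * z)⁻¹)
    rw [hf₂.diffContOnCl.circleAverage] at this
    simpa using this
  have hi₁ : CircleIntegrable (fun z => (1 - ρ₁ * z)⁻¹) 0 1 :=
    ContinuousOn.circleIntegrable' (hf₁.continuousOn.mono hsph)
  have hi₂ : CircleIntegrable (fun z => ρ₂ * z⁻¹ * (1 - ρ₂ * z⁻¹)⁻¹) 0 1 := by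
    refine ContinuousOn.circleIntegrable' ?_
    refine hf₂.continuousOn.comp (f := fun z => z⁻¹) ?_ ?_
    · exact continuousOn_inv₀.mono fun z hz => by
        rintro rfl
        simp at hz
    · intro z hz
      refine hsph ?_
      simpa using hz
  have hsum := Real.circleAverage_add hi₁ hi₂
  rw [ha₁, ha₂, add_zero] at hsum
  have hEq : Set.EqOn (fun z => (s + Complex.I * ((conj c * z).re : ℂ))⁻¹)
      (w⁻¹ • ((fun z => (1 - ρ₁ * z)⁻¹) + fun z => ρ₂ * z⁻¹ * (1 - ρ₂ * z⁻¹)⁻¹))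
      (Metric.sphere (0 : ℂ) |1|) := by
    intro z hz
    have hz1 : ‖z‖ = 1 := by simpa using hz
    have hz0 : z ≠ 0 := norm_pos_iff.1 (by rw [hz1]; exact one_pos)
    have hzi : ‖z⁻¹‖ ≤ 1 := by rw [norm_inv, hz1]; simp
    have hre : ((conj c * z).re : ℂ) = (conj c * z + c * z⁻¹) / 2 := by
      rw [Complex.re_eq_add_conj, map_mul, Complex.conj_conj, Complex.inv_def,
        Complex.normSq_eq_norm_sq, hz1]
      simp
    have e₁ := hne ρ₁ z hn₁ hz1.le
    have e₂ := hne ρ₂ z⁻¹ hn₂ hzi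
    have hcc : conj c * c = (‖c‖ : ℂ) ^ 2 := by
      rw [← Complex.conj_mul']
    have r₁ : ρ₁ * (s + w) = -Complex.I * conj c := by rw [hρ₁]; field_simp
    have r₂ : ρ₂ * (s + w) = -Complex.I * c := by rw [hρ₂]; field_simp
    have h12 : ρ₁ * ρ₂ * (s + w) = s - w := by
      have h3 : (ρ₁ * ρ₂ * (s + w)) * (s + w) = (s - w) * (s + w) := by
        linear_combination (ρ₂ * (s + w)) * r₁ - Complex.I * conj c * r₂ + h +
          (conj c * c) * Complex.I_sq - hcc
      exact mul_right_cancel₀ hsw h3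
    have hfac : s + Complex.I * ((conj c * z + c * z⁻¹) / 2) =
        (s + w) / 2 * ((1 - ρ₁ * z) * (1 - ρ₂ * z⁻¹)) := by
      have hzz : z * z⁻¹ = 1 := mul_inv_cancel₀ hz0
      linear_combination (z / 2) * r₁ + (z⁻¹ / 2) * r₂ - (1 / 2) * h12 -
        (ρ₁ * ρ₂ * (s + w) / 2) * hzz
    have hnum : (s + w) / 2 * (1 - ρ₁ * ρ₂) = w := by
      linear_combination -(1 / 2) * h12
    simp only [Pi.smul_apply, Pi.add_apply, smul_eq_mul]
    rw [hre, hfac]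
    have hsw2 : (s + w) / 2 ≠ 0 := div_ne_zero hsw two_ne_zero
    have hsplit : (1 - ρ₁ * z)⁻¹ + ρ₂ * z⁻¹ * (1 - ρ₂ * z⁻¹)⁻¹ =
        (1 - ρ₁ * ρ₂) * ((1 - ρ₁ * z) * (1 - ρ₂ * z⁻¹))⁻¹ := by
      rw [eq_mul_inv_iff_mul_eq₀ (mul_ne_zero e₁ e₂)]
      have hzz : z * z⁻¹ = 1 := mul_inv_cancel₀ hz0
      have i₁ := inv_mul_cancel₀ e₁
      have i₂ := inv_mul_cancel₀ e₂
      linear_combination (1 - ρ₂ * z⁻¹) * i₁ + ρ₂ * z⁻¹ * (1 - ρ₁ * z) * i₂ - ρ₁ * ρ₂ * hzz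
    rw [hsplit, mul_inv ((s + w) / 2), ← mul_assoc]
    congr 1
    rw [eq_comm, inv_mul_eq_iff_eq_mul₀ hw0, eq_mul_inv_iff_mul_eq₀ hsw2]
    linear_combination hnum
  rw [Real.circleAverage_congr_sphere hEq, Real.circleAverage_smul, hsum, smul_eq_mul, mul_one]

end Symbol

/-! ### The symbol of the single layer operator in closed form -/

section SymbolIntegral

open Filter
open scoped Topology ComplexConjugate Real

/-- The density of the single layer kernel in Laplace variables. -/
def layerDensity (σ : ℝ) (z : Plane) : ℝ := ‖z‖⁻¹ * Real.exp (-σ * ‖z‖)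

/-- The Fourier-Laplace symbol of the single layer operator. -/
def symbol (σ : ℝ) (ξ : SpaceTime) : ℂ :=
  (1 / (2 * Real.pi) : ℂ) * ∫ z : Plane,
    (layerDensity σ z : ℂ) * ((Real.fourierChar (-inner ℝ (pt ‖z‖ z) ξ) : Circle) : ℂ)

/-- The complex frequency `σ + 2πi ξ₀`. -/
def laplaceVar (σ : ℝ) (ξ : SpaceTime) : ℂ := σ + (2 * π * ξ 0 : ℝ) * Complex.I

theorem laplaceVar_re (σ : ℝ) (ξ : SpaceTime) : (laplaceVar σ ξ).re = σ := by
  simp [laplaceVar]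

theorem inner_pt (t : ℝ) (z : Plane) (ξ : SpaceTime) :
    inner ℝ (pt t z) ξ = t * ξ 0 + z 0 * ξ 1 + z 1 * ξ 2 := by
  simp [pt, PiLp.inner_apply, Fin.sum_univ_three]
  ring

theorem integrable_layerDensity {σ : ℝ} (hσ : 0 < σ) : Integrable (layerDensity σ) := by
  have h : Integrable (fun z : Plane => (fun r : ℝ => r⁻¹ * Real.exp (-σ * r)) ‖z‖) := by
    refine (integrable_fun_norm_addHaar volume (f := fun r : ℝ => r⁻¹ * Real.exp (-σ * r))).2 ?_
    have h1 : IntegrableOn (fun r : ℝ => Real.exp (-σ * r)) (Set.Ioi 0) :=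
      integrableOn_exp_mul_Ioi (by linarith) 0
    refine h1.congr_fun (fun r hr => ?_) measurableSet_Ioi
    have hr0 : r ≠ 0 := ne_of_gt hr
    simp
    field_simp
  exact h

/-- The Jacobian `r` cancels the singularity `1/r` of the kernel, and what remains is a pure
exponential in `r`. -/
theorem integral_polar (σ : ℝ) (ξ : SpaceTime) :
    ∫ z : Plane, (layerDensity σ z : ℂ) *
      ((Real.fourierChar (-inner ℝ (pt ‖z‖ z) ξ) : Circle) : ℂ) =
    ∫ p in Set.Ioi (0 : ℝ) ×ˢ Set.Ioo (-π) π, Complex.exp (-(laplaceVar σ ξ +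
      Complex.I * ((conj (((2 * π * ξ 1 : ℝ) : ℂ) + (2 * π * ξ 2 : ℝ) * Complex.I) *
        circleMap 0 1 p.2).re : ℂ)) * p.1) := by
  have hmp := Complex.orthonormalBasisOneI.repr.measurePreserving
  rw [← hmp.integral_comp' (f := Complex.orthonormalBasisOneI.repr.toHomeomorph.toMeasurableEquiv),
    ← Complex.integral_comp_polarCoord_symm, polarCoord_target]
  refine setIntegral_congr_fun (measurableSet_Ioi.prod measurableSet_Ioo) fun p hp => ?_
  have hr : 0 < p.1 := hp.1
  have hn : ‖Complex.orthonormalBasisOneI.repr (Complex.polarCoord.symm p)‖ = p.1 := by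
    rw [LinearIsometryEquiv.norm_map, Complex.norm_polarCoord_symm, abs_of_pos hr]
  have h0 : (Complex.orthonormalBasisOneI.repr (Complex.polarCoord.symm p)) 0 =
      p.1 * Real.cos p.2 := by
    simp [Complex.polarCoord_symm_apply, -Complex.ofReal_cos, -Complex.ofReal_sin]
  have h1 : (Complex.orthonormalBasisOneI.repr (Complex.polarCoord.symm p)) 1 =
      p.1 * Real.sin p.2 := by
    simp [Complex.polarCoord_symm_apply, -Complex.ofReal_cos, -Complex.ofReal_sin]
  change p.1 • ((layerDensity σ (Complex.orthonormalBasisOneI.repr (Complex.polarCoord.symm p)) : ℂ)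
    * ((Real.fourierChar (-inner ℝ
      (pt ‖Complex.orthonormalBasisOneI.repr (Complex.polarCoord.symm p)‖
        (Complex.orthonormalBasisOneI.repr (Complex.polarCoord.symm p))) ξ) : Circle) : ℂ)) = _
  rw [layerDensity, inner_pt, hn, h0, h1, Real.fourierChar_apply, Complex.real_smul]
  have hc : ((conj (((2 * π * ξ 1 : ℝ) : ℂ) + (2 * π * ξ 2 : ℝ) * Complex.I) *
      circleMap 0 1 p.2).re) = 2 * π * (ξ 1 * Real.cos p.2 + ξ 2 * Real.sin p.2) := by
    simp [circleMap, Complex.exp_re, Complex.exp_im]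
    ring
  rw [hc, ← mul_assoc, ← Complex.ofReal_mul, ← mul_assoc, mul_inv_cancel₀ hr.ne', one_mul,
    Complex.ofReal_exp, ← Complex.exp_add, laplaceVar]
  congr 1
  push_cast
  ring

/-- The radial integral is `1/(s + i Re(c̄ e^{iθ}))`, and the prefactor `1/(2π)` turns the angular
integral into the circle average computed in `circleAverage_inv`. -/
theorem symbol_eq {σ : ℝ} (hσ : 0 < σ) (ξ : SpaceTime) {w : ℂ} (hw : 0 < w.re)
    (h : w ^ 2 = laplaceVar σ ξ ^ 2 + ((‖(2 * π) • sp ξ‖ : ℝ) : ℂ) ^ 2) :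
    symbol σ ξ = w⁻¹ := by
  set s := laplaceVar σ ξ with hs
  have hsre : 0 < s.re := by rw [hs, laplaceVar_re]; exact hσ
  set c : ℂ := ((2 * π * ξ 1 : ℝ) : ℂ) + (2 * π * ξ 2 : ℝ) * Complex.I with hc
  have hnc : ‖(2 * π) • sp ξ‖ = ‖c‖ := by
    rw [EuclideanSpace.norm_eq, Complex.norm_def, Complex.normSq_apply]
    simp only [sp, hc, Fin.sum_univ_two, Real.norm_eq_abs, sq_abs]
    simp [pow_two]
  rw [hnc] at h
  have hre : ∀ θ : ℝ, (-(s + Complex.I * ((conj c * circleMap 0 1 θ).re : ℂ))).re = -σ := by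
    intro θ
    rw [Complex.neg_re, Complex.add_re, hs, laplaceVar_re]
    simp
  have hcont : Continuous fun p : ℝ × ℝ => Complex.exp (-(s +
      Complex.I * ((conj c * circleMap 0 1 p.2).re : ℂ)) * p.1) := by
    have h1 : Continuous fun p : ℝ × ℝ => circleMap 0 1 p.2 :=
      (continuous_circleMap 0 1).comp continuous_snd
    fun_prop
  have hint : Integrable (fun p : ℝ × ℝ => Complex.exp (-(s +
      Complex.I * ((conj c * circleMap 0 1 p.2).re : ℂ)) * p.1))
      ((volume.restrict (Set.Ioi (0 : ℝ))).prod (volume.restrict (Set.Ioo (-π) π))) := by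
    have h1 : Integrable (fun r : ℝ => Real.exp (-σ * r)) (volume.restrict (Set.Ioi 0)) :=
      integrableOn_exp_mul_Ioi (by linarith) 0
    have h2 : Integrable (fun _ : ℝ => (1 : ℝ)) (volume.restrict (Set.Ioo (-π) π)) :=
      integrable_const 1
    refine (h1.mul_prod h2).mono' hcont.aestronglyMeasurable (Eventually.of_forall fun p => ?_)
    rw [Complex.norm_exp, Complex.re_mul_ofReal, hre, mul_one]
  have hcirc := circleAverage_inv hsre hw h
  rw [symbol, integral_polar, Measure.volume_eq_prod, ← Measure.prod_restrict,
    integral_prod_symm _ hint]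
  have hinner : ∀ θ : ℝ, ∫ r in Set.Ioi (0 : ℝ), Complex.exp (-(s +
      Complex.I * ((conj c * circleMap 0 1 θ).re : ℂ)) * r) =
      (s + Complex.I * ((conj c * circleMap 0 1 θ).re : ℂ))⁻¹ := by
    intro θ
    rw [integral_exp_mul_complex_Ioi (by rw [hre]; linarith)]
    rw [Complex.ofReal_zero, mul_zero, Complex.exp_zero, neg_div_neg_eq, one_div]
  simp only [hinner]
  rw [← integral_Ioc_eq_integral_Ioo, ← intervalIntegral.integral_of_le (by linarith [Real.pi_pos])]
  have hper : Function.Periodic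
      (fun θ => (s + Complex.I * ((conj c * circleMap 0 1 θ).re : ℂ))⁻¹) (2 * π) := by
    intro θ
    simp only [periodic_circleMap 0 1 θ]
  have hshift := hper.intervalIntegral_add_eq (-π) 0
  rw [show -π + 2 * π = π by ring, zero_add] at hshift
  rw [hshift, ← hcirc, Real.circleAverage_def, Complex.real_smul]
  push_cast
  rw [one_div]

end SymbolIntegral

/-! ### Coercivity and continuity estimates for the symbol -/

section SymbolBounds

open Filter
open scoped Topology ComplexConjugate Real

/-! ### Estimates for the square root -/

section Sqrt

variable {s w : ℂ} {k : ℝ}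

/-- Eliminating `Im w = Re s · Im s / Re w` from the real part of `w² = s² + k²`; every lower bound
on `Re w` comes from this identity. -/
theorem sqrt_factor (h : w ^ 2 = s ^ 2 + (k : ℂ) ^ 2) :
    (w.re ^ 2 - s.re ^ 2) * (w.re ^ 2 + s.im ^ 2) = w.re ^ 2 * k ^ 2 := by
  obtain ⟨h1, h2⟩ := sqrt_re_im h
  linear_combination w.re ^ 2 * h1 + (w.re * w.im + s.re * s.im) * h2

theorem re_le_re_sqrt (hw : 0 < w.re) (h : w ^ 2 = s ^ 2 + (k : ℂ) ^ 2) :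
    s.re ≤ w.re := by
  have h1 := sqrt_factor h
  have h2 : 0 ≤ w.re ^ 2 - s.re ^ 2 := by
    refine nonneg_of_mul_nonneg_left (b := w.re ^ 2 + s.im ^ 2) ?_ (by positivity)
    rw [h1]; positivity
  exact le_of_sq_le_sq (by linarith) hw.le

theorem re_sqrt_lower (hs : 0 < s.re) (hw : 0 < w.re) (h : w ^ 2 = s ^ 2 + (k : ℂ) ^ 2) :
    s.re ^ 2 * (‖s‖ ^ 2 + k ^ 2) ≤ w.re ^ 2 * ‖s‖ ^ 2 := by
  have h1 := sqrt_factor h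
  have h2 := re_le_re_sqrt hw h
  rw [← Complex.normSq_eq_norm_sq, Complex.normSq_apply]
  have h3 : 0 ≤ w.re ^ 2 - s.re ^ 2 := by nlinarith
  -- After multiplication by `(Re w)²` and use of `sqrt_factor`, the difference of the two sides is
  -- exactly `((Re w)² - (Re s)²)² (Im s)²`.
  have h4 : 0 ≤ (w.re ^ 2 - s.re ^ 2) * ((w.re ^ 2 - s.re ^ 2) * s.im ^ 2) := by positivity
  have h5 : w.re ^ 2 * (s.re ^ 2 * (s.re * s.re + s.im * s.im + k ^ 2)) ≤
      w.re ^ 2 * (w.re ^ 2 * (s.re * s.re + s.im * s.im)) := by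
    nlinarith
  exact le_of_mul_le_mul_left h5 (by positivity)

theorem norm_sqrt_sq_le (h : w ^ 2 = s ^ 2 + (k : ℂ) ^ 2) : ‖w‖ ^ 2 ≤ ‖s‖ ^ 2 + k ^ 2 := by
  rw [← norm_pow, h]
  refine (norm_add_le _ _).trans ?_
  simp

theorem norm_sqrt_lower (h : w ^ 2 = s ^ 2 + (k : ℂ) ^ 2) :
    s.re ^ 2 * (‖s‖ ^ 2 + k ^ 2) ^ 2 ≤ 3 * (‖w‖ ^ 2 * ‖s‖) ^ 2 := by
  have h1 : (‖w‖ ^ 2) ^ 2 = (s.re ^ 2 - s.im ^ 2 + k ^ 2) ^ 2 + (2 * s.re * s.im) ^ 2 := by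
    rw [← norm_pow, h, ← Complex.normSq_eq_norm_sq, Complex.normSq_apply]
    simp [pow_two]
    ring
  rw [mul_pow, h1, ← Complex.normSq_eq_norm_sq, Complex.normSq_apply]
  -- The factorization `s² + k² = (s + ik)(s - ik)`. The larger factor controls `|s|² + k²`. The
  -- smaller one may degenerate near `|k| = |Im s|`, but it is at least `(Re s)²`; this is why a
  -- factor `|s|` is lost.
  rw [show (s.re ^ 2 - s.im ^ 2 + k ^ 2) ^ 2 + (2 * s.re * s.im) ^ 2 =
    (s.re ^ 2 + (|s.im| + |k|) ^ 2) * (s.re ^ 2 + (|s.im| - |k|) ^ 2) by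
      have e1 := sq_abs s.im
      have e2 := sq_abs k
      rw [← e1, ← e2]
      have : (2 * s.re * s.im) ^ 2 = 4 * s.re ^ 2 * |s.im| ^ 2 := by rw [e1]; ring
      rw [this]; ring]
  rw [show s.re * s.re + s.im * s.im + k ^ 2 = s.re ^ 2 + |s.im| ^ 2 + |k| ^ 2 by
    rw [sq_abs, sq_abs]; ring,
    show s.re * s.re + s.im * s.im = s.re ^ 2 + |s.im| ^ 2 by rw [sq_abs]; ring]
  have hη := abs_nonneg s.im
  have hk := abs_nonneg k
  set η := |s.im|
  set κ := |k|
  set S := s.re ^ 2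
  have hS : 0 ≤ S := sq_nonneg _
  have h2 : S + η ^ 2 + κ ^ 2 ≤ S + (η + κ) ^ 2 := by nlinarith [mul_nonneg hη hk]
  have h3 : S * (S + η ^ 2 + κ ^ 2) ≤ 3 * ((S + (η - κ) ^ 2) * (S + η ^ 2)) := by
    have h4 : κ ^ 2 ≤ 2 * η ^ 2 + 2 * (η - κ) ^ 2 := by nlinarith [sq_nonneg (2 * η - κ)]
    have h5 : 0 ≤ (η - κ) ^ 2 * η ^ 2 := by positivity
    have h6 : 0 ≤ S * (η - κ) ^ 2 := by positivity
    nlinarith [mul_le_mul_of_nonneg_left h4 hS, mul_nonneg hS (sq_nonneg η)]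
  calc S * (S + η ^ 2 + κ ^ 2) ^ 2 = (S + η ^ 2 + κ ^ 2) * (S * (S + η ^ 2 + κ ^ 2)) := by ring
    _ ≤ (S + (η + κ) ^ 2) * (3 * ((S + (η - κ) ^ 2) * (S + η ^ 2))) := by
        apply mul_le_mul h2 h3 <;> positivity
    _ = _ := by ring

end Sqrt

/-! ### The weights -/

/-- `|ω|² + |2πξ'|²`. -/
def freqSq (σ : ℝ) (ξ : SpaceTime) : ℝ := absOmega σ ξ ^ 2 + ‖(2 * π) • sp ξ‖ ^ 2

theorem norm_laplaceVar (σ : ℝ) (ξ : SpaceTime) : ‖laplaceVar σ ξ‖ = absOmega σ ξ := by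
  simp only [laplaceVar, absOmega, Complex.norm_def, Complex.normSq_apply]
  congr 1
  simp
  ring

theorem le_absOmega (σ : ℝ) (ξ : SpaceTime) : σ ≤ absOmega σ ξ := by
  rw [← norm_laplaceVar]
  conv_lhs => rw [← laplaceVar_re σ ξ]
  exact Complex.re_le_norm _

variable {σ : ℝ}

theorem absOmega_pos (hσ : 0 < σ) (ξ : SpaceTime) : 0 < absOmega σ ξ :=
  hσ.trans_le (le_absOmega σ ξ)

theorem freqSq_pos (hσ : 0 < σ) (ξ : SpaceTime) : 0 < freqSq σ ξ := by
  have := absOmega_pos hσ ξ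
  unfold freqSq
  positivity

theorem weight_pos (hσ : 0 < σ) (s r : ℝ) (ξ : SpaceTime) : 0 < weight s r σ ξ :=
  mul_pos (Real.rpow_pos_of_pos (absOmega_pos hσ ξ) _) (Real.rpow_pos_of_pos (freqSq_pos hσ ξ) _)

theorem weight_add (hσ : 0 < σ) (s r s' r' : ℝ) (ξ : SpaceTime) :
    weight (s + s') (r + r') σ ξ = weight s r σ ξ * weight s' r' σ ξ := by
  have h1 := absOmega_pos hσ ξ
  have h2 := freqSq_pos hσ ξ
  unfold freqSq at h2
  simp only [weight, mul_add, Real.rpow_add h1, Real.rpow_add h2]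
  ring

theorem weight_zero_zero (ξ : SpaceTime) : weight 0 0 σ ξ = 1 := by simp [weight]

theorem weight_neg (hσ : 0 < σ) (s r : ℝ) (ξ : SpaceTime) :
    weight (-s) (-r) σ ξ = (weight s r σ ξ)⁻¹ := by
  refine eq_inv_of_mul_eq_one_left ?_
  rw [← weight_add hσ]
  simp [weight_zero_zero]

theorem weight_zero_half (ξ : SpaceTime) : weight 0 (1 / 2) σ ξ = √(freqSq σ ξ) := by
  simp [weight, freqSq, Real.sqrt_eq_rpow]

theorem weight_half_zero (ξ : SpaceTime) : weight (1 / 2) 0 σ ξ = absOmega σ ξ := by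
  simp [weight]

theorem weight_half_half (hσ : 0 < σ) (ξ : SpaceTime) :
    weight (1 / 2) (1 / 2) σ ξ = absOmega σ ξ * √(freqSq σ ξ) := by
  rw [← weight_zero_half, ← weight_half_zero (σ := σ), ← weight_add hσ]
  norm_num

theorem weight_neg_half_neg_half (hσ : 0 < σ) (ξ : SpaceTime) :
    weight (-1 / 2) (-1 / 2) σ ξ = (absOmega σ ξ * √(freqSq σ ξ))⁻¹ := by
  rw [← weight_half_half hσ, ← weight_neg hσ]
  norm_num

theorem weight_half_neg_half (hσ : 0 < σ) (ξ : SpaceTime) :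
    weight (1 / 2) (-1 / 2) σ ξ = absOmega σ ξ * (√(freqSq σ ξ))⁻¹ := by
  rw [← weight_zero_half, ← weight_half_zero (σ := σ), ← weight_neg hσ, ← weight_add hσ]
  norm_num

theorem continuous_absOmega (σ : ℝ) : Continuous (absOmega σ) := by
  have h : Continuous fun ξ : SpaceTime => 2 * Real.pi * ξ 0 :=
    continuous_const.mul (PiLp.continuous_apply 2 _ 0)
  exact ((Complex.continuous_ofReal.comp h).add continuous_const).norm

theorem continuous_weight (hσ : 0 < σ) (s r : ℝ) : Continuous (weight s r σ) := by
  refine Continuous.mul ?_ ?_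
  · exact Continuous.rpow_const (f := absOmega σ) (continuous_absOmega σ)
      fun ξ => Or.inl (absOmega_pos hσ ξ).ne'
  · exact Continuous.rpow_const (f := freqSq σ)
      (((continuous_absOmega σ).pow 2).add ((continuous_sp.const_smul (2 * π)).norm.pow 2))
      fun ξ => Or.inl (freqSq_pos hσ ξ).ne'

/-! ### Estimates for the symbol -/

/-- The bounds on `w` that the symbol estimates need: the third and fourth give coercivity, the
third alone gives continuity relative to `Re m`, and the last gives the mapping property. The
constant `2` there replaces `√3`. -/
theorem exists_symbol_sqrt (hσ : 0 < σ) (ξ : SpaceTime) : ∃ w : ℂ, σ ≤ w.re ∧ symbol σ ξ = w⁻¹ ∧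
    σ * √(freqSq σ ξ) ≤ w.re * absOmega σ ξ ∧ ‖w‖ ^ 2 ≤ freqSq σ ξ ∧
    σ * freqSq σ ξ ≤ 2 * (‖w‖ ^ 2 * absOmega σ ξ) := by
  have hs : 0 < (laplaceVar σ ξ).re := by rwa [laplaceVar_re]
  obtain ⟨w, hw, h⟩ := exists_sqrt_re_pos hs ‖(2 * π) • sp ξ‖
  have h1 := re_le_re_sqrt hw h
  have h2 := re_sqrt_lower hs hw h
  have h3 := norm_sqrt_sq_le h
  have h4 := norm_sqrt_lower h
  rw [laplaceVar_re] at h1 h2 h4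
  rw [norm_laplaceVar] at h2 h3 h4
  have ha := absOmega_pos hσ ξ
  change σ ^ 2 * freqSq σ ξ ≤ _ at h2
  change σ ^ 2 * freqSq σ ξ ^ 2 ≤ _ at h4
  refine ⟨w, h1, symbol_eq hσ ξ hw h, ?_, h3, ?_⟩
  · refine le_of_sq_le_sq ?_ (by positivity)
    rw [mul_pow, mul_pow, Real.sq_sqrt (freqSq_pos hσ ξ).le]
    exact h2
  · refine le_of_sq_le_sq ?_ (by positivity)
    nlinarith [sq_nonneg (‖w‖ ^ 2 * absOmega σ ξ)]

theorem norm_symbol_le (hσ : 0 < σ) (ξ : SpaceTime) : ‖symbol σ ξ‖ ≤ σ⁻¹ := by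
  obtain ⟨w, hw, hm, -⟩ := exists_symbol_sqrt hσ ξ
  rw [hm, norm_inv]
  exact inv_anti₀ hσ (hw.trans (Complex.re_le_norm w))

/-- Coercivity of the symbol. -/
theorem le_symbol_re (hσ : 0 < σ) (ξ : SpaceTime) :
    σ * weight (-1 / 2) (-1 / 2) σ ξ ≤ (symbol σ ξ).re := by
  obtain ⟨w, hw, hm, h1, h2, -⟩ := exists_symbol_sqrt hσ ξ
  have ha := absOmega_pos hσ ξ
  have hf := freqSq_pos hσ ξ
  have hn : 0 < ‖w‖ := (hσ.trans_le hw).trans_le (Complex.re_le_norm w)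
  rw [hm, Complex.inv_re, Complex.normSq_eq_norm_sq, weight_neg_half_neg_half hσ,
    ← div_eq_mul_inv, div_le_div_iff₀ (by positivity) (by positivity)]
  have hq := Real.sqrt_pos.2 hf
  have hqq := Real.mul_self_sqrt hf.le
  calc σ * ‖w‖ ^ 2 ≤ σ * freqSq σ ξ := by gcongr
    _ = (σ * √(freqSq σ ξ)) * √(freqSq σ ξ) := by rw [mul_assoc, hqq]
    _ ≤ (w.re * absOmega σ ξ) * √(freqSq σ ξ) := by gcongr
    _ = _ := by ring

/-- Continuity of the symbol relative to its coercivity. -/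
theorem norm_symbol_sq_le (hσ : 0 < σ) (ξ : SpaceTime) :
    ‖symbol σ ξ‖ ^ 2 ≤ (symbol σ ξ).re * (σ⁻¹ * weight (1 / 2) (-1 / 2) σ ξ) := by
  obtain ⟨w, hw, hm, h1, -⟩ := exists_symbol_sqrt hσ ξ
  have hf := Real.sqrt_pos.2 (freqSq_pos hσ ξ)
  have hn : 0 < ‖w‖ := (hσ.trans_le hw).trans_le (Complex.re_le_norm w)
  rw [hm, Complex.inv_re, Complex.normSq_eq_norm_sq, weight_half_neg_half hσ, norm_inv, inv_pow]
  -- Since `Re m = Re w / |w|²`, the bound on `|m|² = 1/|w|²` amounts to the lower bound on `Re w`.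
  have : 1 ≤ w.re * absOmega σ ξ / (σ * √(freqSq σ ξ)) := by
    rwa [one_le_div (by positivity)]
  calc (‖w‖ ^ 2)⁻¹ ≤ (‖w‖ ^ 2)⁻¹ * (w.re * absOmega σ ξ / (σ * √(freqSq σ ξ))) :=
        le_mul_of_one_le_right (by positivity) this
    _ = _ := by field_simp

/-- The single layer operator maps order `(1/2, -1/2)` to order `(0, 1/2)`. -/
theorem norm_symbol_sq_mul_weight_le (hσ : 0 < σ) (ξ : SpaceTime) :
    ‖symbol σ ξ‖ ^ 2 * weight 0 (1 / 2) σ ξ ≤ 2 / σ * weight (1 / 2) (-1 / 2) σ ξ := by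
  obtain ⟨w, hw, hm, -, -, h1⟩ := exists_symbol_sqrt hσ ξ
  have hf := Real.sqrt_pos.2 (freqSq_pos hσ ξ)
  have hn : 0 < ‖w‖ := (hσ.trans_le hw).trans_le (Complex.re_le_norm w)
  rw [hm, weight_half_neg_half hσ, weight_zero_half, norm_inv, inv_pow, inv_mul_eq_div,
    ← div_eq_mul_inv, div_mul_div_comm, div_le_div_iff₀ (by positivity) (by positivity)]
  have hqq := Real.mul_self_sqrt (freqSq_pos hσ ξ).le
  calc √(freqSq σ ξ) * (σ * √(freqSq σ ξ)) = σ * freqSq σ ξ := by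
        rw [mul_left_comm, hqq]
    _ ≤ _ := by linarith

end SymbolBounds

/-! ### Transforms of functionals and well-definedness of the pairing -/

section Transforms

open Filter
open scoped Topology ComplexConjugate Real ContDiff

variable {σ : ℝ}

/-! ### Weighted norms -/

theorem weightedNorm_lt_top_iff {s r : ℝ} {g : SpaceTime → ℂ} :
    weightedNorm s r σ g < ⊤ ↔ ∫⁻ ξ, ENNReal.ofReal (weight s r σ ξ) * ‖g ξ‖ₑ ^ 2 < ⊤ :=
  ENNReal.rpow_lt_top_iff_of_pos (by norm_num)

theorem weightedNorm_congr {s r : ℝ} {g g' : SpaceTime → ℂ} (h : g =ᵐ[volume] g') :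
    weightedNorm s r σ g = weightedNorm s r σ g' := by
  unfold weightedNorm
  congr 1
  refine lintegral_congr_ae ?_
  filter_upwards [h] with ξ hξ
  rw [hξ]

theorem weightedNorm_lt_top_of_le {s r s' r' : ℝ} {g g' : SpaceTime → ℂ}
    (h : weightedNorm s r σ g < ⊤) (c : ℝ) (hc : 0 ≤ c)
    (hle : ∀ ξ, weight s' r' σ ξ * ‖g' ξ‖ ^ 2 ≤ c * (weight s r σ ξ * ‖g ξ‖ ^ 2)) :
    weightedNorm s' r' σ g' < ⊤ := by
  rw [weightedNorm_lt_top_iff] at h ⊢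
  have h1 : ∫⁻ ξ, ENNReal.ofReal c * (ENNReal.ofReal (weight s r σ ξ) * ‖g ξ‖ₑ ^ 2) < ⊤ := by
    rw [lintegral_const_mul' _ _ ENNReal.ofReal_ne_top]
    exact ENNReal.mul_lt_top ENNReal.ofReal_lt_top h
  refine lt_of_le_of_lt (lintegral_mono fun ξ => ?_) h1
  rw [← ofReal_norm, ← ofReal_norm, ← ENNReal.ofReal_pow (norm_nonneg _),
    ← ENNReal.ofReal_pow (norm_nonneg _), ← ENNReal.ofReal_mul' (by positivity),
    ← ENNReal.ofReal_mul' (by positivity), ← ENNReal.ofReal_mul hc]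
  exact ENNReal.ofReal_le_ofReal (hle ξ)

theorem memWeighted_of_weightedNorm {s r a c : ℝ} {g : SpaceTime → ℂ}
    (hg : AEStronglyMeasurable g) (h : weightedNorm s r σ g < ⊤) (hc : 0 ≤ c)
    (hle : ∀ ξ : SpaceTime, (1 + ‖ξ‖) ^ (2 * a) ≤ c * weight s r σ ξ) : MemWeighted a g := by
  rw [weightedNorm_lt_top_iff] at h
  refine ⟨(continuous_one_add_norm_rpow a).aestronglyMeasurable.smul hg, ?_⟩
  rw [eLpNorm_lt_top_iff_lintegral_rpow_enorm_lt_top (by norm_num) (by norm_num)]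
  have h1 : ∫⁻ ξ, ENNReal.ofReal c * (ENNReal.ofReal (weight s r σ ξ) * ‖g ξ‖ₑ ^ 2) < ⊤ := by
    rw [lintegral_const_mul' _ _ ENNReal.ofReal_ne_top]
    exact ENNReal.mul_lt_top ENNReal.ofReal_lt_top h
  refine lt_of_le_of_lt (lintegral_mono fun ξ => ?_) h1
  have h2 : ‖(1 + ‖ξ‖) ^ a • g ξ‖ₑ ^ (2 : ℝ≥0∞).toReal =
      ENNReal.ofReal ((1 + ‖ξ‖) ^ (2 * a)) * ‖g ξ‖ₑ ^ 2 := by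
    rw [enorm_smul, ENNReal.toReal_ofNat, show (2 : ℝ) = ((2 : ℕ) : ℝ) by norm_num,
      ENNReal.rpow_natCast, mul_pow, Real.enorm_of_nonneg (by positivity),
      ← ENNReal.ofReal_pow (by positivity), mul_comm _ a, Real.rpow_mul (by positivity),
      Real.rpow_natCast]
  rw [h2, ← mul_assoc, ← ENNReal.ofReal_mul hc]
  gcongr
  exact hle ξ

theorem norm_sq_eq (ξ : SpaceTime) : ‖ξ‖ ^ 2 = ξ 0 ^ 2 + ‖sp ξ‖ ^ 2 := by
  rw [EuclideanSpace.norm_sq_eq, EuclideanSpace.norm_sq_eq, Fin.sum_univ_three,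
    Fin.sum_univ_two]
  simp [sp, add_assoc]

theorem freqSq_eq (ξ : SpaceTime) : freqSq σ ξ = σ ^ 2 + (2 * π * ‖ξ‖) ^ 2 := by
  rw [freqSq, mul_pow, norm_sq_eq, ← norm_laplaceVar, ← Complex.normSq_eq_norm_sq,
    Complex.normSq_apply, norm_smul, mul_pow, Real.norm_eq_abs, sq_abs]
  simp [laplaceVar]
  ring

theorem sqrt_freqSq_le (hσ : 0 < σ) (ξ : SpaceTime) :
    √(freqSq σ ξ) ≤ (σ + 2 * π) * (1 + ‖ξ‖) := by
  have hn := norm_nonneg ξ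
  have hπ := Real.pi_pos
  refine Real.sqrt_le_iff.2 ⟨by positivity, ?_⟩
  rw [freqSq_eq]
  have h1 : 0 ≤ σ * (2 * π) := by positivity
  have h2 : 0 ≤ σ * σ * ‖ξ‖ := by positivity
  have h3 : 0 ≤ π * π * ‖ξ‖ := by positivity
  have h4 : 0 ≤ σ * π * ‖ξ‖ := by positivity
  have h5 : 0 ≤ σ * π * ‖ξ‖ ^ 2 := by positivity
  have h6 : 0 ≤ σ * σ * ‖ξ‖ ^ 2 := by positivity
  nlinarith [sq_nonneg π]

theorem le_sqrt_freqSq (hσ : 0 < σ) (ξ : SpaceTime) :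
    1 + ‖ξ‖ ≤ (σ⁻¹ + 1) * √(freqSq σ ξ) := by
  have hn := norm_nonneg ξ
  have hπ := Real.pi_gt_three
  have h1 : σ ≤ √(freqSq σ ξ) := by
    refine Real.le_sqrt_of_sq_le ?_
    rw [freqSq_eq]; nlinarith [sq_nonneg (2 * π * ‖ξ‖)]
  have h2 : ‖ξ‖ ≤ √(freqSq σ ξ) := by
    refine Real.le_sqrt_of_sq_le ?_
    rw [freqSq_eq]
    have : ‖ξ‖ ≤ 2 * π * ‖ξ‖ := by nlinarith
    nlinarith [sq_nonneg σ]
  have h3 : 1 ≤ σ⁻¹ * √(freqSq σ ξ) := by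
    rw [inv_mul_eq_div, one_le_div hσ]; exact h1
  linarith

theorem absOmega_le_sqrt_freqSq (ξ : SpaceTime) : absOmega σ ξ ≤ √(freqSq σ ξ) := by
  refine Real.le_sqrt_of_sq_le ?_
  unfold freqSq
  nlinarith [sq_nonneg ‖(2 * π) • sp ξ‖]

theorem memWeighted_half (hσ : 0 < σ) {g : SpaceTime → ℂ} (hg : AEStronglyMeasurable g)
    (h : weightedNorm 0 (1 / 2) σ g < ⊤) : MemWeighted (1 / 2) g := by
  refine memWeighted_of_weightedNorm hg h (c := σ⁻¹ + 1) (by positivity) fun ξ => ?_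
  rw [weight_zero_half]
  simpa using le_sqrt_freqSq hσ ξ

theorem memWeighted_neg_half (hσ : 0 < σ) {g : SpaceTime → ℂ} (hg : AEStronglyMeasurable g)
    (h : weightedNorm 0 (-(1 / 2)) σ g < ⊤) : MemWeighted (-(1 / 2)) g := by
  have hπ := Real.pi_pos
  refine memWeighted_of_weightedNorm hg h (c := σ + 2 * π) (by positivity) fun ξ => ?_
  have h1 := weight_neg hσ 0 (1 / 2) ξ
  rw [neg_zero] at h1
  have hf := Real.sqrt_pos.2 (freqSq_pos hσ ξ)
  rw [h1, weight_zero_half, mul_neg, Real.rpow_neg (by positivity), ← div_eq_mul_inv,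
    le_div_iff₀ hf, inv_mul_le_iff₀ (by positivity)]
  simpa [mul_comm] using sqrt_freqSq_le hσ ξ

/-- As `|ω|² ≤ |ω|² + |2πξ'|²`, the weight of order `(-1/2, -1/2)` dominates a multiple of `(1 +
|ξ|)⁻²`. This order is the weakest one used, and it suffices for uniqueness of the transform. -/
theorem memWeighted_neg_one (hσ : 0 < σ) {g : SpaceTime → ℂ} (hg : AEStronglyMeasurable g)
    (h : weightedNorm (-1 / 2) (-1 / 2) σ g < ⊤) : MemWeighted (-1) g := by
  have hπ := Real.pi_pos
  refine memWeighted_of_weightedNorm hg h (c := (σ + 2 * π) ^ 2) (by positivity) fun ξ => ?_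
  have hf := Real.sqrt_pos.2 (freqSq_pos hσ ξ)
  have ha := absOmega_pos hσ ξ
  rw [weight_neg_half_neg_half hσ, mul_neg, Real.rpow_neg (by positivity), ← div_eq_mul_inv,
    le_div_iff₀ (by positivity), inv_mul_le_iff₀ (by positivity)]
  have h1 := sqrt_freqSq_le hσ ξ
  have h2 := absOmega_le_sqrt_freqSq (σ := σ) ξ
  calc absOmega σ ξ * √(freqSq σ ξ) ≤ √(freqSq σ ξ) * √(freqSq σ ξ) := by gcongr
    _ ≤ ((σ + 2 * π) * (1 + ‖ξ‖)) * ((σ + 2 * π) * (1 + ‖ξ‖)) := by gcongr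
    _ = _ := by norm_num; ring

/-- Lowering the time order. -/
theorem weightedNorm_lt_top_of_time_le (hσ : 0 < σ) {s s' r : ℝ} (hs : s' ≤ s)
    {g : SpaceTime → ℂ} (h : weightedNorm s r σ g < ⊤) : weightedNorm s' r σ g < ⊤ := by
  refine weightedNorm_lt_top_of_le h (σ ^ (2 * (s' - s))) (by positivity) fun ξ => ?_
  rw [← mul_assoc]
  gcongr
  have h1 := weight_add hσ s r (s' - s) 0 ξ
  rw [add_sub_cancel, add_zero] at h1
  have h2 : weight (s' - s) 0 σ ξ ≤ σ ^ (2 * (s' - s)) := by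
    simp only [weight, Real.rpow_zero, mul_one]
    exact Real.rpow_le_rpow_of_nonpos hσ (le_absOmega σ ξ) (by linarith)
  rw [h1, mul_comm]
  exact mul_le_mul_of_nonneg_right h2 (weight_pos hσ s r ξ).le

/-! ### Functionals and their transforms -/

/-- The function `e^{σt} φ`. -/
def expTest (σ : ℝ) (φ : SpaceTime → ℝ) (x : SpaceTime) : ℂ := ((Real.exp (σ * x 0) * φ x : ℝ) : ℂ)

theorem contDiff_time : ContDiff ℝ ∞ (fun x : SpaceTime => x 0) :=
  contDiff_euclidean.1 contDiff_id 0

theorem isTest_expTest {Ω : Opens SpaceTime} (σ : ℝ) (φ : 𝓓(Ω, ℝ)) :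
    IsTest (tsupport φ) (expTest σ φ) where
  contDiff := Complex.ofRealCLM.contDiff.comp
    (((contDiff_const.mul contDiff_time).exp).mul φ.contDiff)
  hasCompactSupport := by
    have h : HasCompactSupport fun x : SpaceTime => Real.exp (σ * x 0) * φ x :=
      φ.hasCompactSupport.mul_left
    exact h.comp_left Complex.ofReal_zero
  tsupport_subset := by
    refine closure_mono fun x hx => ?_
    contrapose! hx
    simp [expTest, Function.notMem_support.1 hx]

/-- The real test function `e^{-σt} ρ`, for a smooth compactly supported `ρ`. -/
def weightTest {Ω : Opens SpaceTime} (σ : ℝ) (ρ : SpaceTime → ℝ) (h1 : ContDiff ℝ ∞ ρ)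
    (h2 : HasCompactSupport ρ) (h3 : tsupport ρ ⊆ Ω) : 𝓓(Ω, ℝ) :=
  ⟨fun x => Real.exp (-σ * x 0) * ρ x, ((contDiff_const.mul contDiff_time).exp).mul h1,
    h2.mul_left, tsupport_mul_subset_right.trans h3⟩

/-- The factor `e^{σt}` in `HasTransform` is undone by testing with `e^{-σt} ρ`, so every smooth
compactly supported real `ρ` on `Ω` is available on the frequency side. -/
theorem hasTransform_integral {Ω : Opens SpaceTime} {u : Functional Ω} {g : SpaceTime → ℂ}
    (h : HasTransform σ u g) {ρ : SpaceTime → ℝ} (h1 : ContDiff ℝ ∞ ρ)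
    (h2 : HasCompactSupport ρ) (h3 : tsupport ρ ⊆ Ω) :
    Integrable (fun ξ => g ξ * 𝓕⁻ (fun x => ((ρ x : ℝ) : ℂ)) ξ) ∧
      u (weightTest σ ρ h1 h2 h3) = ∫ ξ, g ξ * 𝓕⁻ (fun x => ((ρ x : ℝ) : ℂ)) ξ := by
  have h4 := h.2 (weightTest σ ρ h1 h2 h3)
  have h5 : (fun x : SpaceTime => ((Real.exp (σ * x 0) * weightTest (Ω := Ω) σ ρ h1 h2 h3 x : ℝ) : ℂ)) =
      fun x => ((ρ x : ℝ) : ℂ) := by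
    funext x
    change ((Real.exp (σ * x 0) * (Real.exp (-σ * x 0) * ρ x) : ℝ) : ℂ) = _
    rw [← mul_assoc, ← Real.exp_add]
    simp
  rwa [h5] at h4

/-- Functionals act on real test functions, while the modulations above need complex ones; real and
imaginary parts are treated separately. -/
theorem SpectralVanishes.of_hasTransform {Ω : Opens SpaceTime} {u : Functional Ω}
    {g : SpaceTime → ℂ} (h : HasTransform σ u g) {S : Set SpaceTime}
    (hu : Distribution.IsVanishingOn u S) : SpectralVanishes g (Ω ∩ S) := by
  intro ψ hψ
  have hre : ContDiff ℝ ∞ fun x => (ψ x).re := Complex.reCLM.contDiff.comp hψ.contDiff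
  have him : ContDiff ℝ ∞ fun x => (ψ x).im := Complex.imCLM.contDiff.comp hψ.contDiff
  have hrec : HasCompactSupport fun x => (ψ x).re := hψ.hasCompactSupport.comp_left Complex.zero_re
  have himc : HasCompactSupport fun x => (ψ x).im := hψ.hasCompactSupport.comp_left Complex.zero_im
  have hres : tsupport (fun x => (ψ x).re) ⊆ Ω ∩ S :=
    (tsupport_comp_subset Complex.zero_re ψ).trans hψ.tsupport_subset
  have hims : tsupport (fun x => (ψ x).im) ⊆ Ω ∩ S :=
    (tsupport_comp_subset Complex.zero_im ψ).trans hψ.tsupport_subset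
  have key : ∀ (ρ : SpaceTime → ℝ) (h1 : ContDiff ℝ ∞ ρ) (h2 : HasCompactSupport ρ)
      (_ : tsupport ρ ⊆ Ω ∩ S), Integrable (fun ξ => g ξ * 𝓕⁻ (fun x => ((ρ x : ℝ) : ℂ)) ξ) ∧
        ∫ ξ, g ξ * 𝓕⁻ (fun x => ((ρ x : ℝ) : ℂ)) ξ = 0 := by
    intro ρ h1 h2 h3
    have h4 := hasTransform_integral h h1 h2 (h3.trans Set.inter_subset_left)
    refine ⟨h4.1, h4.2.symm.trans (hu _ ?_)⟩
    exact tsupport_mul_subset_right.trans (h3.trans Set.inter_subset_right)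
  obtain ⟨i1, e1⟩ := key _ hre hrec hres
  obtain ⟨i2, e2⟩ := key _ him himc hims
  have hsplit : ∀ ξ, 𝓕⁻ ψ ξ = 𝓕⁻ (fun x => (((ψ x).re : ℝ) : ℂ)) ξ +
      Complex.I * 𝓕⁻ (fun x => (((ψ x).im : ℝ) : ℂ)) ξ := by
    intro ξ
    have j1 : Integrable fun x => (((ψ x).re : ℝ) : ℂ) := hψ.integrable.re.ofReal
    have j2 : Integrable fun x => (((ψ x).im : ℝ) : ℂ) := hψ.integrable.im.ofReal
    rw [Real.fourierInv_eq_fourier_neg, Real.fourierInv_eq_fourier_neg,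
      Real.fourierInv_eq_fourier_neg, Real.fourier_eq, Real.fourier_eq, Real.fourier_eq,
      ← integral_const_mul, ← integral_add ((Real.fourierIntegral_convergent_iff _).2 j1)
        (((Real.fourierIntegral_convergent_iff _).2 j2).const_mul _)]
    refine integral_congr_ae (Eventually.of_forall fun x => ?_)
    simp only [Circle.smul_def, smul_eq_mul]
    conv_lhs => rw [← Complex.re_add_im (ψ x)]
    ring
  have : ∀ ξ, g ξ * 𝓕⁻ ψ ξ = g ξ * 𝓕⁻ (fun x => (((ψ x).re : ℝ) : ℂ)) ξ +
      Complex.I * (g ξ * 𝓕⁻ (fun x => (((ψ x).im : ℝ) : ℂ)) ξ) := fun ξ => by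
    rw [hsplit]; ring
  simp only [this]
  rw [integral_add i1 (i2.const_mul _), integral_const_mul, e1, e2]
  simp

theorem HasTransform.sub {Ω : Opens SpaceTime} {u v : Functional Ω} {g y : SpaceTime → ℂ}
    (hu : HasTransform σ u g) (hv : HasTransform σ v y) : HasTransform σ (u - v) (g - y) := by
  refine ⟨hu.1.sub hv.1, fun φ => ?_⟩
  obtain ⟨i1, e1⟩ := hu.2 φ
  obtain ⟨i2, e2⟩ := hv.2 φ
  simp only [Pi.sub_apply, sub_mul]
  exact ⟨i1.sub i2, by rw [integral_sub i1 i2, e1, e2]⟩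

theorem HasTransform.pQ {u : Functional ⊤} {g : SpaceTime → ℂ} (hu : HasTransform σ u g)
    (G : Opens Plane) : HasTransform σ (pQ G u) g :=
  ⟨hu.1, fun φ => hu.2 (extendZero φ)⟩

/-- The transform of a functional on space-time is unique. -/
theorem HasTransform.ae_eq {u : Functional ⊤} {g y : SpaceTime → ℂ}
    (hg : HasTransform σ u g) (hy : HasTransform σ u y)
    (hgn : MemWeighted (-1) g) (hyn : MemWeighted (-1) y) : g =ᵐ[volume] y := by
  have h := SpectralVanishes.of_hasTransform (hg.sub hy) (S := Set.univ) (fun φ _ => by simp)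
  have hm : MemWeighted (-1) (g - y) := by
    have := MemLp.sub hgn hyn
    refine this.ae_eq (Eventually.of_forall fun ξ => ?_)
    simp [mul_sub]
  have h0 := ae_eq_zero_of_spectralVanishes zero_le_one hm (by simpa using h)
  filter_upwards [h0] with ξ hξ
  exact sub_eq_zero.1 hξ

/-! ### The cylinder over a Lipschitz set -/

theorem closure_Q_subset (G : Opens Plane) :
    closure (Q G : Set SpaceTime) ⊆ sp ⁻¹' closure (G : Set Plane) :=
  continuous_sp.closure_preimage_subset _

theorem sp_add_smul_pt (z : SpaceTime) (t : ℝ) (v : Plane) : sp (z + t • pt 0 v) = sp z + t • v := by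
  ext i
  fin_cases i <;> simp [sp, pt]

/-- Points of the closure lie on or above the graph, and moving up along the vertical axis of the
local coordinates puts them strictly above it. -/
theorem IsLipschitz.exists_translation {G : Set Plane} (hG : IsLipschitz G) {x : Plane}
    (hx : x ∈ frontier G) : ∃ (v : Plane) (ε : ℝ), 0 < ε ∧
      ∀ δ, 0 < δ → δ < ε → ∀ z ∈ closure G, z ∈ Metric.ball x ε → z + δ • v ∈ G := by
  obtain ⟨R, L, f, ε, hf, hε, hR⟩ := hG x hx
  obtain ⟨v, hv⟩ : ∃ v, R v = EuclideanSpace.single 1 1 := ⟨R.symm _, R.apply_symm_apply _⟩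
  have hvn : ‖v‖ = 1 := by
    rw [← R.norm_map v, hv]
    simp
  -- Half the radius, so that both the point and its translate stay in the ball where `G` is
  -- described by the graph.
  refine ⟨v, ε / 2, by positivity, fun δ hδ hδε z hzc hzb => ?_⟩
  have h0 : Continuous fun y : Plane => (R y) 0 := (PiLp.continuous_apply 2 _ 0).comp R.continuous
  have h1 : Continuous fun y : Plane => (R y) 1 := (PiLp.continuous_apply 2 _ 1).comp R.continuous
  have hle : f ((R z) 0) ≤ (R z) 1 := by
    have hcl : IsClosed {y : Plane | f ((R y) 0) ≤ (R y) 1} :=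
      isClosed_le (hf.continuous.comp h0) h1
    have hsub : Metric.ball x ε ∩ G ⊆ {y : Plane | f ((R y) 0) ≤ (R y) 1} :=
      fun y hy => ((hR y hy.1).1 hy.2).le
    exact closure_minimal hsub hcl (Metric.isOpen_ball.inter_closure
      ⟨Metric.ball_subset_ball (by linarith) hzb, hzc⟩)
  have hball : z + δ • v ∈ Metric.ball x ε := by
    rw [Metric.mem_ball] at hzb ⊢
    calc dist (z + δ • v) x ≤ dist (z + δ • v) z + dist z x := dist_triangle _ _ _
      _ = δ + dist z x := by
          rw [dist_self_add_left, norm_smul, hvn, Real.norm_of_nonneg hδ.le, mul_one]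
      _ < ε := by linarith
  have e0 : (R (z + δ • v)) 0 = (R z) 0 := by
    rw [map_add, map_smul, hv, PiLp.add_apply, PiLp.smul_apply]
    simp
  have e1 : (R (z + δ • v)) 1 = (R z) 1 + δ := by
    rw [map_add, map_smul, hv, PiLp.add_apply, PiLp.smul_apply]
    simp
  rw [hR _ hball, e0, e1]
  linarith

theorem mem_Q {G : Opens Plane} {x : SpaceTime} :
    x ∈ (Q G : Set SpaceTime) ↔ sp x ∈ (G : Set Plane) := Iff.rfl

theorem isTranslatable_Q {G : Opens Plane} (hG : IsLipschitz (G : Set Plane)) :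
    IsTranslatable (Q G : Set SpaceTime) := by
  intro x hx
  rw [(Q G).isOpen.frontier_eq] at hx
  have hfr : sp x ∈ frontier (G : Set Plane) := by
    rw [G.isOpen.frontier_eq]
    exact ⟨closure_Q_subset G hx.1, fun h => hx.2 (mem_Q.2 h)⟩
  obtain ⟨v, ε, hε, h⟩ := hG.exists_translation hfr
  have hW : IsOpen (sp ⁻¹' Metric.ball (sp x) ε) := Metric.isOpen_ball.preimage continuous_sp
  refine ⟨pt 0 v, sp ⁻¹' Metric.ball (sp x) ε, hW,
    Set.mem_preimage.2 (Metric.mem_ball_self hε), ?_⟩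
  have hev : ∀ᶠ δ : ℝ in 𝓝[>] 0, 0 < δ ∧ δ < ε := Ioo_mem_nhdsGT hε
  refine hev.mono fun δ hδ z hz => ?_
  rw [mem_Q, sp_add_smul_pt]
  exact h δ hδ.1 hδ.2 (sp z) (closure_Q_subset G hz.1) hz.2

theorem Q_inter_univ_subset (G : Opens Plane) : (Q G : Set SpaceTime) ⊆ (Q G : Set SpaceTime) ∩ Set.univ :=
  fun _ h => ⟨h, trivial⟩

theorem SpectralVanishes.mono {g : SpaceTime → ℂ} {U U' : Set SpaceTime} (h : SpectralVanishes g U')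
    (hU : U ⊆ U') : SpectralVanishes g U := fun ψ hψ => h ψ (hψ.mono hU)

theorem weight_zero_neg_half_norm {y : SpaceTime → ℂ} (h : weightedNorm (1 / 2) (-1 / 2) σ y < ⊤)
    (hσ : 0 < σ) : weightedNorm 0 (-(1 / 2)) σ y < ⊤ := by
  have := weightedNorm_lt_top_of_time_le hσ (s' := 0) (by norm_num) h
  rwa [neg_div] at this

/-- The pairing of extensions of a functional vanishing on `Q` with functionals supported in the
closed cylinder. -/
theorem integral_mul_conj_eq_of_hasTransform (hσ : 0 < σ) {G : Opens Plane}
    (hG : IsLipschitz (G : Set Plane)) {f : Functional (Q G)} {v : Functional ⊤}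
    {g g' y : SpaceTime → ℂ} (hg : HasTransform σ f g) (hgn : weightedNorm 0 (1 / 2) σ g < ⊤)
    (hg' : HasTransform σ f g') (hgn' : weightedNorm 0 (1 / 2) σ g' < ⊤)
    (hy : HasTransform σ v y) (hyn : weightedNorm 0 (-(1 / 2)) σ y < ⊤)
    (hv : Distribution.IsVanishingOn v (causalCylinder G)ᶜ) :
    Integrable (fun ξ => g ξ * conj (y ξ)) ∧
    ∫ ξ, g ξ * conj (y ξ) = ∫ ξ, g' ξ * conj (y ξ) := by
  have m := memWeighted_half hσ hg.1 hgn
  have m' := memWeighted_half hσ hg'.1 hgn'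
  have my := memWeighted_neg_half hσ hy.1 hyn
  have hint : ∀ {g : SpaceTime → ℂ}, MemWeighted (1 / 2) g →
      Integrable fun ξ => g ξ * conj (y ξ) := by
    intro g m
    have hi := (integrable_weighted_sq m my 0).const_mul ((1 + ‖(0 : SpaceTime)‖) ^ (1 / 2 : ℝ))
    refine hi.mono' (m.aestronglyMeasurable.mul
      (Complex.continuous_conj.comp_aestronglyMeasurable my.aestronglyMeasurable))
      (Eventually.of_forall fun ξ => ?_)
    simpa only [sub_zero] using norm_mul_conj_le g y (by norm_num : (0 : ℝ) ≤ 1 / 2) ξ 0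
  refine ⟨hint m, ?_⟩
  have msub : MemWeighted (1 / 2) (g - g') := by
    refine (MemLp.sub m m').ae_eq (Eventually.of_forall fun ξ => ?_)
    simp [mul_sub]
  have h0 := integral_mul_conj_eq_zero (by norm_num) msub my (Q G).isOpen (isTranslatable_Q hG)
    ((SpectralVanishes.of_hasTransform (hg.sub hg') (S := Set.univ) (fun φ _ => by simp)).mono
      (Q_inter_univ_subset G))
    ((SpectralVanishes.of_hasTransform hy hv).mono fun x hx =>
      ⟨trivial, fun hxc => hx ?_⟩)
  · simp only [Pi.sub_apply, sub_mul] at h0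
    rw [integral_sub (hint m) (hint m')] at h0
    exact sub_eq_zero.1 h0
  · have h1 : sp x ∈ closure (G : Set Plane) := hxc.2
    have hcyl : x ∈ closure (sp ⁻¹' (G : Set Plane)) := by
      -- The projection `sp` is open, hence the closed cylinder over `closure G` lies in the closure
      -- of `Q`.
      refine (IsOpenMap.preimage_closure_subset_closure_preimage ?_) h1
      intro U hU
      rw [isOpen_iff_mem_nhds]
      rintro _ ⟨z, hz, rfl⟩
      have hc : Continuous fun y : Plane => pt (z 0) y := by
        unfold pt
        fun_prop
      have hpz : pt (z 0) (sp z) = z := by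
        ext i; fin_cases i <;> simp [pt, sp]
      have : (fun y : Plane => pt (z 0) y) ⁻¹' U ∈ 𝓝 (sp z) :=
        (hU.preimage hc).mem_nhds (by rw [Set.mem_preimage, hpz]; exact hz)
      refine Filter.mem_of_superset this fun y hy => ⟨pt (z 0) y, hy, ?_⟩
      ext i; fin_cases i <;> simp [pt, sp]
    exact hcyl

/-- The pairing picks some pair of transforms. That of `v` is unique almost everywhere, and the
value does not depend on the extension of `f`, so any pair computes it. -/
theorem pairing_eq (hσ : 0 < σ) {G : Opens Plane} (hG : IsLipschitz (G : Set Plane))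
    {f : Functional (Q G)} {v : Functional ⊤} {g y : SpaceTime → ℂ}
    (hg : HasTransform σ f g) (hgn : weightedNorm 0 (1 / 2) σ g < ⊤)
    (hy : HasTransform σ v y) (hyn : weightedNorm 0 (-(1 / 2)) σ y < ⊤)
    (hv : Distribution.IsVanishingOn v (causalCylinder G)ᶜ) :
    pairing 0 (1 / 2) σ f v = ∫ ξ, g ξ * conj (y ξ) := by
  have hex : ∃ c, IsPairing 0 (1 / 2) σ f v c :=
    ⟨_, g, y, hg, hgn, hy, by rwa [neg_zero], rfl⟩
  rw [pairing, dif_pos hex]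
  obtain ⟨g', y', hg', hgn', hy', hyn', hc⟩ := hex.choose_spec
  rw [neg_zero] at hyn'
  rw [hc]
  have hmono : ∀ {y : SpaceTime → ℂ}, AEStronglyMeasurable y →
      weightedNorm 0 (-(1 / 2)) σ y < ⊤ → MemWeighted (-1) y := fun hm hn =>
    memWeighted_neg_one hσ hm (by
      have := weightedNorm_lt_top_of_time_le hσ (s' := -1 / 2) (by norm_num) hn
      rwa [← neg_div] at this)
  have hae := hy'.ae_eq hy (hmono hy'.1 hyn') (hmono hy.1 hyn)
  rw [← (integral_mul_conj_eq_of_hasTransform hσ hG hg' hgn' hg hgn hy hyn hv).2]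
  refine integral_congr_ae ?_
  filter_upwards [hae] with ξ hξ
  rw [hξ]

/-- The norm of a functional on space-time is the weighted norm of its transform. -/
theorem weightedNorm_le_sobNorm (hσ : 0 < σ) {s : ℝ} (hs : -1 / 2 ≤ s) {v : Functional ⊤}
    {y : SpaceTime → ℂ} (hy : HasTransform σ v y) (hyn : weightedNorm (-1 / 2) (-1 / 2) σ y < ⊤) :
    weightedNorm s (-1 / 2) σ y ≤ sobNorm s (-1 / 2) σ v := by
  refine le_iInf₂ fun y' hy' => ?_
  rcases eq_top_or_lt_top (weightedNorm s (-1 / 2) σ y') with h | h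
  · rw [h]; exact le_top
  · have h1 := weightedNorm_lt_top_of_time_le hσ hs h
    have hae := hy.ae_eq hy' (memWeighted_neg_one hσ hy.1 hyn)
      (memWeighted_neg_one hσ hy'.1 h1)
    exact (weightedNorm_congr hae).le

theorem exists_hasTransform_of_sobNorm_lt_top {Ω : Opens SpaceTime} {s r : ℝ} {u : Functional Ω}
    (h : sobNorm s r σ u < ⊤) : ∃ g, HasTransform σ u g ∧ weightedNorm s r σ g < ⊤ := by
  obtain ⟨g, hg⟩ := iInf_lt_iff.1 h
  obtain ⟨h1, h2⟩ := iInf_lt_iff.1 hg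
  exact ⟨g, h1, h2⟩

end Transforms

/-! ### The single layer operator as a multiplier; transforms of functions -/

section LayerTransform

open Filter
open scoped Topology ComplexConjugate Real ContDiff

variable {σ : ℝ}

/-- The time shift `a 0` interacts with the weight `e^{σt}` and produces `e^{-σ a₀}`. For `a = (|z|,
z)` this is the damping that makes the kernel `1/|z|` integrable at infinity. -/
theorem fourierInv_expTest_translate (a : SpaceTime) (φ : 𝓓((⊤ : Opens SpaceTime), ℝ))
    (ξ : SpaceTime) : 𝓕⁻ (expTest σ (translate a φ)) ξ =
      ((Real.exp (-σ * a 0) : ℝ) : ℂ) * (((Real.fourierChar (-inner ℝ a ξ) : Circle) : ℂ) *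
        𝓕⁻ (expTest σ φ) ξ) := by
  have h := fourierInv_comp_sub (expTest σ φ) (-a) ξ
  rw [inner_neg_left] at h
  rw [← h, Real.fourierInv_eq, Real.fourierInv_eq, ← integral_const_mul]
  refine integral_congr_ae (Eventually.of_forall fun x => ?_)
  have hval : expTest σ (translate a φ) x =
      ((Real.exp (-σ * a 0) : ℝ) : ℂ) * expTest σ φ (x - -a) := by
    change ((Real.exp (σ * x 0) * φ (x + a) : ℝ) : ℂ) =
      ((Real.exp (-σ * a 0) : ℝ) : ℂ) * ((Real.exp (σ * (x - -a) 0) * φ (x - -a) : ℝ) : ℂ)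
    rw [sub_neg_eq_add, PiLp.add_apply, ← Complex.ofReal_mul, ← mul_assoc, ← Real.exp_add]
    congr 3
    ring_nf
  simp only [hval, Circle.smul_def, smul_eq_mul]
  ring

theorem continuous_pt_norm : Continuous fun z : Plane => pt ‖z‖ z := by
  unfold pt
  fun_prop

theorem continuous_layerChar :
    Continuous fun p : Plane × SpaceTime =>
      ((Real.fourierChar (-inner ℝ (pt ‖p.1‖ p.1) p.2) : Circle) : ℂ) := by
  refine continuous_subtype_val.comp (Real.continuous_fourierChar.comp ?_)
  exact ((continuous_pt_norm.comp continuous_fst).inner continuous_snd).neg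

theorem continuous_symbol (hσ : 0 < σ) : Continuous (symbol σ) := by
  refine continuous_const.mul (continuous_of_dominated (bound := fun z => ‖layerDensity σ z‖)
    (fun ξ => ?_) (fun ξ => Eventually.of_forall fun z => ?_) (integrable_layerDensity hσ).norm
    (Eventually.of_forall fun z => ?_))
  · have h1 : Continuous fun z : Plane =>
        ((Real.fourierChar (-inner ℝ (pt ‖z‖ z) ξ) : Circle) : ℂ) :=
      continuous_subtype_val.comp (Real.continuous_fourierChar.comp
        (continuous_pt_norm.inner continuous_const).neg)
    exact (Complex.continuous_ofReal.comp_aestronglyMeasurable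
      (integrable_layerDensity hσ).aestronglyMeasurable).mul h1.aestronglyMeasurable
  · rw [norm_mul, Circle.norm_coe, mul_one, Complex.norm_real]
  · have h1 : Continuous fun ξ : SpaceTime =>
        ((Real.fourierChar (-inner ℝ (pt ‖z‖ z) ξ) : Circle) : ℂ) :=
      continuous_subtype_val.comp (Real.continuous_fourierChar.comp
        (continuous_const.inner continuous_id).neg)
    exact continuous_const.mul h1

/-- The single layer operator is a Fourier-Laplace multiplier. -/
theorem HasTransform.singleLayer (hσ : 0 < σ) {u : Functional ⊤} {g : SpaceTime → ℂ}
    (h : HasTransform σ u g) :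
    HasTransform σ (singleLayer u) (fun ξ => symbol σ ξ * g ξ) := by
  refine ⟨(continuous_symbol hσ).aestronglyMeasurable.mul h.1, fun φ => ?_⟩
  obtain ⟨hi, -⟩ := h.2 φ
  change Integrable (fun ξ => g ξ * 𝓕⁻ (expTest σ φ) ξ) at hi
  change Integrable (fun ξ => symbol σ ξ * g ξ * 𝓕⁻ (expTest σ φ) ξ) ∧
    Punch.singleLayer u φ = ∫ ξ, symbol σ ξ * g ξ * 𝓕⁻ (expTest σ φ) ξ
  constructor
  · simp only [mul_assoc]
    exact hi.bdd_mul (continuous_symbol hσ).aestronglyMeasurable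
      (Eventually.of_forall fun ξ => norm_symbol_le hσ ξ)
  · have hprod : Integrable (fun p : Plane × SpaceTime => (layerDensity σ p.1 : ℂ) *
        (((Real.fourierChar (-inner ℝ (pt ‖p.1‖ p.1) p.2) : Circle) : ℂ) *
          (g p.2 * 𝓕⁻ (expTest σ φ) p.2))) (volume.prod volume) := by
      have h1 := (integrable_layerDensity hσ).ofReal (𝕜 := ℂ)
      refine (h1.mul_prod hi).mono (?_ : AEStronglyMeasurable _ _)
        (Eventually.of_forall fun p => ?_)
      · exact (h1.aestronglyMeasurable.comp_fst).mul
          (continuous_layerChar.aestronglyMeasurable.mul hi.aestronglyMeasurable.comp_snd)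
      · simp only [norm_mul, Circle.norm_coe, one_mul]
        exact le_rfl
    have hu : ∀ z : Plane, ((‖z‖⁻¹ : ℝ) : ℂ) * u (translate (pt ‖z‖ z) φ) =
        ∫ ξ, (layerDensity σ z : ℂ) *
        (((Real.fourierChar (-inner ℝ (pt ‖z‖ z) ξ) : Circle) : ℂ) *
          (g ξ * 𝓕⁻ (expTest σ φ) ξ)) := by
      intro z
      rw [(h.2 (translate (pt ‖z‖ z) φ)).2, ← integral_const_mul]
      refine integral_congr_ae (Eventually.of_forall fun ξ => ?_)
      change ((‖z‖⁻¹ : ℝ) : ℂ) * (g ξ * 𝓕⁻ (expTest σ (translate (pt ‖z‖ z) φ)) ξ) = _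
      rw [fourierInv_expTest_translate, layerDensity, show pt ‖z‖ z 0 = ‖z‖ by simp [pt]]
      push_cast
      ring
    rw [Punch.singleLayer]
    simp only [hu]
    -- Fubini moves the integral over `z` inside, where it becomes the symbol.
    rw [integral_integral_swap hprod, ← integral_const_mul]
    refine integral_congr_ae (Eventually.of_forall fun ξ => ?_)
    simp only [symbol, ← mul_assoc]
    rw [integral_mul_const, integral_mul_const]
    ring

/-- The transform of the single layer potential has finite norm of order `(0, 1/2)`. -/
theorem weightedNorm_symbol_mul_lt_top (hσ : 0 < σ) {g : SpaceTime → ℂ}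
    (h : weightedNorm (1 / 2) (-1 / 2) σ g < ⊤) :
    weightedNorm 0 (1 / 2) σ (fun ξ => symbol σ ξ * g ξ) < ⊤ := by
  refine weightedNorm_lt_top_of_le h (2 / σ) (by positivity) fun ξ => ?_
  have := norm_symbol_sq_mul_weight_le hσ ξ
  rw [norm_mul, mul_pow]
  calc weight 0 (1 / 2) σ ξ * (‖symbol σ ξ‖ ^ 2 * ‖g ξ‖ ^ 2) =
      (‖symbol σ ξ‖ ^ 2 * weight 0 (1 / 2) σ ξ) * ‖g ξ‖ ^ 2 := by ring
    _ ≤ (2 / σ * weight (1 / 2) (-1 / 2) σ ξ) * ‖g ξ‖ ^ 2 := by gcongr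
    _ = _ := by ring

/-! ### Functions as functionals -/

/-- The regular distribution of a locally integrable function. -/
def ofFunDistribution (f : SpaceTime → ℝ) (hf : LocallyIntegrable f) :
    𝓓'((⊤ : Opens SpaceTime), ℂ) where
  toFun := ofFun f
  map_add' φ ψ := by
    have h : ∀ φ : 𝓓((⊤ : Opens SpaceTime), ℝ), Integrable fun x => f x * φ x := fun φ => by
      have := φ.integrable_bilin (ContinuousLinearMap.mul ℝ ℝ) (hf.locallyIntegrableOn _)
      exact this.congr (Eventually.of_forall fun x => mul_comm _ _)
    simp only [ofFun, ← Complex.ofReal_add]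
    rw [← integral_add (h φ) (h ψ)]
    simp [mul_add]
  map_smul' c φ := by
    simp only [ofFun, RingHom.id_apply, Complex.real_smul, ← Complex.ofReal_mul]
    rw [← integral_const_mul]
    simp [mul_left_comm]
  cont := by
    have h : ofFun f = fun φ => ((TestFunction.integralAgainstBilinCLM
        (ContinuousLinearMap.mul ℝ ℝ) volume f φ : ℝ) : ℂ) := by
      funext φ
      rw [TestFunction.integralAgainstBilinCLM_eq_integral (hf.locallyIntegrableOn _)]
      simp [ofFun, mul_comm]
    rw [h]
    exact Complex.continuous_ofReal.comp (ContinuousLinearMap.continuous _)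

theorem coe_ofFunDistribution (f : SpaceTime → ℝ) (hf : LocallyIntegrable f) :
    ⇑(ofFunDistribution f hf) = ofFun f := rfl

theorem nonneg_ofFun {f : SpaceTime → ℝ} (hf : ∀ᵐ x, 0 ≤ f x) : Nonneg (ofFun f) := by
  intro φ hφ
  refine ⟨?_, by simp [ofFun]⟩
  rw [ofFun, Complex.ofReal_re]
  refine integral_nonneg_of_ae ?_
  filter_upwards [hf] with x hx
  exact mul_nonneg hx (hφ x)

theorem isVanishingOn_ofFun {f : SpaceTime → ℝ} {S : Set SpaceTime} (hf : ∀ x ∈ S, f x = 0) :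
    Distribution.IsVanishingOn (ofFun f) S := by
  intro φ hφ
  rw [ofFun, Complex.ofReal_eq_zero]
  refine integral_eq_zero_of_ae (Eventually.of_forall fun x => ?_)
  by_cases hx : x ∈ S
  · simp [hf x hx]
  · simp [image_eq_zero_of_notMem_tsupport fun h => hx (hφ h)]

theorem integrable_mul_conj (A B : Lp ℂ 2 (volume : Measure SpaceTime)) :
    Integrable fun ξ => B ξ * conj (A ξ) :=
  (L2.integrable_inner (𝕜 := ℂ) A B).congr
    (Eventually.of_forall fun _ => rfl)

theorem integral_mul_conj (A B : Lp ℂ 2 (volume : Measure SpaceTime)) :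
    ∫ ξ, B ξ * conj (A ξ) = inner ℂ A B := by
  rw [L2.inner_def]
  rfl

/-- Plancherel's formula for a square integrable function and a Schwartz function. -/
theorem exists_plancherel_schwartz (F : Lp ℂ 2 (volume : Measure SpaceTime)) :
    ∃ B : Lp ℂ 2 (volume : Measure SpaceTime), ∀ S : SchwartzMap SpaceTime ℂ,
      Integrable (fun ξ => B ξ * conj ((𝓕 S : SchwartzMap SpaceTime ℂ) ξ)) ∧
        ∫ ξ, B ξ * conj ((𝓕 S : SchwartzMap SpaceTime ℂ) ξ) = ∫ x, F x * conj (S x) := by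
  refine ⟨𝓕 F, fun S => ?_⟩
  have h1 := Lp.inner_fourier_eq (S.toLp 2 (volume : Measure SpaceTime)) F
  rw [SchwartzMap.toLp_fourier_eq] at h1
  generalize (𝓕 F : Lp ℂ 2 (volume : Measure SpaceTime)) = B at h1 ⊢
  generalize (𝓕 S : SchwartzMap SpaceTime ℂ) = T at h1 ⊢
  rw [← integral_mul_conj, ← integral_mul_conj] at h1
  have hT : (fun ξ => B ξ * conj (T.toLp 2 (volume : Measure SpaceTime) ξ)) =ᵐ[volume]
      fun ξ => B ξ * conj (T ξ) := by
    filter_upwards [T.coeFn_toLp 2 (volume : Measure SpaceTime)] with ξ hξ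
    rw [hξ]
  have hS : (fun ξ => F ξ * conj (S.toLp 2 (volume : Measure SpaceTime) ξ)) =ᵐ[volume]
      fun ξ => F ξ * conj (S ξ) := by
    filter_upwards [S.coeFn_toLp 2 (volume : Measure SpaceTime)] with ξ hξ
    rw [hξ]
  exact ⟨(integrable_mul_conj _ B).congr hT,
    (integral_congr_ae hT).symm.trans (h1.trans (integral_congr_ae hS))⟩

/-- A function `f` with `e^{-σt} f` square integrable has a square integrable transform. -/
theorem exists_hasTransform_ofFun {f : SpaceTime → ℝ}
    (hf : MemLp (fun x => Real.exp (-σ * x 0) * f x) 2) :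
    ∃ g : SpaceTime → ℂ, HasTransform σ (ofFun f) g ∧ weightedNorm 0 0 σ g < ⊤ := by
  have hF : MemLp (fun x => ((Real.exp (-σ * x 0) * f x : ℝ) : ℂ)) 2 := hf.ofReal
  obtain ⟨B, hB⟩ := exists_plancherel_schwartz (hF.toLp _)
  have hgm := Lp.memLp B
  refine ⟨⇑B, ⟨hgm.1, fun φ => ?_⟩, ?_⟩
  · have hψ := (isTest_expTest σ φ).conj
    -- Plancherel is applied to the conjugate of the test function, since the conjugate of its
    -- Fourier transform is the inverse transform in `HasTransform`.
    obtain ⟨S, hS⟩ : ∃ S : SchwartzMap SpaceTime ℂ, ⇑S = fun x => conj (expTest σ φ x) :=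
      ⟨hψ.hasCompactSupport.toSchwartzMap hψ.contDiff, rfl⟩
    have hSφ : ∀ ξ, conj ((𝓕 S : SchwartzMap SpaceTime ℂ) ξ) = 𝓕⁻ (expTest σ φ) ξ := by
      intro ξ
      have h1 := conj_fourier (fun x => conj (expTest σ φ x)) ξ
      simp only [Complex.conj_conj] at h1
      rw [SchwartzMap.fourier_coe, hS]
      exact h1
    obtain ⟨h1, h2⟩ := hB S
    simp only [hSφ] at h1 h2
    refine ⟨h1, Eq.trans ?_ h2.symm⟩
    rw [ofFun, ← integral_complex_ofReal]
    refine integral_congr_ae ?_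
    filter_upwards [hF.coeFn_toLp] with x h2
    rw [h2, hS, Complex.conj_conj, expTest, ← Complex.ofReal_mul]
    congr 1
    have : Real.exp (-σ * x 0) * Real.exp (σ * x 0) = 1 := by
      rw [← Real.exp_add]; simp
    linear_combination -(f x * φ x) * this
  · rw [weightedNorm_lt_top_iff]
    have := (eLpNorm_lt_top_iff_lintegral_rpow_enorm_lt_top (by norm_num) (by norm_num)).1 hgm.2
    simpa [weight_zero_zero] using this

/-- As `|ω|² ≤ |ω|² + |2πξ'|²`, square integrability of `e^{-σt} f` already gives finite norm of
order `(1/2, -1/2)`. Discontinuous piecewise polynomials are therefore admissible. -/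
theorem weight_half_neg_half_le_one (hσ : 0 < σ) (ξ : SpaceTime) :
    weight (1 / 2) (-1 / 2) σ ξ ≤ 1 := by
  rw [weight_half_neg_half hσ, ← div_eq_mul_inv,
    div_le_one (Real.sqrt_pos.2 (freqSq_pos hσ ξ))]
  exact absOmega_le_sqrt_freqSq ξ

end LayerTransform

/-! ### Piecewise polynomials belong to the energy space -/

section Discrete

open Filter
open scoped Topology Real

/-- Bounded measurable functions with bounded support in `[0,∞) × closure G`. -/
structure IsBoundedCausal (G : Opens Plane) (F : SpaceTime → ℝ) : Prop where
  aestronglyMeasurable : AEStronglyMeasurable F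
  bounded : ∃ C : ℝ, ∀ᵐ x, ‖F x‖ ≤ C
  support_subset : Function.support F ⊆ causalCylinder G
  isBounded_support : Bornology.IsBounded (Function.support F)

namespace IsBoundedCausal

variable {G : Opens Plane} {F H : SpaceTime → ℝ}

theorem zero : IsBoundedCausal G 0 where
  aestronglyMeasurable := aestronglyMeasurable_zero
  bounded := ⟨0, by simp⟩
  support_subset := by simp
  isBounded_support := by simp

theorem add (hF : IsBoundedCausal G F) (hH : IsBoundedCausal G H) : IsBoundedCausal G (F + H) where
  aestronglyMeasurable := hF.1.add hH.1
  bounded := by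
    obtain ⟨C, hC⟩ := hF.bounded
    obtain ⟨D, hD⟩ := hH.bounded
    refine ⟨C + D, ?_⟩
    filter_upwards [hC, hD] with x h1 h2
    exact (norm_add_le _ _).trans (add_le_add h1 h2)
  support_subset := (Function.support_add _ _).trans
    (Set.union_subset hF.support_subset hH.support_subset)
  isBounded_support := (hF.isBounded_support.union hH.isBounded_support).subset
    (Function.support_add _ _)

theorem const_smul (hF : IsBoundedCausal G F) (a : ℝ) : IsBoundedCausal G (a • F) where
  aestronglyMeasurable := hF.1.const_smul a
  bounded := by
    obtain ⟨C, hC⟩ := hF.bounded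
    refine ⟨‖a‖ * C, ?_⟩
    filter_upwards [hC] with x h1
    rw [Pi.smul_apply, norm_smul]
    gcongr
  support_subset := (Function.support_const_smul_subset a F).trans hF.support_subset
  isBounded_support := hF.isBounded_support.subset (Function.support_const_smul_subset a F)

/-- Multiplying by a continuous function gives a function in every `Lᵖ`. -/
theorem memLp_mul (hF : IsBoundedCausal G F) {w : SpaceTime → ℝ} (hw : Continuous w) (p : ℝ≥0∞) :
    MemLp (fun x => w x * F x) p := by
  obtain ⟨R, hR⟩ := hF.isBounded_support.subset_closedBall 0
  obtain ⟨C, hC⟩ := hF.bounded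
  obtain ⟨D, hD⟩ := (isCompact_closedBall (0 : SpaceTime) R).exists_bound_of_continuousOn
    hw.continuousOn
  have h1 : (fun x => w x * F x) = (Metric.closedBall (0 : SpaceTime) R).indicator
      fun x => w x * F x := by
    refine (Set.indicator_eq_self.2 fun x hx => hR ?_).symm
    exact right_ne_zero_of_mul hx
  rw [h1, memLp_indicator_iff_restrict measurableSet_closedBall]
  have hm : AEStronglyMeasurable (fun x => w x * F x) := hw.aestronglyMeasurable.mul hF.1
  have : IsFiniteMeasure ((volume : Measure SpaceTime).restrict (Metric.closedBall 0 R)) :=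
    ⟨by rw [Measure.restrict_apply_univ]; exact measure_closedBall_lt_top⟩
  refine MemLp.of_bound hm.restrict (D * C) ?_
  filter_upwards [ae_restrict_mem measurableSet_closedBall, ae_restrict_of_ae hC] with x hx hx'
  rw [norm_mul]
  exact mul_le_mul (hD x hx) hx' (norm_nonneg _) ((norm_nonneg _).trans (hD x hx))

theorem locallyIntegrable (hF : IsBoundedCausal G F) : LocallyIntegrable F := by
  have := hF.memLp_mul (w := fun _ => 1) continuous_const 1
  simp only [one_mul] at this
  exact (memLp_one_iff_integrable.1 this).locallyIntegrable

theorem exists_hasTransform {σ : ℝ} (hσ : 0 < σ) (hF : IsBoundedCausal G F) :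
    ∃ g : SpaceTime → ℂ, HasTransform σ (ofFun F) g ∧ weightedNorm (1 / 2) (-1 / 2) σ g < ⊤ := by
  have hw : Continuous fun x : SpaceTime => Real.exp (-σ * x 0) := by fun_prop
  obtain ⟨g, hg, hgn⟩ := exists_hasTransform_ofFun (hF.memLp_mul hw 2)
  refine ⟨g, hg, weightedNorm_lt_top_of_le hgn 1 zero_le_one fun ξ => ?_⟩
  rw [one_mul, weight_zero_zero]
  gcongr
  exact weight_half_neg_half_le_one hσ ξ

theorem isVanishingOn (hF : IsBoundedCausal G F) :
    Distribution.IsVanishingOn (ofFun F) (causalCylinder G)ᶜ :=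
  isVanishingOn_ofFun fun _ hx => by_contra fun h => hx (hF.support_subset h)

end IsBoundedCausal

/-! ### Piecewise polynomials -/

theorem IsTimePoly.exists_pieces {p N : ℕ} {Δt : ℝ} (hΔ : 0 < Δt) {f : ℝ → ℝ}
    (hf : IsTimePoly p Δt N f) : ∃ P : ℕ → Polynomial ℝ, ∀ t, f t = ∑ n ∈ Finset.range N,
      (Set.Ico (n * Δt) ((n + 1) * Δt)).indicator (fun t => (P n).eval t) t := by
  have hP : ∀ n, ∃ P : Polynomial ℝ, n < N →
      ∀ t ∈ Set.Ico (n * Δt) ((n + 1) * Δt), f t = P.eval t := fun n => by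
    by_cases hn : n < N
    · obtain ⟨P, -, h⟩ := hf.1 n hn
      exact ⟨P, fun _ => h⟩
    · exact ⟨0, fun h => absurd h hn⟩
  choose P hP using hP
  refine ⟨P, fun t => ?_⟩
  by_cases ht : t ∈ Set.Ico 0 (N * Δt)
  · have h0 : 0 ≤ t / Δt := div_nonneg ht.1 hΔ.le
    -- The mesh interval containing `t` has index `⌊t / Δt⌋`; half-open intervals make it the only
    -- one.
    have hmem : t ∈ Set.Ico (⌊t / Δt⌋₊ * Δt) ((⌊t / Δt⌋₊ + 1) * Δt) :=
      ⟨(le_div_iff₀ hΔ).1 (Nat.floor_le h0), (div_lt_iff₀ hΔ).1 (Nat.lt_floor_add_one _)⟩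
    have hN : ⌊t / Δt⌋₊ < N := (Nat.floor_lt h0).2 ((div_lt_iff₀ hΔ).2 ht.2)
    rw [Finset.sum_eq_single_of_mem _ (Finset.mem_range.2 hN), Set.indicator_of_mem hmem,
      hP _ hN t hmem]
    intro n _ hne
    refine Set.indicator_of_notMem (fun h => hne ?_) _
    refine ((Nat.floor_eq_iff h0).2 ⟨(le_div_iff₀ hΔ).2 h.1, (div_lt_iff₀ hΔ).2 h.2⟩).symm
  · rw [hf.2 t ht, Finset.sum_eq_zero]
    intro n hn
    refine Set.indicator_of_notMem (fun h => ht ⟨(by positivity : (0 : ℝ) ≤ n * Δt).trans h.1,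
      h.2.trans_le ?_⟩) _
    gcongr
    exact_mod_cast Finset.mem_range.1 hn

theorem IsTimePoly.measurable {p N : ℕ} {Δt : ℝ} (hΔ : 0 < Δt) {f : ℝ → ℝ}
    (hf : IsTimePoly p Δt N f) : Measurable f := by
  obtain ⟨P, hP⟩ := hf.exists_pieces hΔ
  rw [funext hP]
  exact Finset.measurable_sum _ fun n _ => (P n).continuous.measurable.indicator measurableSet_Ico

theorem IsTimePoly.exists_bound {p N : ℕ} {Δt : ℝ} (hΔ : 0 < Δt) {f : ℝ → ℝ}
    (hf : IsTimePoly p Δt N f) : ∃ C, ∀ t, ‖f t‖ ≤ C := by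
  obtain ⟨P, hP⟩ := hf.exists_pieces hΔ
  choose C hC using fun n : ℕ => (isCompact_Icc (a := n * Δt) (b := (n + 1) * Δt)).exists_bound_of_continuousOn
    (P n).continuous.continuousOn
  refine ⟨∑ n ∈ Finset.range N, |C n|, fun t => ?_⟩
  rw [hP]
  refine (norm_sum_le _ _).trans (Finset.sum_le_sum fun n _ => ?_)
  by_cases h : t ∈ Set.Ico (n * Δt) ((n + 1) * Δt)
  · rw [Set.indicator_of_mem h]
    exact (hC n t (Set.Ico_subset_Icc_self h)).trans (le_abs_self _)
  · rw [Set.indicator_of_notMem h, norm_zero]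
    exact abs_nonneg _

/-- The faces of full dimension are triangles. -/
theorem card_eq_three_of_interior_nonempty {K : Geometry.SimplicialComplex ℝ Plane}
    {S : Finset Plane} (hS : S ∈ K.faces) (h : (interior (convexHull ℝ (S : Set Plane))).Nonempty) :
    S.card = 3 := by
  rw [interior_convexHull_nonempty_iff_affineSpan_eq_top] at h
  have h1 := (K.indep hS).affineSpan_eq_top_iff_card_eq_finrank_add_one
  rw [Subtype.range_coe] at h1
  simpa using h1.1 h

/-- The interior of a triangulation together with the complement is conull. -/
theorem ae_mem_interior_or_notMem {K : Geometry.SimplicialComplex ℝ Plane} (hK : K.faces.Finite) :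
    ∀ᵐ y, (∃ S ∈ K.faces, S.card = 3 ∧ y ∈ interior (convexHull ℝ (S : Set Plane))) ∨
      y ∉ K.space := by
  -- Convex sets have null frontier. Off these finitely many frontiers, a point of the triangulated
  -- set lies in the interior of some face, which must then be a triangle.
  have h : ∀ᵐ y, ∀ S ∈ K.faces, y ∉ frontier (convexHull ℝ (S : Set Plane)) :=
    (ae_ball_iff hK.countable).2 fun S _ =>
      measure_eq_zero_iff_ae_notMem.1 ((convex_convexHull ℝ (S : Set Plane)).addHaar_frontier volume)
  filter_upwards [h] with y hy
  by_cases hyK : y ∈ K.space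
  · obtain ⟨S, hS, hyS⟩ := K.mem_space_iff.1 hyK
    have hi : y ∈ interior (convexHull ℝ (S : Set Plane)) := by
      by_contra hn
      exact hy S hS ⟨subset_closure hyS, hn⟩
    exact Or.inl ⟨S, hS, card_eq_three_of_interior_nonempty hS ⟨y, hi⟩, hi⟩
  · exact Or.inr hyK

theorem continuous_eval_mvPolynomial (P : MvPolynomial (Fin 2) ℝ) :
    Continuous fun y : Plane => MvPolynomial.eval (fun i => y i) P :=
  (MvPolynomial.continuous_eval P).comp (by fun_prop)

theorem isClosed_space {K : Geometry.SimplicialComplex ℝ Plane} (hK : K.faces.Finite) :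
    IsClosed K.space :=
  hK.isClosed_biUnion fun S _ => (S.finite_toSet.isCompact_convexHull (𝕜 := ℝ)).isClosed

theorem IsSpacePoly.aestronglyMeasurable {q : ℕ} {K : Geometry.SimplicialComplex ℝ Plane}
    (hK : K.faces.Finite) {g : Plane → ℝ} (hg : IsSpacePoly q K g) : AEStronglyMeasurable g := by
  have := hK.countable.to_subtype
  have h1 : AEStronglyMeasurable g (volume.restrict (⋃ S : {S // S ∈ K.faces},
      {y | S.1.card = 3 ∧ y ∈ interior (convexHull ℝ (S.1 : Set Plane))})) := by
    refine AEStronglyMeasurable.iUnion fun ⟨S, hS⟩ => ?_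
    by_cases h3 : S.card = 3
    · obtain ⟨P, -, hP⟩ := hg.1 S hS h3
      simp only [h3, true_and, Set.ofPred_mem_eq]
      refine (continuous_eval_mvPolynomial P).aestronglyMeasurable.congr ?_
      filter_upwards [ae_restrict_mem isOpen_interior.measurableSet] with y hy
      exact (hP y hy).symm
    · simp [h3]
  have h2 : AEStronglyMeasurable g (volume.restrict K.spaceᶜ) := by
    refine (aestronglyMeasurable_const (b := (0 : ℝ))).congr ?_
    filter_upwards [ae_restrict_mem (isClosed_space hK).measurableSet.compl] with y hy
    exact (hg.2 y hy).symm
  have h3 := aestronglyMeasurable_union_iff.2 ⟨h1, h2⟩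
  rwa [Measure.restrict_eq_self_of_ae_mem] at h3
  filter_upwards [ae_mem_interior_or_notMem hK] with y hy
  rcases hy with ⟨S, hS, hy⟩ | hy
  · exact Or.inl (Set.mem_iUnion.2 ⟨⟨S, hS⟩, hy⟩)
  · exact Or.inr hy

theorem IsSpacePoly.exists_bound {q : ℕ} {K : Geometry.SimplicialComplex ℝ Plane}
    (hK : K.faces.Finite) {g : Plane → ℝ} (hg : IsSpacePoly q K g) : ∃ C, ∀ᵐ y, ‖g y‖ ≤ C := by
  have hb : ∀ S : Finset Plane, ∃ C : ℝ, S ∈ K.faces → S.card = 3 →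
      ∀ y ∈ interior (convexHull ℝ (S : Set Plane)), ‖g y‖ ≤ C := fun S => by
    by_cases hS : S ∈ K.faces ∧ S.card = 3
    · obtain ⟨P, -, hP⟩ := hg.1 S hS.1 hS.2
      obtain ⟨C, hC⟩ := (S.finite_toSet.isCompact_convexHull (𝕜 := ℝ)).exists_bound_of_continuousOn
        (continuous_eval_mvPolynomial P).continuousOn
      exact ⟨C, fun _ _ y hy => by rw [hP y hy]; exact hC y (interior_subset hy)⟩
    · exact ⟨0, fun h1 h2 => absurd ⟨h1, h2⟩ hS⟩
  choose C hC using hb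
  refine ⟨∑ S ∈ hK.toFinset, |C S|, ?_⟩
  have hnn : 0 ≤ ∑ S ∈ hK.toFinset, |C S| := Finset.sum_nonneg fun _ _ => abs_nonneg _
  filter_upwards [ae_mem_interior_or_notMem hK] with y hy
  rcases hy with ⟨S, hS, h3, hy⟩ | hy
  · refine ((hC S hS h3 y hy).trans (le_abs_self _)).trans ?_
    exact Finset.single_le_sum (f := fun S => |C S|) (fun _ _ => abs_nonneg _)
      (hK.mem_toFinset.2 hS)
  · rw [hg.2 y hy, norm_zero]
    exact hnn

/-- A surjective linear map sends Lebesgue measure to a multiple of Lebesgue measure, so null sets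
of the plane pull back to null sets of space-time. -/
theorem quasiMeasurePreserving_sp : Measure.QuasiMeasurePreserving sp := by
  let L : SpaceTime →ₗ[ℝ] Plane :=
    { toFun := sp
      map_add' := fun x y => by ext i; fin_cases i <;> simp [sp]
      map_smul' := fun c x => by ext i; fin_cases i <;> simp [sp] }
  have hL : Function.Surjective L := fun y => ⟨pt 0 y, by
    ext i; fin_cases i <;> simp [L, sp, pt]⟩
  obtain ⟨c, -, hc⟩ := L.exists_map_addHaar_eq_smul_addHaar volume volume hL
  refine ⟨continuous_sp.measurable, ?_⟩
  change Measure.map L volume ≪ volume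
  rw [hc]
  exact Measure.smul_absolutelyContinuous

theorem isBoundedCausal_mul {p q N : ℕ} {Δt : ℝ} (hΔ : 0 < Δt) {G : Opens Plane}
    (hGb : Bornology.IsBounded (G : Set Plane)) {K : Geometry.SimplicialComplex ℝ Plane}
    (hK : IsTriangulation G K) {f : ℝ → ℝ} {g : Plane → ℝ} (hf : IsTimePoly p Δt N f)
    (hg : IsSpacePoly q K g) : IsBoundedCausal G fun x => f (x 0) * g (sp x) := by
  have hsupp : Function.support (fun x : SpaceTime => f (x 0) * g (sp x)) ⊆
      {x | x 0 ∈ Set.Ico 0 (N * Δt) ∧ sp x ∈ closure (G : Set Plane)} := by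
    intro x hx
    refine ⟨by_contra fun h => left_ne_zero_of_mul hx (hf.2 _ h), ?_⟩
    rw [← hK.2]
    exact by_contra fun h => right_ne_zero_of_mul hx (hg.2 _ h)
  refine ⟨?_, ?_, hsupp.trans fun x hx => ⟨hx.1.1, hx.2⟩, ?_⟩
  · have h0 : Measurable fun x : SpaceTime => x 0 := by fun_prop
    exact ((hf.measurable hΔ).comp h0).aestronglyMeasurable.mul
      ((hg.aestronglyMeasurable hK.1).comp_quasiMeasurePreserving quasiMeasurePreserving_sp)
  · obtain ⟨C, hC⟩ := hf.exists_bound hΔ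
    obtain ⟨D, hD⟩ := hg.exists_bound hK.1
    refine ⟨C * D, ?_⟩
    filter_upwards [quasiMeasurePreserving_sp.ae hD] with x hx
    rw [norm_mul]
    exact mul_le_mul (hC _) hx (norm_nonneg _) ((norm_nonneg _).trans (hC (x 0)))
  · obtain ⟨R, hR⟩ := hGb.closure.subset_closedBall 0
    refine (Metric.isBounded_closedBall (x := (0 : SpaceTime)) (r := N * Δt + R)).subset
      (hsupp.trans fun x hx => ?_)
    have h1 := hR hx.2
    rw [mem_closedBall_zero_iff] at h1 ⊢
    have h2 := norm_nonneg (sp x)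
    refine abs_le_of_sq_le_sq' ?_ (by nlinarith [hx.1.1, hx.1.2]) |>.2
    rw [norm_sq_eq]
    nlinarith [hx.1.1, hx.1.2]

theorem isBoundedCausal_of_mem_piecewisePoly {p q N : ℕ} {Δt : ℝ} (hΔ : 0 < Δt) {G : Opens Plane}
    (hGb : Bornology.IsBounded (G : Set Plane)) {K : Geometry.SimplicialComplex ℝ Plane}
    (hK : IsTriangulation G K) {F : SpaceTime → ℝ} (hF : F ∈ piecewisePoly p q Δt N K) :
    IsBoundedCausal G F := by
  induction hF using Submodule.span_induction with
  | mem F h =>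
    obtain ⟨f, g, hf, hg, rfl⟩ := h
    exact isBoundedCausal_mul hΔ hGb hK hf hg
  | zero => exact IsBoundedCausal.zero
  | add F H _ _ hF hH => exact hF.add hH
  | smul a F _ hF => exact hF.const_smul a

end Discrete

/-! ### Falk's error estimate -/

section Falk

open Filter
open scoped Topology ComplexConjugate Real

variable {σ : ℝ}

/-! ### Weighted norms as integrals -/

theorem weightedNorm_sq {s r : ℝ} (g : SpaceTime → ℂ) :
    weightedNorm s r σ g ^ 2 = ∫⁻ ξ, ENNReal.ofReal (weight s r σ ξ) * ‖g ξ‖ₑ ^ 2 := by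
  rw [weightedNorm, ← ENNReal.rpow_natCast, ← ENNReal.rpow_mul]
  norm_num

theorem ofReal_weight_mul_enorm_sq {s r : ℝ} (g : SpaceTime → ℂ) (ξ : SpaceTime) :
    ENNReal.ofReal (weight s r σ ξ) * ‖g ξ‖ₑ ^ 2 = ENNReal.ofReal (weight s r σ ξ * ‖g ξ‖ ^ 2) := by
  rw [← ofReal_norm, ← ENNReal.ofReal_pow (norm_nonneg _), ← ENNReal.ofReal_mul' (by positivity)]

theorem integrable_weight_mul (hσ : 0 < σ) {s r : ℝ} {g : SpaceTime → ℂ}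
    (hg : AEStronglyMeasurable g) (h : weightedNorm s r σ g < ⊤) :
    Integrable fun ξ => weight s r σ ξ * ‖g ξ‖ ^ 2 := by
  refine ⟨(continuous_weight hσ s r).aestronglyMeasurable.mul (hg.norm.pow 2), ?_⟩
  rw [hasFiniteIntegral_iff_ofReal (Eventually.of_forall fun ξ =>
    mul_nonneg (weight_pos hσ s r ξ).le (sq_nonneg _))]
  simpa only [ofReal_weight_mul_enorm_sq] using weightedNorm_lt_top_iff.1 h

theorem weightedNorm_sq_eq_ofReal (hσ : 0 < σ) {s r : ℝ} {g : SpaceTime → ℂ}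
    (hg : AEStronglyMeasurable g) (h : weightedNorm s r σ g < ⊤) :
    weightedNorm s r σ g ^ 2 = ENNReal.ofReal (∫ ξ, weight s r σ ξ * ‖g ξ‖ ^ 2) := by
  rw [ofReal_integral_eq_lintegral_ofReal (integrable_weight_mul hσ hg h)
    (Eventually.of_forall fun ξ => mul_nonneg (weight_pos hσ s r ξ).le (sq_nonneg _)),
    weightedNorm_sq]
  simp only [ofReal_weight_mul_enorm_sq]

theorem weightedNorm_sub_lt_top (hσ : 0 < σ) {s r : ℝ} {g g' : SpaceTime → ℂ}
    (hg : AEStronglyMeasurable g) (hg' : AEStronglyMeasurable g')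
    (h : weightedNorm s r σ g < ⊤) (h' : weightedNorm s r σ g' < ⊤) :
    weightedNorm s r σ (g - g') < ⊤ := by
  have hi := ((integrable_weight_mul hσ hg h).add (integrable_weight_mul hσ hg' h')).const_mul 2
  rw [weightedNorm_lt_top_iff]
  simp only [ofReal_weight_mul_enorm_sq]
  refine lt_of_le_of_lt (lintegral_mono fun ξ => ENNReal.ofReal_le_ofReal ?_)
    ((hasFiniteIntegral_iff_ofReal (Eventually.of_forall fun ξ => ?_)).1 hi.2)
  · have h1 : ‖(g - g') ξ‖ ^ 2 ≤ 2 * (‖g ξ‖ ^ 2 + ‖g' ξ‖ ^ 2) := by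
      have h2 := norm_sub_le (g ξ) (g' ξ)
      have h3 : ‖(g - g') ξ‖ ^ 2 ≤ (‖g ξ‖ + ‖g' ξ‖) ^ 2 := by
        rw [Pi.sub_apply]
        gcongr
      nlinarith [sq_nonneg (‖g ξ‖ - ‖g' ξ‖)]
    have := mul_le_mul_of_nonneg_left h1 (weight_pos hσ s r ξ).le
    simp only [Pi.add_apply]
    linarith
  · have := weight_pos hσ s r ξ
    simp only [Pi.add_apply, Pi.zero_apply]
    positivity

/-- Hölder's inequality for dual weights. -/
theorem enorm_integral_mul_conj_le (hσ : 0 < σ) (s r : ℝ) {g y : SpaceTime → ℂ}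
    (hg : AEStronglyMeasurable g) (hy : AEStronglyMeasurable y) :
    ‖∫ ξ, g ξ * conj (y ξ)‖ₑ ≤ weightedNorm s r σ g * weightedNorm (-s) (-r) σ y := by
  have hm : ∀ s r : ℝ, ∀ {g : SpaceTime → ℂ}, AEStronglyMeasurable g →
      AEMeasurable fun ξ => ENNReal.ofReal √(weight s r σ ξ) * ‖g ξ‖ₑ := fun s r g hg =>
    ((Real.continuous_sqrt.comp (continuous_weight hσ s r)).measurable.ennreal_ofReal.aemeasurable).mul
      hg.enorm
  have hsq : ∀ s r : ℝ, ∀ g : SpaceTime → ℂ,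
      (∫⁻ ξ, (ENNReal.ofReal √(weight s r σ ξ) * ‖g ξ‖ₑ) ^ (2 : ℝ)) ^ (1 / 2 : ℝ) =
        weightedNorm s r σ g := fun s r g => by
    unfold weightedNorm
    congr 1
    refine lintegral_congr fun ξ => ?_
    rw [show (2 : ℝ) = ((2 : ℕ) : ℝ) by norm_num, ENNReal.rpow_natCast, mul_pow,
      ← ENNReal.ofReal_pow (Real.sqrt_nonneg _), Real.sq_sqrt (weight_pos hσ s r ξ).le]
  have h := ENNReal.lintegral_mul_le_Lp_mul_Lq volume Real.HolderConjugate.two_two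
    (hm s r hg) (hm (-s) (-r) hy)
  rw [hsq, hsq] at h
  refine (enorm_integral_le_lintegral_enorm _).trans (le_trans (le_of_eq ?_) h)
  refine lintegral_congr fun ξ => ?_
  have hw := Real.sqrt_pos.2 (weight_pos hσ s r ξ)
  rw [Pi.mul_apply, mul_mul_mul_comm, ← ENNReal.ofReal_mul hw.le, weight_neg hσ, Real.sqrt_inv,
    mul_inv_cancel₀ hw.ne', ENNReal.ofReal_one, one_mul, enorm_mul, ← ofReal_norm (conj (y ξ)),
    Complex.norm_conj, ofReal_norm]

theorem ae_eq_zero_of_weightedNorm_eq_zero (hσ : 0 < σ) {s r : ℝ} {g : SpaceTime → ℂ}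
    (hg : AEStronglyMeasurable g) (h : weightedNorm s r σ g = 0) : g =ᵐ[volume] 0 := by
  have h1 := weightedNorm_sq (s := s) (r := r) (σ := σ) g
  have hm : AEMeasurable fun ξ => ENNReal.ofReal (weight s r σ ξ) * ‖g ξ‖ₑ ^ 2 :=
    (continuous_weight hσ s r).measurable.ennreal_ofReal.aemeasurable.mul (hg.enorm.pow_const 2)
  rw [h, zero_pow two_ne_zero, eq_comm, lintegral_eq_zero_iff' hm] at h1
  filter_upwards [h1] with ξ hξ
  have hw := weight_pos hσ s r ξ
  simpa [hw, hw.not_ge] using hξ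

/-! ### Functionals together with their transforms -/

/-- `y` is the transform of the functional `v` supported in the closed cylinder, and has finite norm
of order `(1/2, -1/2)`. -/
structure IsTildeTransform (σ : ℝ) (G : Opens Plane) (v : Functional ⊤) (y : SpaceTime → ℂ) :
    Prop where
  hasTransform : HasTransform σ v y
  lt_top : weightedNorm (1 / 2) (-1 / 2) σ y < ⊤
  isVanishingOn : Distribution.IsVanishingOn v (causalCylinder G)ᶜ

/-- `g` is the transform of an extension of `f`, and has finite norm of order `(0, 1/2)`. -/
structure IsQuotTransform (σ : ℝ) (G : Opens Plane) (f : Functional (Q G)) (g : SpaceTime → ℂ) :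
    Prop where
  hasTransform : HasTransform σ f g
  lt_top : weightedNorm 0 (1 / 2) σ g < ⊤

variable {G : Opens Plane}

theorem IsTildeTransform.sub (hσ : 0 < σ) {v v' : Functional ⊤} {y y' : SpaceTime → ℂ}
    (h : IsTildeTransform σ G v y) (h' : IsTildeTransform σ G v' y') :
    IsTildeTransform σ G (v - v') (y - y') where
  hasTransform := h.1.sub h'.1
  lt_top := weightedNorm_sub_lt_top hσ h.1.1 h'.1.1 h.2 h'.2
  isVanishingOn φ hφ := by simp [h.3 φ hφ, h'.3 φ hφ]

theorem IsQuotTransform.sub (hσ : 0 < σ) {f f' : Functional (Q G)} {g g' : SpaceTime → ℂ}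
    (h : IsQuotTransform σ G f g) (h' : IsQuotTransform σ G f' g') :
    IsQuotTransform σ G (f - f') (g - g') where
  hasTransform := h.1.sub h'.1
  lt_top := weightedNorm_sub_lt_top hσ h.1.1 h'.1.1 h.2 h'.2

theorem IsTildeTransform.singleLayer (hσ : 0 < σ) {v : Functional ⊤} {y : SpaceTime → ℂ}
    (h : IsTildeTransform σ G v y) :
    IsQuotTransform σ G (pQ G (singleLayer v)) fun ξ => symbol σ ξ * y ξ where
  hasTransform := (h.1.singleLayer hσ).pQ G
  lt_top := weightedNorm_symbol_mul_lt_top hσ h.2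

theorem IsBoundedCausal.exists_isTildeTransform (hσ : 0 < σ) {F : SpaceTime → ℝ}
    (hF : IsBoundedCausal G F) : ∃ y, IsTildeTransform σ G (ofFun F) y := by
  obtain ⟨y, h1, h2⟩ := hF.exists_hasTransform hσ
  exact ⟨y, h1, h2, hF.isVanishingOn⟩

theorem IsTildeTransform.memTilde {v : Functional ⊤} {y : SpaceTime → ℂ}
    (h : IsTildeTransform σ G v y) : MemTilde (1 / 2) (-1 / 2) σ G v :=
  ⟨h.3, (iInf₂_le y h.1).trans_lt h.2⟩

theorem MemTilde.exists_isTildeTransform {v : Functional ⊤} (h : MemTilde (1 / 2) (-1 / 2) σ G v) :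
    ∃ y, IsTildeTransform σ G v y := by
  obtain ⟨y, h1, h2⟩ := exists_hasTransform_of_sobNorm_lt_top h.2
  exact ⟨y, h1, h2, h.1⟩

theorem MemQuot.exists_isQuotTransform (hσ : 0 < σ) {s : ℝ} (hs : 0 ≤ s) {f : Functional (Q G)}
    (h : MemQuot s (1 / 2) σ G f) : ∃ g, IsQuotTransform σ G f g := by
  obtain ⟨g, h1, h2⟩ := exists_hasTransform_of_sobNorm_lt_top h.2
  exact ⟨g, h1, weightedNorm_lt_top_of_time_le hσ hs h2⟩

theorem IsQuotTransform.pairing_eq (hσ : 0 < σ) (hG : IsLipschitz (G : Set Plane))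
    {f : Functional (Q G)} {v : Functional ⊤} {g y : SpaceTime → ℂ}
    (h : IsQuotTransform σ G f g) (hv : IsTildeTransform σ G v y) :
    pairing 0 (1 / 2) σ f v = ∫ ξ, g ξ * conj (y ξ) :=
  Punch.pairing_eq hσ hG h.1 h.2 hv.1 (weight_zero_neg_half_norm hv.2 hσ) hv.3

theorem IsQuotTransform.integrable (hσ : 0 < σ) (hG : IsLipschitz (G : Set Plane))
    {f : Functional (Q G)} {v : Functional ⊤} {g y : SpaceTime → ℂ}
    (h : IsQuotTransform σ G f g) (hv : IsTildeTransform σ G v y) :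
    Integrable fun ξ => g ξ * conj (y ξ) :=
  (integral_mul_conj_eq_of_hasTransform hσ hG h.1 h.2 h.1 h.2 hv.1
    (weight_zero_neg_half_norm hv.2 hσ) hv.3).1

/-- The duality estimate. -/
theorem IsQuotTransform.enorm_integral_le (hσ : 0 < σ) (hG : IsLipschitz (G : Set Plane))
    {f : Functional (Q G)} {v : Functional ⊤}
    {g y : SpaceTime → ℂ} (h : IsQuotTransform σ G f g) (hv : IsTildeTransform σ G v y) :
    ‖∫ ξ, g ξ * conj (y ξ)‖ₑ ≤ sobNorm (1 / 2) (1 / 2) σ f * weightedNorm (-1 / 2) (-1 / 2) σ y := by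
  have hy : weightedNorm (-1 / 2) (-1 / 2) σ y < ⊤ :=
    weightedNorm_lt_top_of_time_le hσ (by norm_num) hv.2
  -- The convention `∞ · 0 = 0` matters here: if the norm of `y` vanishes, then `y = 0` almost
  -- everywhere and the integral is zero. Otherwise one may divide by that norm and take the infimum
  -- over extensions `g'`, each of which gives the same integral.
  by_cases h0 : weightedNorm (-1 / 2) (-1 / 2) σ y = 0
  · have hae := ae_eq_zero_of_weightedNorm_eq_zero hσ hv.1.1 h0
    have : ∫ ξ, g ξ * conj (y ξ) = 0 := by
      refine integral_eq_zero_of_ae ?_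
      filter_upwards [hae] with ξ hξ
      simp [hξ]
    simp [this]
  rw [← ENNReal.div_le_iff h0 hy.ne]
  refine le_iInf₂ fun g' hg' => ?_
  rcases eq_top_or_lt_top (weightedNorm (1 / 2) (1 / 2) σ g') with ht | ht
  · rw [ht]
    exact le_top
  have hq : IsQuotTransform σ G f g' :=
    ⟨hg', weightedNorm_lt_top_of_time_le hσ (by norm_num) ht⟩
  rw [ENNReal.div_le_iff h0 hy.ne, (integral_mul_conj_eq_of_hasTransform hσ hG h.1 h.2 hq.1 hq.2 hv.1
    (weight_zero_neg_half_norm hv.2 hσ) hv.3).2]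
  have := enorm_integral_mul_conj_le hσ (1 / 2) (1 / 2) hg'.1 hv.1.1
  rwa [← neg_div] at this

/-! ### The abstract error estimate -/

/-- Falk's argument on the frequency side: `e` is the error, `d` the best approximation error and `w`
the residual. -/
theorem falk_estimate (hσ : 0 < σ) {e d w : SpaceTime → ℂ}
    (he : Integrable fun ξ => weight (-1 / 2) (-1 / 2) σ ξ * ‖e ξ‖ ^ 2)
    (hd : Integrable fun ξ => weight (1 / 2) (-1 / 2) σ ξ * ‖d ξ‖ ^ 2)
    (hwe : Integrable fun ξ => w ξ * conj (e ξ)) (hwd : Integrable fun ξ => w ξ * conj (d ξ))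
    (hee : Integrable fun ξ => symbol σ ξ * e ξ * conj (e ξ))
    (hed : Integrable fun ξ => symbol σ ξ * e ξ * conj (d ξ))
    (h1 : 0 ≤ (∫ ξ, w ξ * conj (e ξ)).re)
    (h2 : (∫ ξ, (w ξ + symbol σ ξ * e ξ) * conj (e ξ - d ξ)).re ≤ 0) :
    σ * ∫ ξ, weight (-1 / 2) (-1 / 2) σ ξ * ‖e ξ‖ ^ 2 ≤
      2 * ‖∫ ξ, w ξ * conj (d ξ)‖ + σ⁻¹ * ∫ ξ, weight (1 / 2) (-1 / 2) σ ξ * ‖d ξ‖ ^ 2 := by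
  have hsplit : ∫ ξ, (w ξ + symbol σ ξ * e ξ) * conj (e ξ - d ξ) =
      (∫ ξ, w ξ * conj (e ξ)) + (∫ ξ, symbol σ ξ * e ξ * conj (e ξ)) -
        ((∫ ξ, w ξ * conj (d ξ)) + ∫ ξ, symbol σ ξ * e ξ * conj (d ξ)) := by
    rw [← integral_add' hwe hee, ← integral_add' hwd hed,
      ← integral_sub' (hwe.add hee) (hwd.add hed)]
    refine integral_congr_ae (Eventually.of_forall fun ξ => ?_)
    simp only [map_sub, Pi.add_apply, Pi.sub_apply]
    ring
  have hmul : ∀ ξ, (symbol σ ξ * e ξ * conj (e ξ)).re = (symbol σ ξ).re * ‖e ξ‖ ^ 2 := fun ξ => by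
    rw [mul_assoc, Complex.mul_conj', ← Complex.ofReal_pow, Complex.re_mul_ofReal]
  have hre : (∫ ξ, symbol σ ξ * e ξ * conj (e ξ)).re = ∫ ξ, (symbol σ ξ).re * ‖e ξ‖ ^ 2 := by
    rw [← RCLike.re_eq_complex_re, ← integral_re hee]
    simp only [RCLike.re_eq_complex_re, hmul]
  have hei : Integrable fun ξ => (symbol σ ξ).re * ‖e ξ‖ ^ 2 := by
    have := hee.re
    simpa only [RCLike.re_eq_complex_re, hmul] using this
  have hlow : σ * ∫ ξ, weight (-1 / 2) (-1 / 2) σ ξ * ‖e ξ‖ ^ 2 ≤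
      ∫ ξ, (symbol σ ξ).re * ‖e ξ‖ ^ 2 := by
    rw [← integral_const_mul]
    refine integral_mono (he.const_mul σ) hei fun ξ => ?_
    have := mul_le_mul_of_nonneg_right (le_symbol_re hσ ξ) (sq_nonneg ‖e ξ‖)
    linarith
  -- Young's inequality with `|m|² ≤ Re m · σ⁻¹ · weight (1/2) (-1/2)`: half of the coercive term is
  -- spent here and absorbed at the end, which produces the factor `2` before the residual term.
  have hcross : (∫ ξ, symbol σ ξ * e ξ * conj (d ξ)).re ≤
      (1 / 2) * ∫ ξ, ((symbol σ ξ).re * ‖e ξ‖ ^ 2 + σ⁻¹ * (weight (1 / 2) (-1 / 2) σ ξ * ‖d ξ‖ ^ 2)) := by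
    refine (Complex.re_le_norm _).trans ((norm_integral_le_integral_norm _).trans ?_)
    rw [← integral_const_mul]
    refine integral_mono hed.norm ((hei.add (hd.const_mul _)).const_mul _) fun ξ => ?_
    have ha : 0 ≤ (symbol σ ξ).re := (mul_pos hσ (weight_pos hσ _ _ ξ)).le.trans (le_symbol_re hσ ξ)
    have hb : 0 ≤ σ⁻¹ * weight (1 / 2) (-1 / 2) σ ξ :=
      mul_nonneg (inv_nonneg.2 hσ.le) (weight_pos hσ _ _ ξ).le
    have hab := norm_symbol_sq_le hσ ξ
    rw [norm_mul, norm_mul, Complex.norm_conj]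
    generalize (symbol σ ξ).re = a at ha hab ⊢
    refine abs_le_of_sq_le_sq' ?_ (mul_nonneg (by norm_num) (add_nonneg (by positivity)
      (by rw [← mul_assoc]; positivity))) |>.2
    calc (‖symbol σ ξ‖ * ‖e ξ‖ * ‖d ξ‖) ^ 2 = ‖symbol σ ξ‖ ^ 2 * (‖e ξ‖ * ‖d ξ‖) ^ 2 := by ring
      _ ≤ (a * (σ⁻¹ * weight (1 / 2) (-1 / 2) σ ξ)) * (‖e ξ‖ * ‖d ξ‖) ^ 2 := by gcongr
      _ ≤ _ := by
        nlinarith [sq_nonneg (a * ‖e ξ‖ ^ 2 - σ⁻¹ * (weight (1 / 2) (-1 / 2) σ ξ * ‖d ξ‖ ^ 2))]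
  rw [integral_add hei (hd.const_mul _), integral_const_mul] at hcross
  rw [hsplit] at h2
  simp only [Complex.add_re, Complex.sub_re, hre] at h2
  have hx := Complex.re_le_norm (∫ ξ, w ξ * conj (d ξ))
  linarith

/-- The error estimate for a fixed discrete function. -/
theorem sobNorm_sub_sq_le (hσ : 0 < σ) (hG : IsLipschitz (G : Set Plane))
    {h : Functional (Q G)} {u v φ : Functional ⊤} {H U W Φ : SpaceTime → ℂ}
    (hh : IsQuotTransform σ G h H) (hu : IsTildeTransform σ G u U)
    (hv : IsTildeTransform σ G v W) (hφ : IsTildeTransform σ G φ Φ)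
    (h1 : (pairing 0 (1 / 2) σ h (v - u)).re ≤ (pairing 0 (1 / 2) σ (pQ G (singleLayer u)) (v - u)).re)
    (h2 : (pairing 0 (1 / 2) σ h (φ - v)).re ≤ (pairing 0 (1 / 2) σ (pQ G (singleLayer v)) (φ - v)).re) :
    sobNorm (-1 / 2) (-1 / 2) σ (u - v) ^ 2 ≤ ENNReal.ofReal (2 / σ + 1 / σ ^ 2) *
      (sobNorm (1 / 2) (1 / 2) σ (h - pQ G (singleLayer u)) * sobNorm (-1 / 2) (-1 / 2) σ (u - φ) +
        sobNorm (1 / 2) (-1 / 2) σ (u - φ) ^ 2) := by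
  have he := hu.sub hσ hv
  have hd := hu.sub hσ hφ
  have hw := hh.sub hσ (hu.singleLayer hσ)
  have hwv := hh.sub hσ (hv.singleLayer hσ)
  have hme := he.singleLayer hσ
  have hvu := hv.sub hσ hu
  have hφv := hφ.sub hσ hv
  have heN : weightedNorm (-1 / 2) (-1 / 2) σ (U - W) < ⊤ :=
    weightedNorm_lt_top_of_time_le hσ (by norm_num) he.2
  have hdN : weightedNorm (-1 / 2) (-1 / 2) σ (U - Φ) < ⊤ :=
    weightedNorm_lt_top_of_time_le hσ (by norm_num) hd.2
  have hest := falk_estimate hσ (e := U - W) (d := U - Φ)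
    (w := H - fun ξ => symbol σ ξ * U ξ)
    (integrable_weight_mul hσ he.1.1 heN) (integrable_weight_mul hσ hd.1.1 hd.2)
    (hw.integrable hσ hG he) (hw.integrable hσ hG hd) (hme.integrable hσ hG he)
    (hme.integrable hσ hG hd)
    -- The continuous inequality for `u`, tested with the discrete solution, with the signs arranged
    -- as `Re⟨h - Vu, u - v⟩ ≥ 0`.
    (by
      rw [hh.pairing_eq hσ hG hvu, (hu.singleLayer hσ).pairing_eq hσ hG hvu] at h1
      have : ∫ ξ, (H - fun ξ => symbol σ ξ * U ξ) ξ * conj ((U - W) ξ) =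
          (∫ ξ, symbol σ ξ * U ξ * conj ((W - U) ξ)) - ∫ ξ, H ξ * conj ((W - U) ξ) := by
        rw [← integral_sub ((hu.singleLayer hσ).integrable hσ hG hvu) (hh.integrable hσ hG hvu)]
        refine integral_congr_ae (Eventually.of_forall fun ξ => ?_)
        simp only [Pi.sub_apply, map_sub]
        ring
      rw [this, Complex.sub_re]
      linarith)
    -- The discrete inequality tested with `φ`, using `h - Vv = (h - Vu) + V(u - v)` and `φ - v = (u
    -- - v) - (u - φ)`.
    (by
      rw [hh.pairing_eq hσ hG hφv, (hv.singleLayer hσ).pairing_eq hσ hG hφv] at h2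
      have : ∫ ξ, ((H - fun ξ => symbol σ ξ * U ξ) ξ + symbol σ ξ * (U - W) ξ) *
          conj ((U - W) ξ - (U - Φ) ξ) =
          (∫ ξ, H ξ * conj ((Φ - W) ξ)) - ∫ ξ, symbol σ ξ * W ξ * conj ((Φ - W) ξ) := by
        rw [← integral_sub (hh.integrable hσ hG hφv) ((hv.singleLayer hσ).integrable hσ hG hφv)]
        refine integral_congr_ae (Eventually.of_forall fun ξ => ?_)
        simp only [Pi.sub_apply, map_sub]
        ring
      rw [this, Complex.sub_re]
      linarith)
  have hX := hw.enorm_integral_le hσ hG hd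
  have hmono1 := weightedNorm_le_sobNorm hσ (s := -1 / 2) le_rfl hd.1 hdN
  have hmono2 := weightedNorm_le_sobNorm hσ (s := 1 / 2) (by norm_num) hd.1 hdN
  have hle : sobNorm (-1 / 2) (-1 / 2) σ (u - v) ≤ weightedNorm (-1 / 2) (-1 / 2) σ (U - W) :=
    iInf₂_le _ he.1
  refine (pow_le_pow_left₀ zero_le hle 2).trans ?_
  rw [weightedNorm_sq_eq_ofReal hσ he.1.1 heN]
  have hD := weightedNorm_sq_eq_ofReal hσ hd.1.1 hd.2
  generalize (∫ ξ, (H - fun ξ => symbol σ ξ * U ξ) ξ * conj ((U - Φ) ξ)) = X at hest hX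
  have hDn : 0 ≤ ∫ ξ, weight (1 / 2) (-1 / 2) σ ξ * ‖(U - Φ) ξ‖ ^ 2 :=
    integral_nonneg fun ξ => mul_nonneg (weight_pos hσ _ _ ξ).le (sq_nonneg _)
  generalize (∫ ξ, weight (1 / 2) (-1 / 2) σ ξ * ‖(U - Φ) ξ‖ ^ 2) = D at hest hD hDn
  generalize (∫ ξ, weight (-1 / 2) (-1 / 2) σ ξ * ‖(U - W) ξ‖ ^ 2) = E at hest
  -- Dividing by `σ` leaves the constants `2/σ` and `1/σ²`; their sum bounds both.
  have hE : E ≤ (2 / σ + 1 / σ ^ 2) * (‖X‖ + D) := by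
    have hXn := norm_nonneg X
    have h3 : E ≤ σ⁻¹ * (2 * ‖X‖ + σ⁻¹ * D) := by
      rw [inv_mul_eq_div, le_div_iff₀ hσ]
      linarith
    refine h3.trans (sub_nonneg.1 ?_)
    have : (2 / σ + 1 / σ ^ 2) * (‖X‖ + D) - σ⁻¹ * (2 * ‖X‖ + σ⁻¹ * D) =
        1 / σ ^ 2 * ‖X‖ + 2 / σ * D := by
      field_simp
      ring
    rw [this]
    positivity
  calc ENNReal.ofReal E ≤ ENNReal.ofReal ((2 / σ + 1 / σ ^ 2) * (‖X‖ + D)) :=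
        ENNReal.ofReal_le_ofReal hE
    _ = ENNReal.ofReal (2 / σ + 1 / σ ^ 2) * (‖X‖ₑ + weightedNorm (1 / 2) (-1 / 2) σ (U - Φ) ^ 2) := by
        rw [ENNReal.ofReal_mul (by positivity), ENNReal.ofReal_add (norm_nonneg _) hDn, hD, ofReal_norm]
    _ ≤ _ := by
        gcongr
        exact hX.trans (by gcongr)

end Falk

end

end Punch

/-- A priori estimate of Falk type for the Galerkin approximation of the punch problem. The constant
depends on `σ` only. The discrete space `S` is any linear space of piecewise polynomials on the
space-time mesh, in particular the one generated by products of functions which are continuous, vanish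
at `t = 0` (if `p ≥ 1`), and vanish on the boundary of `G` (if `q ≥ 1`). -/
theorem theorem7p3 (σ : ℝ) (hσ : 0 < σ) :
    ∃ C : ℝ, 0 < C ∧
      ∀ (G : TopologicalSpace.Opens Punch.Plane),
        Bornology.IsBounded (G : Set Punch.Plane) → Punch.IsLipschitz (G : Set Punch.Plane) →
      ∀ (K : Geometry.SimplicialComplex ℝ Punch.Plane), Punch.IsTriangulation G K →
      ∀ (p q N : ℕ) (Δt : ℝ), 0 < Δt →
      ∀ (S : Submodule ℝ (Punch.SpaceTime → ℝ)), S ≤ Punch.piecewisePoly p q Δt N K →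
      ∀ (h : 𝓓'(Punch.Q G, ℂ)), Punch.MemQuot (3 / 2) (1 / 2) σ G h →
      ∀ (u : 𝓓'((⊤ : TopologicalSpace.Opens Punch.SpaceTime), ℂ)), Punch.IsSolution σ G h u →
      ∀ (uh : Punch.SpaceTime → ℝ), Punch.IsDiscreteSolution σ G h S uh →
        Punch.sobNorm (-1 / 2) (-1 / 2) σ (⇑u - Punch.ofFun uh) ^ 2 ≤
          ENNReal.ofReal C * ⨅ φ ∈ Punch.nonnegCone S,
            (Punch.sobNorm (1 / 2) (1 / 2) σ (⇑h - Punch.pQ G (Punch.singleLayer u)) *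
                Punch.sobNorm (-1 / 2) (-1 / 2) σ (⇑u - Punch.ofFun φ) +
              Punch.sobNorm (1 / 2) (-1 / 2) σ (⇑u - Punch.ofFun φ) ^ 2) := by
  have hC : 0 < 2 / σ + 1 / σ ^ 2 := by positivity
  refine ⟨2 / σ + 1 / σ ^ 2, hC, ?_⟩
  intro G hGb hG K hK p q N Δt hΔ S hS h hh u hu uh huh
  have hbc : ∀ F ∈ Punch.nonnegCone S, Punch.IsBoundedCausal G F := fun F hF =>
    Punch.isBoundedCausal_of_mem_piecewisePoly hΔ hGb hK (hS hF.1)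
  obtain ⟨H, hH⟩ := Punch.MemQuot.exists_isQuotTransform hσ (by norm_num) hh
  obtain ⟨U, hU⟩ := Punch.MemTilde.exists_isTildeTransform hu.1
  have hbuh := hbc uh huh.1
  obtain ⟨W, hW⟩ := hbuh.exists_isTildeTransform hσ
  -- The discrete solution defines a nonnegative distribution of finite energy norm, hence an
  -- admissible competitor for `u`.
  have h1 := hu.2.2 (Punch.ofFunDistribution uh hbuh.locallyIntegrable) hW.memTilde
    (Punch.nonneg_ofFun huh.1.2)
  rw [Punch.coe_ofFunDistribution] at h1
  have hC0 : ENNReal.ofReal (2 / σ + 1 / σ ^ 2) ≠ 0 := by simpa using hC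
  -- The constant is moved to the left, so that the bound can be proved for each `φ` under the
  -- infimum.
  rw [mul_comm, ← ENNReal.div_le_iff hC0 ENNReal.ofReal_ne_top]
  refine le_iInf₂ fun φ hφ => ?_
  rw [ENNReal.div_le_iff hC0 ENNReal.ofReal_ne_top, mul_comm]
  obtain ⟨Φ, hΦ⟩ := (hbc φ hφ).exists_isTildeTransform hσ
  exact Punch.sobNorm_sub_sq_le hσ hG hH hU hW hΦ h1 (huh.2 φ hφ)
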